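/- **Proposition (potentials in $L_0^{q,\infty}$ are admissible).** Let $d\ge 2$ and $m\ge 1$ be integers. *Notation.* For $\alpha\in\mathbb R$ let $S_\alpha=(1-\Delta)^{\alpha/2}$ on $\mathcal S'(\mathbb R^d)$. Put $p_d=\frac{2d+2}{d+3}$, $p_d'=\frac{2d+2}{d-1}$, $\theta=m-\frac d{d+1}$, and let $L^{p,r}$ be the Lorentz spaces, with $\|f\|_{L^{q,\infty}}=\sup_{t>0}t\,|\{|f|>t\}|^{1/q}$. Let $W_\alpha^{p,r}=\{u\in\mathcal S':S_\alpha u\in L^{p,r}\}$ with $\|u\|_{W_\alpha^{p,r}}=\|S_\alpha u\|_{L^{p,r}}$. With $D_0=\{|x|\le1\}$ and $D_j=\{2^{j-1}\le|x|\le2^j\}$ for $j\ge1$, let $B$, $B^*$ be the spaces of (measurable) functions $f:\mathbb R^d\to\mathbb C$ with finite norm $$\|f\|_B=\sum_{j\ge0}2^{j/2}\|f\|_{L^2(D_j)},\qquad \|f\|_{B^*}=\sup_{j\ge0}2^{-j/2}\|f\|_{L^2(D_j)}.$$ Let $$X=W_{-\theta}^{p_d,2}+S_m(B),\qquad X^*=W_{\theta}^{p_d',2}\cap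 S_{-m}(B^*),$$ with the usual sum and intersection norms. The pairing of $T=S_\theta F_1+S_mF_2\in X$ ($F_1\in L^{p_d,2}$, $F_2\in B$) with $g\in X^*$ is $\langle T,g\rangle=\int F_1\overline{S_\theta g}+\int F_2\overline{S_m g}$ (independent of the decomposition), and $\langle g,T\rangle=\overline{\langle T,g\rangle}$. For $N\ge0$ and $\gamma\in(0,1]$ let $\mu_{N,\gamma}(x)=\frac{(1+|x|^2)^N}{(1+\gamma|x|^2)^N}$. Let $L_0^{q,\infty}$ be the closure of $C_c^\infty(\mathbb R^d)$ with respect to $\|\cdot\|_{L^{q,\infty}}$. *Definition.* A linear operator $V:X^*\to X$ is an *admissible perturbation* of $(-\Delta)^m$ if 1. (P1) $V\in\mathcal B(X^*,X)$ and $\langle V\phi,\psi\rangle=\langle\phi,V\psi\rangle$ for all $\phi,\psi\in\mathcal S(\mathbb R^d)$; 2. (P2) for all $\varepsilon>0$ and $N\ge0$ there are $A_{N,\varepsilon},R_{N,\varepsilon}\in[1,\infty)$ such that for all $u\in X^*$ and $\gamma\in(0,1]$ $$\|\mu_{N,\gamma}Vu\|_X\le\varepsilon\|\mu_{N,\gamma}u\|_{X^*}+A_{N,\varepsilon}\|u\,1_{\{|x|\le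 R_{N,\varepsilon}\}}\|_{L^2};$$ 3. (P3) there are an integer $J\ge1$ and $A_j,B_j\in\mathcal B(X^*,L^2)$, $1\le j\le J$, with $\langle Vf,g\rangle=\sum_{j=1}^J\langle B_jf,A_jg\rangle$ for all $f,g\in X^*$. *Statement.* Let $q$ be a real number with $$\frac d{2m}\le q\le\frac{d+1}2\qquad\text{and}\qquad q>1,$$ and let $V:\mathbb R^d\to\mathbb R$ be a function in $L_0^{q,\infty}(\mathbb R^d)$. Then every $u\in X^*$ is a function, pointwise multiplication $u\mapsto Vu$ defines a linear operator from $X^*$ to $X$, and this operator is an admissible perturbation of $(-\Delta)^m$. -/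

import Mathlib

open MeasureTheory TemperedDistribution Set
open scoped SchwartzMap ENNReal NNReal ComplexConjugate

noncomputable section

namespace HighOrderSchrodinger

/-- Euclidean space `ℝ^d`. -/
abbrev E (d : ℕ) : Type := EuclideanSpace ℝ (Fin d)

/-! ### Lorentz spaces -/

/-- The distribution function `t ↦ |{x : |f x| > t}|`. -/
def distFun {d : ℕ} (f : E d → ℂ) (t : ℝ) : ℝ≥0∞ := volume {x | t < ‖f x‖}

/-- The quasi-norm of the Lorentz space `L^{p,r}`, for finite `p, r`:
`(r ∫_0^∞ t^{r-1} |{|f| > t}|^{r/p} dt)^{1/r}`, which is the same number as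
`((r/p) ∫_0^∞ (s^{1/p} f^*(s))^r ds/s)^{1/r}`. -/
def lorentzNorm {d : ℕ} (p r : ℝ) (f : E d → ℂ) : ℝ≥0∞ :=
  (ENNReal.ofReal r *
    ∫⁻ t in Ioi (0 : ℝ), ENNReal.ofReal (t ^ (r - 1)) * distFun f t ^ (r / p)) ^ (1 / r)

/-- The quasi-norm of the weak Lebesgue space `L^{q,∞}`: `sup_{t > 0} t |{|f| > t}|^{1/q}`. -/
def weakNorm {d : ℕ} (q : ℝ) (f : E d → ℂ) : ℝ≥0∞ :=
  ⨆ (t : ℝ) (_ : 0 < t), ENNReal.ofReal t * distFun f t ^ (1 / q)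

/-- `f ∈ L_0^{q,∞}`: `f` is a limit of functions in `C_c^∞` with respect to the
`L^{q,∞}` quasi-norm. -/
def MemWeakZero {d : ℕ} (q : ℝ) (f : E d → ℂ) : Prop :=
  AEStronglyMeasurable f volume ∧
    ∀ ε : ℝ≥0∞, 0 < ε → ∃ φ : E d → ℂ, ContDiff ℝ (⊤ : ℕ∞) φ ∧ HasCompactSupport φ ∧
      weakNorm q (fun x ↦ f x - φ x) < ε

/-! ### The Agmon–Hörmander spaces -/

/-- The dyadic shells: `D_0 = {|x| ≤ 1}` and `D_j = {2^{j-1} ≤ |x| ≤ 2^j}` for `j ≥ 1`. -/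
def shell (d : ℕ) : ℕ → Set (E d)
  | 0 => {x | ‖x‖ ≤ 1}
  | j + 1 => {x | (2 : ℝ) ^ j ≤ ‖x‖ ∧ ‖x‖ ≤ (2 : ℝ) ^ (j + 1)}

/-- The norm of `B`. -/
def normB {d : ℕ} (f : E d → ℂ) : ℝ≥0∞ :=
  ∑' j : ℕ, (2 : ℝ≥0∞) ^ ((j : ℝ) / 2) * eLpNorm f 2 (volume.restrict (shell d j))

/-- The norm of `B^*`. -/
def normBStar {d : ℕ} (f : E d → ℂ) : ℝ≥0∞ :=
  ⨆ j : ℕ, (2 : ℝ≥0∞) ^ (-((j : ℝ) / 2)) * eLpNorm f 2 (volume.restrict (shell d j))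

/-! ### Functions as tempered distributions -/

/-- The tempered distribution `T` is the function `f`: `T φ = ∫ φ f` for all Schwartz `φ`,
with absolutely convergent integrals. -/
def IsFun {d : ℕ} (T : 𝓢'(E d, ℂ)) (f : E d → ℂ) : Prop :=
  AEStronglyMeasurable f volume ∧
    ∀ φ : 𝓢(E d, ℂ), Integrable (fun x ↦ φ x * f x) ∧ T φ = ∫ x, φ x * f x

/-- The value of a function (quasi-)norm `N` on a tempered distribution: `N f` if the
distribution is a function `f` (which is then unique up to null sets), and `∞` otherwise. -/
def distNorm {d : ℕ} (N : (E d → ℂ) → ℝ≥0∞) (T : 𝓢'(E d, ℂ)) : ℝ≥0∞ :=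
  ⨅ (f : E d → ℂ) (_ : IsFun T f), N f

/-- The Bessel potential `S_α = (1 - Δ)^{α/2}`. With Mathlib's convention
`𝓕 f ξ = ∫ e^{-2 π i x·ξ} f x dx` its symbol is `(1 + |2 π ξ|²)^{α/2}`. -/
def S {d : ℕ} (α : ℝ) : 𝓢'(E d, ℂ) →L[ℂ] 𝓢'(E d, ℂ) :=
  fourierMultiplierCLM ℂ (fun ξ : E d ↦ (((1 + ‖(2 * Real.pi) • ξ‖ ^ 2) ^ (α / 2) : ℝ) : ℂ))

/-! ### The spaces `X` and `X^*` -/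

/-- The exponent `p_d = (2d+2)/(d+3)`. -/
def pd (d : ℕ) : ℝ := (2 * d + 2) / (d + 3)

/-- The exponent `p_d' = (2d+2)/(d-1)`. -/
def pd' (d : ℕ) : ℝ := (2 * d + 2) / ((d : ℝ) - 1)

/-- `θ_{m,d} = m - d/(d+1)`. -/
def theta (m d : ℕ) : ℝ := m - (d : ℝ) / (d + 1)

/-- The norm of `X = W_{-θ}^{p_d,2} + S_m(B)`. -/
def normX {d : ℕ} (m : ℕ) (T : 𝓢'(E d, ℂ)) : ℝ≥0∞ :=
  ⨅ (T₁ : 𝓢'(E d, ℂ)) (T₂ : 𝓢'(E d, ℂ)) (_ : T = T₁ + T₂),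
    distNorm (lorentzNorm (pd d) 2) (S (-theta m d) T₁) + distNorm normB (S (-(m : ℝ)) T₂)

/-- The norm of `X^* = W_θ^{p_d',2} ∩ S_{-m}(B^*)`. -/
def normXStar {d : ℕ} (m : ℕ) (T : 𝓢'(E d, ℂ)) : ℝ≥0∞ :=
  max (distNorm (lorentzNorm (pd' d) 2) (S (theta m d) T)) (distNorm normBStar (S (m : ℝ) T))

/-! #### Facts showing that `X` and `X^*` are vector spaces -/

lemma isFun_zero {d : ℕ} : IsFun (0 : 𝓢'(E d, ℂ)) 0 :=
  ⟨aestronglyMeasurable_zero, fun φ ↦ by simp⟩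

lemma IsFun.add {d : ℕ} {T U : 𝓢'(E d, ℂ)} {f g : E d → ℂ} (hf : IsFun T f) (hg : IsFun U g) :
    IsFun (T + U) (f + g) := by
  refine ⟨hf.1.add hg.1, fun φ ↦ ?_⟩
  have h1 := hf.2 φ
  have h2 := hg.2 φ
  have e : (fun x ↦ φ x * (f + g) x) = (fun x ↦ φ x * f x) + fun x ↦ φ x * g x := by
    ext x; simp [mul_add]
  refine ⟨by rw [e]; exact h1.1.add h2.1, ?_⟩
  rw [e]
  rw [integral_add' h1.1 h2.1, ← h1.2, ← h2.2]
  rfl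

lemma IsFun.smul {d : ℕ} {T : 𝓢'(E d, ℂ)} {f : E d → ℂ} (c : ℂ) (hf : IsFun T f) :
    IsFun (c • T) (c • f) := by
  refine ⟨hf.1.const_smul c, fun φ ↦ ?_⟩
  have h1 := hf.2 φ
  have e : (fun x ↦ φ x * (c • f) x) = fun x ↦ c * (φ x * f x) := by
    ext x; simp; ring
  refine ⟨by rw [e]; exact h1.1.const_mul c, ?_⟩
  rw [e, integral_const_mul, ← h1.2]
  rfl

lemma distNorm_lt_top {d : ℕ} {N : (E d → ℂ) → ℝ≥0∞} {T : 𝓢'(E d, ℂ)} :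
    distNorm N T < ∞ ↔ ∃ f, IsFun T f ∧ N f < ∞ := by
  simp [distNorm, iInf_lt_iff]

lemma distNorm_zero_lt {d : ℕ} {N : (E d → ℂ) → ℝ≥0∞} (hN : N 0 < ∞) :
    distNorm N (0 : 𝓢'(E d, ℂ)) < ∞ := distNorm_lt_top.2 ⟨0, isFun_zero, hN⟩

lemma distNorm_add_lt {d : ℕ} {N : (E d → ℂ) → ℝ≥0∞} {T U : 𝓢'(E d, ℂ)}
    (hN : ∀ f g, AEStronglyMeasurable f volume → AEStronglyMeasurable g volume →
      N f < ∞ → N g < ∞ → N (f + g) < ∞)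
    (hT : distNorm N T < ∞) (hU : distNorm N U < ∞) : distNorm N (T + U) < ∞ := by
  obtain ⟨f, hf, hf'⟩ := distNorm_lt_top.1 hT
  obtain ⟨g, hg, hg'⟩ := distNorm_lt_top.1 hU
  exact distNorm_lt_top.2 ⟨_, hf.add hg, hN f g hf.1 hg.1 hf' hg'⟩

lemma distNorm_smul_lt {d : ℕ} {N : (E d → ℂ) → ℝ≥0∞} {T : 𝓢'(E d, ℂ)} (c : ℂ)
    (hN : ∀ f, N f < ∞ → N (c • f) < ∞)
    (hT : distNorm N T < ∞) : distNorm N (c • T) < ∞ := by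
  obtain ⟨f, hf, hf'⟩ := distNorm_lt_top.1 hT
  exact distNorm_lt_top.2 ⟨_, hf.smul c, hN f hf'⟩

lemma normB_zero {d : ℕ} : normB (0 : E d → ℂ) < ∞ := by
  simp [normB]

lemma normB_add {d : ℕ} (f g : E d → ℂ) (hf : AEStronglyMeasurable f volume)
    (hg : AEStronglyMeasurable g volume) (h1 : normB f < ∞) (h2 : normB g < ∞) :
    normB (f + g) < ∞ := by
  refine lt_of_le_of_lt ?_ (ENNReal.add_lt_top.2 ⟨h1, h2⟩)
  rw [normB, normB, normB, ← ENNReal.tsum_add]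
  refine ENNReal.tsum_le_tsum fun j ↦ ?_
  rw [← mul_add]
  gcongr
  exact eLpNorm_add_le hf.restrict hg.restrict (by norm_num)

lemma normB_smul {d : ℕ} (c : ℂ) (f : E d → ℂ) (h : normB f < ∞) : normB (c • f) < ∞ := by
  have : normB (c • f) = ‖c‖ₑ * normB f := by
    rw [normB, normB, ← ENNReal.tsum_mul_left]
    refine tsum_congr fun j ↦ ?_
    rw [eLpNorm_const_smul]
    ring
  rw [this]
  exact ENNReal.mul_lt_top (by simp) h

lemma normBStar_zero {d : ℕ} : normBStar (0 : E d → ℂ) < ∞ := by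
  simp [normBStar]

lemma normBStar_add {d : ℕ} (f g : E d → ℂ) (hf : AEStronglyMeasurable f volume)
    (hg : AEStronglyMeasurable g volume) (h1 : normBStar f < ∞) (h2 : normBStar g < ∞) :
    normBStar (f + g) < ∞ := by
  refine lt_of_le_of_lt ?_ (ENNReal.add_lt_top.2 ⟨h1, h2⟩)
  refine iSup_le fun j ↦ ?_
  calc _ ≤ (2 : ℝ≥0∞) ^ (-((j : ℝ) / 2)) * (eLpNorm f 2 (volume.restrict (shell d j))
        + eLpNorm g 2 (volume.restrict (shell d j))) := by
          gcongr
          exact eLpNorm_add_le hf.restrict hg.restrict (by norm_num)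
    _ ≤ _ := by
      rw [mul_add]
      exact add_le_add
        (le_iSup (fun j : ℕ ↦ (2 : ℝ≥0∞) ^ (-((j : ℝ) / 2)) *
          eLpNorm f 2 (volume.restrict (shell d j))) j)
        (le_iSup (fun j : ℕ ↦ (2 : ℝ≥0∞) ^ (-((j : ℝ) / 2)) *
          eLpNorm g 2 (volume.restrict (shell d j))) j)

lemma normBStar_smul {d : ℕ} (c : ℂ) (f : E d → ℂ) (h : normBStar f < ∞) :
    normBStar (c • f) < ∞ := by
  refine lt_of_le_of_lt ?_ (ENNReal.mul_lt_top (a := ‖c‖ₑ) (by simp) h)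
  refine iSup_le fun j ↦ ?_
  rw [eLpNorm_const_smul, mul_left_comm]
  gcongr
  exact le_iSup (fun j : ℕ ↦ (2 : ℝ≥0∞) ^ (-((j : ℝ) / 2)) *
          eLpNorm f 2 (volume.restrict (shell d j))) j

lemma distFun_antitone {d : ℕ} (f : E d → ℂ) : Antitone (distFun f) := fun _ _ h ↦
  measure_mono fun _ hx ↦ lt_of_le_of_lt h hx

lemma lorentzNorm_lt_top {d : ℕ} {p r : ℝ} (hr : 0 < r) {f : E d → ℂ} :
    lorentzNorm p r f < ∞ ↔
      ∫⁻ t in Ioi (0 : ℝ), ENNReal.ofReal (t ^ (r - 1)) * distFun f t ^ (r / p) < ∞ := by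
  have h1 : 0 < 1 / r := by positivity
  rw [lorentzNorm, ENNReal.rpow_lt_top_iff_of_pos h1]
  constructor
  · intro h
    refine lt_top_iff_ne_top.2 fun h' ↦ ?_
    rw [h', ENNReal.mul_top (by simpa using hr)] at h
    exact lt_irrefl _ h
  · exact fun h ↦ ENNReal.mul_lt_top (by simp) h

lemma lorentz_scale {d : ℕ} {p r : ℝ} {f : E d → ℂ} (a : ℝ) (ha : 0 < a)
    (h : ∫⁻ t in Ioi (0 : ℝ), ENNReal.ofReal (t ^ (r - 1)) * distFun f t ^ (r / p) < ∞) :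
    ∫⁻ t in Ioi (0 : ℝ), ENNReal.ofReal (t ^ (r - 1)) * distFun f (a * t) ^ (r / p) < ∞ := by
  have him : (fun t : ℝ ↦ a * t) '' Ioi 0 = Ioi 0 := by
    rw [image_mul_left_Ioi ha, mul_zero]
  have key := lintegral_image_eq_lintegral_abs_deriv_mul (s := Ioi (0 : ℝ)) measurableSet_Ioi
    (f := fun t ↦ a * t) (f' := fun _ ↦ a)
    (fun x _ ↦ by simpa using ((hasDerivAt_id x).const_mul a).hasDerivWithinAt)
    (fun x _ y _ hxy ↦ mul_left_cancel₀ ha.ne' hxy)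
    (fun t ↦ ENNReal.ofReal (t ^ (r - 1)) * distFun f t ^ (r / p))
  rw [him] at key
  rw [key] at h
  have e : ∀ t ∈ Ioi (0 : ℝ), ENNReal.ofReal (t ^ (r - 1)) * distFun f (a * t) ^ (r / p) =
      ENNReal.ofReal (a ^ (-r)) * (ENNReal.ofReal |a| *
        (ENNReal.ofReal ((a * t) ^ (r - 1)) * distFun f (a * t) ^ (r / p))) := by
    intro t ht
    rw [← mul_assoc, ← mul_assoc, ← ENNReal.ofReal_mul (by positivity),
      ← ENNReal.ofReal_mul (by positivity), abs_of_pos ha, Real.mul_rpow ha.le (le_of_lt ht)]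
    congr 2
    have : a ^ (-r) * a * a ^ (r - 1) = 1 := by
      nth_rewrite 2 [← Real.rpow_one a]
      rw [← Real.rpow_add ha, ← Real.rpow_add ha]
      simp
    rw [← mul_assoc, this, one_mul]
  rw [setLIntegral_congr_fun measurableSet_Ioi e, lintegral_const_mul' _ _ (by simp)]
  exact ENNReal.mul_lt_top (by simp) h

lemma lorentzNorm_zero {d : ℕ} {p r : ℝ} (hp : 0 < p) (hr : 0 < r) :
    lorentzNorm p r (0 : E d → ℂ) < ∞ := by
  rw [lorentzNorm_lt_top hr]
  have : ∫⁻ t in Ioi (0 : ℝ), ENNReal.ofReal (t ^ (r - 1)) * distFun (0 : E d → ℂ) t ^ (r / p)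
      = ∫⁻ t in Ioi (0 : ℝ), 0 := by
    refine setLIntegral_congr_fun measurableSet_Ioi fun t ht ↦ ?_
    have h0 : distFun (0 : E d → ℂ) t = 0 := by
      have : {x : E d | t < ‖(0 : E d → ℂ) x‖} = ∅ := by
        ext x; simpa using (le_of_lt ht)
      rw [distFun, this, measure_empty]
    simp only [h0]
    rw [ENNReal.zero_rpow_of_pos (by positivity), mul_zero]
  rw [this]
  simp

lemma lorentzNorm_smul {d : ℕ} {p r : ℝ} (hp : 0 < p) (hr : 0 < r) (c : ℂ) (f : E d → ℂ)
    (h : lorentzNorm p r f < ∞) : lorentzNorm p r (c • f) < ∞ := by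
  by_cases hc : c = 0
  · rw [hc, zero_smul]
    exact lorentzNorm_zero hp hr
  have hc' : 0 < ‖c‖ := norm_pos_iff.2 hc
  rw [lorentzNorm_lt_top hr] at h ⊢
  convert! lorentz_scale ‖c‖⁻¹ (by positivity) h using 4 with t
  simp only [distFun]
  congr 2
  ext x
  simp only [Pi.smul_apply, smul_eq_mul, norm_mul, mem_ofPred_eq]
  rw [inv_mul_lt_iff₀ hc']

lemma distFun_add {d : ℕ} (f g : E d → ℂ) (t : ℝ) :
    distFun (f + g) t ≤ distFun f (2⁻¹ * t) + distFun g (2⁻¹ * t) := by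
  refine (measure_mono fun x hx ↦ ?_).trans (measure_union_le _ _)
  by_contra hcon
  simp only [mem_union, mem_ofPred_eq, not_or, not_lt] at hcon hx
  have := norm_add_le (f x) (g x)
  simp only [Pi.add_apply] at hx
  linarith

lemma rpow_add_le_two {s : ℝ} (hs : 0 ≤ s) (a b : ℝ≥0∞) :
    (a + b) ^ s ≤ (2 : ℝ≥0∞) ^ s * (a ^ s + b ^ s) := by
  calc (a + b) ^ s ≤ (2 * max a b) ^ s := by
        gcongr
        rw [two_mul]
        exact add_le_add (le_max_left _ _) (le_max_right _ _)
    _ = 2 ^ s * (max a b) ^ s := ENNReal.mul_rpow_of_nonneg _ _ hs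
    _ ≤ _ := by
        gcongr
        rcases le_total a b with hab | hab
        · rw [max_eq_right hab]; exact le_add_self
        · rw [max_eq_left hab]; exact le_self_add

lemma lorentzNorm_add {d : ℕ} {p r : ℝ} (hp : 0 < p) (hr : 0 < r) (f g : E d → ℂ)
    (h1 : lorentzNorm p r f < ∞) (h2 : lorentzNorm p r g < ∞) :
    lorentzNorm p r (f + g) < ∞ := by
  rw [lorentzNorm_lt_top hr] at h1 h2 ⊢
  have h1' := lorentz_scale 2⁻¹ (by norm_num) h1
  have h2' := lorentz_scale 2⁻¹ (by norm_num) h2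
  have hs : 0 ≤ r / p := by positivity
  refine lt_of_le_of_lt (b := (2 : ℝ≥0∞) ^ (r / p) *
    ((∫⁻ t in Ioi (0 : ℝ), ENNReal.ofReal (t ^ (r - 1)) * distFun f (2⁻¹ * t) ^ (r / p)) +
      ∫⁻ t in Ioi (0 : ℝ), ENNReal.ofReal (t ^ (r - 1)) * distFun g (2⁻¹ * t) ^ (r / p))) ?_ ?_
  · have hm : Measurable fun t : ℝ ↦
        ENNReal.ofReal (t ^ (r - 1)) * distFun f (2⁻¹ * t) ^ (r / p) := by
      have : Measurable (distFun f) := (distFun_antitone f).measurable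
      fun_prop
    have htop : (2 : ℝ≥0∞) ^ (r / p) ≠ ∞ := ENNReal.rpow_ne_top_of_nonneg hs (by simp)
    rw [← lintegral_add_left hm, ← lintegral_const_mul' _ _ htop]
    refine lintegral_mono fun t ↦ ?_
    calc _ ≤ ENNReal.ofReal (t ^ (r - 1)) *
          ((2 : ℝ≥0∞) ^ (r / p) * (distFun f (2⁻¹ * t) ^ (r / p) +
            distFun g (2⁻¹ * t) ^ (r / p))) := by
          gcongr
          refine le_trans ?_ (rpow_add_le_two hs _ _)
          gcongr
          exact distFun_add f g t
      _ = _ := by ring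
  · refine ENNReal.mul_lt_top (ENNReal.rpow_lt_top_of_nonneg hs (by simp)) ?_
    exact ENNReal.add_lt_top.2 ⟨h1', h2'⟩

lemma pd_pos (d : ℕ) : 0 < pd d := by
  unfold pd; positivity

lemma pd'_pos {d : ℕ} (hd : 2 ≤ d) : 0 < pd' d := by
  have : (2 : ℝ) ≤ d := by exact_mod_cast hd
  unfold pd'
  apply div_pos <;> linarith

lemma normX_lt_top {d m : ℕ} {T : 𝓢'(E d, ℂ)} : normX m T < ∞ ↔
    ∃ T₁ T₂, T = T₁ + T₂ ∧ distNorm (lorentzNorm (pd d) 2) (S (-theta m d) T₁) < ∞ ∧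
      distNorm normB (S (-(m : ℝ)) T₂) < ∞ := by
  simp only [normX, iInf_lt_iff, ENNReal.add_lt_top, exists_prop]

/-- The space `X = W_{-θ}^{p_d,2} + S_m(B)`: the tempered distributions of finite `X`-norm. -/
def X (d m : ℕ) : Submodule ℂ 𝓢'(E d, ℂ) where
  carrier := {T | normX m T < ∞}
  zero_mem' := by
    refine normX_lt_top.2 ⟨0, 0, by simp, ?_, ?_⟩
    · rw [map_zero]; exact distNorm_zero_lt (lorentzNorm_zero (pd_pos d) two_pos)
    · rw [map_zero]; exact distNorm_zero_lt normB_zero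
  add_mem' := by
    intro T U hT hU
    obtain ⟨T₁, T₂, rfl, h1, h2⟩ := normX_lt_top.1 hT
    obtain ⟨U₁, U₂, rfl, h3, h4⟩ := normX_lt_top.1 hU
    refine normX_lt_top.2 ⟨T₁ + U₁, T₂ + U₂, by abel, ?_, ?_⟩
    · rw [map_add]
      exact distNorm_add_lt (fun f g _ _ ↦ lorentzNorm_add (pd_pos d) two_pos f g) h1 h3
    · rw [map_add]
      exact distNorm_add_lt normB_add h2 h4
  smul_mem' := by
    intro c T hT
    obtain ⟨T₁, T₂, rfl, h1, h2⟩ := normX_lt_top.1 hT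
    refine normX_lt_top.2 ⟨c • T₁, c • T₂, by simp, ?_, ?_⟩
    · rw [map_smul]
      exact distNorm_smul_lt c (lorentzNorm_smul (pd_pos d) two_pos c) h1
    · rw [map_smul]
      exact distNorm_smul_lt c (normB_smul c) h2

lemma normXStar_lt_top {d m : ℕ} {T : 𝓢'(E d, ℂ)} : normXStar m T < ∞ ↔
    distNorm (lorentzNorm (pd' d) 2) (S (theta m d) T) < ∞ ∧
      distNorm normBStar (S (m : ℝ) T) < ∞ := max_lt_iff

/-- The space `X^* = W_θ^{p_d',2} ∩ S_{-m}(B^*)`: the tempered distributions of finite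
`X^*`-norm. -/
def XStar (d m : ℕ) (hd : 2 ≤ d) : Submodule ℂ 𝓢'(E d, ℂ) where
  carrier := {T | normXStar m T < ∞}
  zero_mem' := by
    refine normXStar_lt_top.2 ⟨?_, ?_⟩
    · rw [map_zero]; exact distNorm_zero_lt (lorentzNorm_zero (pd'_pos hd) two_pos)
    · rw [map_zero]; exact distNorm_zero_lt normBStar_zero
  add_mem' := by
    intro T U hT hU
    have hT' := normXStar_lt_top.1 hT
    have hU' := normXStar_lt_top.1 hU
    refine normXStar_lt_top.2 ⟨?_, ?_⟩
    · rw [map_add]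
      exact distNorm_add_lt (fun f g _ _ ↦ lorentzNorm_add (pd'_pos hd) two_pos f g) hT'.1 hU'.1
    · rw [map_add]
      exact distNorm_add_lt normBStar_add hT'.2 hU'.2
  smul_mem' := by
    intro c T hT
    have hT' := normXStar_lt_top.1 hT
    refine normXStar_lt_top.2 ⟨?_, ?_⟩
    · rw [map_smul]
      exact distNorm_smul_lt c (lorentzNorm_smul (pd'_pos hd) two_pos c) hT'.1
    · rw [map_smul]
      exact distNorm_smul_lt c (normBStar_smul c) hT'.2

lemma isFun_schwartz {d : ℕ} (φ : 𝓢(E d, ℂ)) : IsFun (φ : 𝓢'(E d, ℂ)) φ := by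
  refine ⟨φ.continuous.aestronglyMeasurable, fun ψ ↦ ⟨?_, ?_⟩⟩
  · obtain ⟨C, hC⟩ := φ.decay 0 0
    refine ψ.integrable.mul_bdd (c := C) φ.continuous.aestronglyMeasurable ?_
    filter_upwards with x
    simpa using hC.2 x
  · rw [SchwartzMap.coe_apply]
    rfl

lemma lorentzNorm_schwartz {d : ℕ} {p : ℝ} (hp : 2 < p) (φ : 𝓢(E d, ℂ)) :
    lorentzNorm p 2 φ < ∞ := by
  rw [lorentzNorm_lt_top two_pos]
  obtain ⟨C, hC0, hC⟩ := φ.decay 0 0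
  have hC' : ∀ x, ‖φ x‖ ≤ C := fun x ↦ by simpa using hC x
  set I : ℝ≥0∞ := ∫⁻ x, ‖φ x‖ₑ with hI
  have hIt : I < ∞ := φ.integrable.2
  have hs : 0 < 2 / p := by positivity
  have hs1 : 0 < 1 - 2 / p := by rw [sub_pos, div_lt_one (by linarith)]; exact hp
  have hbound : ∀ t ∈ Ioi (0 : ℝ),
      ENNReal.ofReal (t ^ ((2 : ℝ) - 1)) * distFun φ t ^ (2 / p) ≤
        (Ioo (0 : ℝ) C).indicator (fun _ ↦ ENNReal.ofReal (C ^ (1 - 2 / p)) * I ^ (2 / p)) t := by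
    intro t ht
    have ht : 0 < t := ht
    by_cases htC : t < C
    · rw [indicator_of_mem (show t ∈ Ioo 0 C from ⟨ht, htC⟩)]
      have hd1 : ENNReal.ofReal t * distFun φ t ≤ I := by
        refine le_trans ?_ (mul_meas_ge_le_lintegral₀
          (φ.continuous.enorm.aemeasurable (μ := volume)) (ENNReal.ofReal t))
        gcongr
        refine measure_mono fun x hx ↦ ?_
        rw [mem_ofPred_eq] at hx ⊢
        rw [← ofReal_norm]
        exact ENNReal.ofReal_le_ofReal hx.le
      calc _ = ENNReal.ofReal (t ^ (1 - 2 / p)) *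
            (ENNReal.ofReal t * distFun φ t) ^ (2 / p) := by
            rw [ENNReal.mul_rpow_of_nonneg _ _ hs.le, ENNReal.ofReal_rpow_of_pos ht, ← mul_assoc,
              ← ENNReal.ofReal_mul (by positivity), ← Real.rpow_add ht]
            congr 3
            ring
        _ ≤ _ := by gcongr
    · have h0 : distFun φ t = 0 := by
        have : {x : E d | t < ‖φ x‖} = ∅ := by
          ext x
          simpa using (hC' x).trans (not_lt.1 htC)
        rw [distFun, this, measure_empty]
      rw [h0, ENNReal.zero_rpow_of_pos hs, mul_zero]
      exact zero_le
  refine lt_of_le_of_lt (setLIntegral_mono' measurableSet_Ioi hbound) ?_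
  refine lt_of_le_of_lt (setLIntegral_le_lintegral _ _) ?_
  rw [lintegral_indicator_const measurableSet_Ioo, Real.volume_Ioo]
  exact ENNReal.mul_lt_top (ENNReal.mul_lt_top (by simp)
    (ENNReal.rpow_lt_top_of_nonneg hs.le hIt.ne)) (by simp)

lemma normBStar_schwartz {d : ℕ} (φ : 𝓢(E d, ℂ)) : normBStar φ < ∞ := by
  refine lt_of_le_of_lt (b := eLpNorm φ 2 volume) ?_ (φ.memLp 2 volume).2
  refine iSup_le fun j ↦ ?_
  calc _ ≤ 1 * eLpNorm φ 2 volume := by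
        gcongr
        · rw [ENNReal.rpow_neg, ENNReal.inv_le_one]
          calc (1 : ℝ≥0∞) = 1 ^ ((j : ℝ) / 2) := (ENNReal.one_rpow _).symm
            _ ≤ 2 ^ ((j : ℝ) / 2) := ENNReal.rpow_le_rpow (by norm_num) (by positivity)
        · exact Measure.restrict_le_self
    _ = _ := one_mul _

lemma two_lt_pd' {d : ℕ} (hd : 2 ≤ d) : 2 < pd' d := by
  have : (2 : ℝ) ≤ d := by exact_mod_cast hd
  unfold pd'
  rw [lt_div_iff₀ (by linarith)]
  linarith

lemma S_symbol_hasTemperateGrowth {d : ℕ} (α : ℝ) : Function.HasTemperateGrowth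
    (fun ξ : E d ↦ (((1 + ‖(2 * Real.pi) • ξ‖ ^ 2) ^ (α / 2) : ℝ) : ℂ)) := by
  have h : Function.HasTemperateGrowth (fun ξ : E d ↦ (2 * Real.pi) • ξ) :=
    ((2 * Real.pi) • ContinuousLinearMap.id ℝ (E d)).hasTemperateGrowth
  have h2 := (Function.hasTemperateGrowth_one_add_norm_sq_rpow (E d) (α / 2)).comp h
  exact Function.Complex.hasTemperateGrowth_ofReal.comp h2

lemma schwartz_mem_XStar {d : ℕ} (m : ℕ) (hd : 2 ≤ d) (φ : 𝓢(E d, ℂ)) :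
    (φ : 𝓢'(E d, ℂ)) ∈ XStar d m hd := by
  refine normXStar_lt_top.2 ⟨?_, ?_⟩ <;>
  rw [S, fourierMultiplierCLM_toTemperedDistributionCLM_eq (S_symbol_hasTemperateGrowth _)]
  · exact distNorm_lt_top.2 ⟨_, isFun_schwartz _, lorentzNorm_schwartz (two_lt_pd' hd) _⟩
  · exact distNorm_lt_top.2 ⟨_, isFun_schwartz _, normBStar_schwartz _⟩

/-- A Schwartz function as an element of `X^*`. -/
def ofSchwartz {d : ℕ} (m : ℕ) (hd : 2 ≤ d) (φ : 𝓢(E d, ℂ)) : XStar d m hd :=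
  ⟨φ, schwartz_mem_XStar m hd φ⟩

/-- `⟨T, g⟩ = c` for the (sesquilinear) duality of `T ∈ X` and `g ∈ X^*`: if
`T = S_θ F₁ + S_m F₂` with `F₁ ∈ L^{p_d,2}` and `F₂ ∈ B`, then
`c = ∫ F₁ conj(S_θ g) + ∫ F₂ conj(S_m g)`; such decompositions exist because `T ∈ X`, and every
one of them is required to give `c`. -/
def IsPairing {d m : ℕ} {hd : 2 ≤ d} (T : X d m) (g : XStar d m hd) (c : ℂ) : Prop :=
  ∀ (T₁ T₂ : 𝓢'(E d, ℂ)) (F₁ F₂ G₁ G₂ : E d → ℂ), (T : 𝓢'(E d, ℂ)) = T₁ + T₂ →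
    IsFun (S (-theta m d) T₁) F₁ → lorentzNorm (pd d) 2 F₁ < ∞ →
    IsFun (S (-(m : ℝ)) T₂) F₂ → normB F₂ < ∞ →
    IsFun (S (theta m d) (g : 𝓢'(E d, ℂ))) G₁ → IsFun (S (m : ℝ) (g : 𝓢'(E d, ℂ))) G₂ →
    (∫ x, F₁ x * conj (G₁ x)) + (∫ x, F₂ x * conj (G₂ x)) = c

/-! ### Admissible perturbations -/

/-- The weight `μ_{N,γ}(x) = (1 + |x|²)^N / (1 + γ |x|²)^N`. -/
def mu {d : ℕ} (N γ : ℝ) (x : E d) : ℝ := (1 + ‖x‖ ^ 2) ^ N / (1 + γ * ‖x‖ ^ 2) ^ N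

/-- The weight is a legitimate multiplier of tempered distributions. -/
lemma mu_hasTemperateGrowth {d : ℕ} (N : ℝ) {γ : ℝ} (hγ : 0 < γ) :
    Function.HasTemperateGrowth (fun x : E d ↦ (mu N γ x : ℂ)) := by
  have h : Function.HasTemperateGrowth (fun x : E d ↦ Real.sqrt γ • x) :=
    (Real.sqrt γ • ContinuousLinearMap.id ℝ (E d)).hasTemperateGrowth
  have h1 := Function.hasTemperateGrowth_one_add_norm_sq_rpow (E d) N
  have h2 := (Function.hasTemperateGrowth_one_add_norm_sq_rpow (E d) (-N)).comp h
  have e : (fun x : E d ↦ mu N γ x) = fun x : E d ↦ (1 + ‖x‖ ^ 2) ^ N *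
      (1 + ‖Real.sqrt γ • x‖ ^ 2) ^ (-N) := by
    ext x
    simp only [mu, norm_smul, Real.norm_eq_abs, mul_pow, sq_abs, Real.sq_sqrt hγ.le]
    rw [Real.rpow_neg (by positivity), div_eq_mul_inv]
  have h3 : Function.HasTemperateGrowth (fun x : E d ↦ mu N γ x) := by
    rw [e]
    exact h1.mul h2
  exact Function.Complex.hasTemperateGrowth_ofReal.comp h3

/-- Multiplication of a tempered distribution by the weight `μ_{N,γ}`. -/
def mulMu {d : ℕ} (N γ : ℝ) : 𝓢'(E d, ℂ) →L[ℂ] 𝓢'(E d, ℂ) :=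
  smulLeftCLM ℂ (fun x : E d ↦ (mu N γ x : ℂ))

/-- The complex Hilbert space `L²(ℝ^d)`. -/
abbrev L2 (d : ℕ) : Type := Lp ℂ 2 (volume : Measure (E d))

/-- An operator `V : X^* → X` is an admissible perturbation of `(-Δ)^m`. -/
structure IsAdmissible {d m : ℕ} {hd : 2 ≤ d} (V : XStar d m hd →ₗ[ℂ] X d m) : Prop where
  /-- `V ∈ 𝓑(X^*, X)` -/
  bounded : ∃ C : ℝ≥0, ∀ u, normX m (V u : 𝓢'(E d, ℂ)) ≤ C * normXStar m (u : 𝓢'(E d, ℂ))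
  /-- `⟨V φ, ψ⟩ = ⟨φ, V ψ⟩` on Schwartz functions, where `⟨φ, V ψ⟩` is the complex conjugate
  of `⟨V ψ, φ⟩` -/
  symmetric : ∀ φ ψ : 𝓢(E d, ℂ), ∃ c : ℂ,
    IsPairing (V (ofSchwartz m hd φ)) (ofSchwartz m hd ψ) c ∧
    IsPairing (V (ofSchwartz m hd ψ)) (ofSchwartz m hd φ) (conj c)
  /-- `‖μ_{N,γ} V u‖_X ≤ ε ‖μ_{N,γ} u‖_{X^*} + A ‖u 1_{|x| ≤ R}‖_{L²}` -/
  weighted : ∀ ε N : ℝ, 0 < ε → 0 ≤ N → ∃ A R : ℝ, 1 ≤ A ∧ 1 ≤ R ∧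
    ∀ (u : XStar d m hd) (γ : ℝ), 0 < γ → γ ≤ 1 →
      normX m (mulMu N γ (V u : 𝓢'(E d, ℂ))) ≤
        ENNReal.ofReal ε * normXStar m (mulMu N γ (u : 𝓢'(E d, ℂ))) +
        ENNReal.ofReal A *
          distNorm (fun f ↦ eLpNorm f 2 (volume.restrict {x | ‖x‖ ≤ R})) (u : 𝓢'(E d, ℂ))
  /-- `⟨V f, g⟩ = ∑_j ⟨B_j f, A_j g⟩` with bounded operators `A_j, B_j : X^* → L²`; the inner
  product of Mathlib is linear in its second argument -/
  factorization : ∃ (J : ℕ) (A B : Fin J → XStar d m hd →ₗ[ℂ] L2 d), 1 ≤ J ∧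
    (∃ C : ℝ≥0, ∀ j u, ‖A j u‖ₑ ≤ C * normXStar m (u : 𝓢'(E d, ℂ)) ∧
      ‖B j u‖ₑ ≤ C * normXStar m (u : 𝓢'(E d, ℂ))) ∧
    ∀ f g : XStar d m hd, IsPairing (V f) g (∑ j, inner ℂ (A j g) (B j f))

/-- A potential `V` (a real function on `ℝ^d`) is an admissible perturbation of `(-Δ)^m`: every
`u ∈ X^*` is a function, `u ↦ V u` (pointwise multiplication) is an operator from `X^*` to `X`,
and this operator is admissible. -/
def IsAdmissiblePotential {d : ℕ} (m : ℕ) (hd : 2 ≤ d) (V : E d → ℝ) : Prop :=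
  ∃ M : XStar d m hd →ₗ[ℂ] X d m,
    (∀ u : XStar d m hd, ∃ f : E d → ℂ, IsFun (u : 𝓢'(E d, ℂ)) f ∧
      IsFun (M u : 𝓢'(E d, ℂ)) (fun x ↦ (V x : ℂ) * f x)) ∧
    IsAdmissible M

end HighOrderSchrodinger

end

/-!
Up to a constant factor, Bessel potentials are convolutions with finite measures of fractional
dimension. Hence the convolution inequalities of Hardy and O'Neil embed `X^*` into the Lorentz
space with exponent `1/2 - c` and second index `2`, and the Lorentz space with exponent `1/2 + c`
and second index `2` into `X`, where `c = 1 / (2q)`. A potential `V` in `L^{q,∞}` raises the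
exponent by `2c`, so it maps `X^*` to `X`, and `|V|^{1/2}` maps `X^*` to `L²`; this gives the
factorization `V = |V|^{1/2} · sign V |V|^{1/2}`.

For the weighted bound, `V` is the sum of a potential with small `L^{q,∞}` norm and a bounded one
with compact support. The first gives the term with `ε`, because multiplication commutes with the
weights. On the support of the second the weights are bounded uniformly in `γ`, which gives the
local `L²` term.
-/

namespace HighOrderSchrodinger

/-! ### Decreasing rearrangements -/

section Rearrangement

variable {α : Type*} [MeasurableSpace α] {μ : Measure α} {f g : α → ℝ≥0∞}

/-- The decreasing rearrangement `f^*` of a nonnegative function. The argument ranges over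
`[0, ∞]`, so that `f^*(0)` is the essential supremum. -/
noncomputable def rearrangement (μ : Measure α) (f : α → ℝ≥0∞) (τ : ℝ≥0∞) : ℝ≥0∞ :=
  sInf {s | μ {x | s < f x} ≤ τ}

lemma measure_rearrangement_lt_le (f : α → ℝ≥0∞) (τ : ℝ≥0∞) :
    μ {x | rearrangement μ f τ < f x} ≤ τ := by
  by_cases h : rearrangement μ f τ = ∞
  · simp [h]
  obtain ⟨u, hu, hlt, hlim⟩ := exists_seq_strictAnti_tendsto' (lt_top_iff_ne_top.2 h)
  have superlevel_eq : {x | rearrangement μ f τ < f x} = ⋃ n, {x | u n < f x} := by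
    ext x
    simp only [mem_ofPred_eq, mem_iUnion]
    exact ⟨fun hx ↦ (hlim.eventually (gt_mem_nhds hx)).exists, fun ⟨n, hn⟩ ↦ (hlt n).1.trans hn⟩
  have hmono : Monotone fun n ↦ {x | u n < f x} :=
    fun n k hnk x hx ↦ lt_of_le_of_lt (hu.antitone hnk) hx
  rw [superlevel_eq, hmono.measure_iUnion]
  refine iSup_le fun n ↦ ?_
  obtain ⟨s, hs, hsu⟩ := sInf_lt_iff.1 (hlt n).1
  exact le_trans (measure_mono fun x hx ↦ hsu.trans hx) hs

lemma rearrangement_le_iff {s τ : ℝ≥0∞} :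
    rearrangement μ f τ ≤ s ↔ μ {x | s < f x} ≤ τ :=
  ⟨fun h ↦ (measure_mono fun _ hx ↦ lt_of_le_of_lt h hx).trans (measure_rearrangement_lt_le f τ),
    fun h ↦ csInf_le' h⟩

lemma lt_rearrangement_iff {s τ : ℝ≥0∞} : s < rearrangement μ f τ ↔ τ < μ {x | s < f x} := by
  rw [← not_le, ← not_le, rearrangement_le_iff]

lemma rearrangement_antitone (f : α → ℝ≥0∞) : Antitone (rearrangement μ f) := fun _ _ h ↦
  rearrangement_le_iff.2 ((measure_rearrangement_lt_le f _).trans h)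

lemma rearrangement_mono (h : f ≤ᵐ[μ] g) (τ : ℝ≥0∞) :
    rearrangement μ f τ ≤ rearrangement μ g τ := by
  refine rearrangement_le_iff.2 (le_trans ?_ (measure_rearrangement_lt_le (μ := μ) g τ))
  refine measure_mono_ae ?_
  filter_upwards [h] with x hfg hx using lt_of_lt_of_le hx hfg

lemma rearrangement_congr (h : f =ᵐ[μ] g) : rearrangement μ f = rearrangement μ g :=
  funext fun τ ↦ le_antisymm (rearrangement_mono h.le τ) (rearrangement_mono h.symm.le τ)

lemma rearrangement_map₂_le {op : ℝ≥0∞ → ℝ≥0∞ → ℝ≥0∞}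
    (hop : ∀ ⦃a a' b b'⦄, a ≤ a' → b ≤ b' → op a b ≤ op a' b') (f g : α → ℝ≥0∞) (σ τ : ℝ≥0∞) :
    rearrangement μ (fun x ↦ op (f x) (g x)) (σ + τ) ≤
      op (rearrangement μ f σ) (rearrangement μ g τ) := by
  have hsubset : {x | op (rearrangement μ f σ) (rearrangement μ g τ) < op (f x) (g x)} ⊆
      {x | rearrangement μ f σ < f x} ∪ {x | rearrangement μ g τ < g x} := by
    intro x hx
    by_contra hcon
    simp only [mem_union, mem_ofPred_eq, not_or, not_lt] at hcon hx
    exact absurd hx (not_lt.2 (hop hcon.1 hcon.2))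
  exact rearrangement_le_iff.2 <| ((measure_mono hsubset).trans (measure_union_le _ _)).trans <|
    add_le_add (measure_rearrangement_lt_le f σ) (measure_rearrangement_lt_le g τ)

lemma rearrangement_add_le (f g : α → ℝ≥0∞) (σ τ : ℝ≥0∞) :
    rearrangement μ (f + g) (σ + τ) ≤ rearrangement μ f σ + rearrangement μ g τ :=
  rearrangement_map₂_le (fun _ _ _ _ ↦ add_le_add) f g σ τ

lemma rearrangement_mul_le (f g : α → ℝ≥0∞) (σ τ : ℝ≥0∞) :
    rearrangement μ (f * g) (σ + τ) ≤ rearrangement μ f σ * rearrangement μ g τ :=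
  rearrangement_map₂_le (fun _ _ _ _ ↦ mul_le_mul') f g σ τ

lemma rearrangement_rpow {c : ℝ} (hc : 0 < c) (f : α → ℝ≥0∞) (τ : ℝ≥0∞) :
    rearrangement μ (fun x ↦ f x ^ c) τ = rearrangement μ f τ ^ c := by
  refine eq_of_forall_lt_iff fun s ↦ ?_
  rw [lt_rearrangement_iff, ← ENNReal.rpow_inv_lt_iff hc, lt_rearrangement_iff]
  simp_rw [ENNReal.rpow_inv_lt_iff hc]

lemma rearrangement_le_of_forall_le {M : ℝ≥0∞} (h : ∀ x, f x ≤ M) (τ : ℝ≥0∞) :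
    rearrangement μ f τ ≤ M := by
  have hempty : {x | M < f x} = ∅ := eq_empty_of_forall_notMem fun x ↦ not_lt.2 (h x)
  exact rearrangement_le_iff.2 (by simp [hempty])

lemma mul_rearrangement_le_lintegral (hf : AEMeasurable f μ) (τ : ℝ≥0∞) :
    τ * rearrangement μ f τ ≤ ∫⁻ x, f x ∂μ := by
  refine ENNReal.mul_le_of_forall_lt fun a ha b hb ↦ ?_
  have hτ : a ≤ μ {x | b ≤ f x} :=
    (ha.trans (lt_rearrangement_iff.1 hb)).le.trans (measure_mono fun x (hx : b < f x) ↦ hx.le)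
  calc a * b ≤ b * μ {x | b ≤ f x} := by rw [mul_comm]; gcongr
    _ ≤ ∫⁻ x, f x ∂μ := mul_meas_ge_le_lintegral₀ hf b

lemma measurable_rearrangement_ofReal (f : α → ℝ≥0∞) :
    Measurable fun τ : ℝ ↦ rearrangement μ f (ENNReal.ofReal τ) :=
  (rearrangement_antitone f).measurable.comp ENNReal.measurable_ofReal

end Rearrangement

section PowerIntegrals

lemma lintegral_Ioi_comp_mul (g : ℝ → ℝ≥0∞) {c : ℝ} (hc : 0 < c) :
    ∫⁻ t in Ioi (0 : ℝ), g t = ENNReal.ofReal c * ∫⁻ t in Ioi (0 : ℝ), g (c * t) := by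
  have himage : (fun t : ℝ ↦ c * t) '' Ioi 0 = Ioi 0 := by rw [image_mul_left_Ioi hc, mul_zero]
  have hsubst := lintegral_image_eq_lintegral_abs_deriv_mul (s := Ioi (0 : ℝ)) measurableSet_Ioi
    (f := fun t ↦ c * t) (f' := fun _ ↦ c)
    (fun x _ ↦ by simpa using ((hasDerivAt_id x).const_mul c).hasDerivWithinAt)
    (fun x _ y _ hxy ↦ mul_left_cancel₀ hc.ne' hxy) g
  rwa [himage, lintegral_const_mul' _ _ (by simp), abs_of_pos hc] at hsubst

lemma lintegral_Ioc_rpow_sub_one {c B : ℝ} (hc : 0 < c) (hB : 0 ≤ B) :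
    ∫⁻ t in Ioc (0 : ℝ) B, ENNReal.ofReal (t ^ (c - 1)) = ENNReal.ofReal (B ^ c / c) := by
  rw [← ofReal_integral_eq_lintegral_ofReal, ← intervalIntegral.integral_of_le hB,
    integral_rpow (Or.inl (by linarith)), sub_add_cancel, Real.zero_rpow hc.ne', sub_zero]
  · exact (intervalIntegrable_iff_integrableOn_Ioc_of_le hB).1
      (intervalIntegral.intervalIntegrable_rpow' (by linarith))
  · filter_upwards [ae_restrict_mem measurableSet_Ioc] with t ht using Real.rpow_nonneg ht.1.le _

lemma lintegral_Ioi_rpow_neg_sub_one {c B : ℝ} (hc : 0 < c) (hB : 0 < B) :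
    ∫⁻ t in Ioi B, ENNReal.ofReal (t ^ (-c - 1)) = ENNReal.ofReal (B ^ (-c) / c) := by
  rw [← ofReal_integral_eq_lintegral_ofReal, integral_Ioi_rpow_of_lt (by linarith) hB,
    sub_add_cancel, neg_div_neg_eq]
  · exact integrableOn_Ioi_rpow_of_lt (by linarith) hB
  · filter_upwards [ae_restrict_mem measurableSet_Ioi] with t ht
      using Real.rpow_nonneg (hB.trans ht).le _

lemma lintegral_rpow_sub_one_mul_min_rpow_neg_lt_top {b c : ℝ} (hb : 0 < b) (hbc : b < c) :
    ∫⁻ s in Ioi (0 : ℝ), ENNReal.ofReal (s ^ (b - 1) * min 1 (s ^ (-c))) < ∞ := by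
  rw [← Ioc_union_Ioi_eq_Ioi zero_le_one, lintegral_union measurableSet_Ioi
    (Set.disjoint_left.2 fun x hx hx' ↦ hx.2.not_gt hx'), ENNReal.add_lt_top]
  constructor
  · calc _ ≤ ∫⁻ s in Ioc (0 : ℝ) 1, ENNReal.ofReal (s ^ (b - 1)) :=
          setLIntegral_mono' measurableSet_Ioc fun s hs ↦ ENNReal.ofReal_le_ofReal
            (mul_le_of_le_one_right (Real.rpow_nonneg hs.1.le _) (min_le_left _ _))
      _ < ∞ := by
          rw [lintegral_Ioc_rpow_sub_one hb zero_le_one]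
          exact ENNReal.ofReal_lt_top
  · calc _ ≤ ∫⁻ s in Ioi (1 : ℝ), ENNReal.ofReal (s ^ (-(c - b) - 1)) := by
          refine setLIntegral_mono' measurableSet_Ioi fun s (hs : 1 < s) ↦
            ENNReal.ofReal_le_ofReal ?_
          rw [show -(c - b) - 1 = b - 1 + -c by ring, Real.rpow_add (by linarith)]
          gcongr
          exact min_le_right _ _
      _ < ∞ := by
          rw [lintegral_Ioi_rpow_neg_sub_one (by linarith) one_pos]
          exact ENNReal.ofReal_lt_top

lemma mul_lintegral_indicator_rpow_sub_one {c : ℝ} (hc : 0 < c) (A : ℝ≥0∞) :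
    ENNReal.ofReal c * ∫⁻ t in Ioi (0 : ℝ),
      {t : ℝ | ENNReal.ofReal t < A}.indicator (fun t ↦ ENNReal.ofReal (t ^ (c - 1))) t =
        A ^ c := by
  have mul_lintegral_Ioc (B : ℝ) (hB : 0 ≤ B) : ENNReal.ofReal c *
      ∫⁻ t in Ioc (0 : ℝ) B, ENNReal.ofReal (t ^ (c - 1)) = ENNReal.ofReal B ^ c := by
    rw [lintegral_Ioc_rpow_sub_one hc hB, ← ENNReal.ofReal_mul hc.le, mul_div_cancel₀ _ hc.ne',
      ENNReal.ofReal_rpow_of_nonneg hB hc.le]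
  rw [setLIntegral_indicator (measurableSet_lt ENNReal.measurable_ofReal measurable_const)]
  rcases eq_or_ne A ∞ with rfl | hA
  · rw [ENNReal.top_rpow_of_pos hc]
    refine ENNReal.eq_top_of_forall_nnreal_le fun r ↦ ?_
    calc (r : ℝ≥0∞) = ENNReal.ofReal ((r : ℝ) ^ c⁻¹) ^ c := by
          rw [ENNReal.ofReal_rpow_of_nonneg (by positivity) hc.le,
            Real.rpow_inv_rpow r.coe_nonneg hc.ne', ENNReal.ofReal_coe_nnreal]
      _ ≤ _ := by
          rw [← mul_lintegral_Ioc _ (by positivity)]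
          gcongr
          exact fun t ht ↦ ⟨ENNReal.ofReal_lt_top, ht.1⟩
  · have hset : {t : ℝ | ENNReal.ofReal t < A} ∩ Ioi 0 = Ioo 0 A.toReal := by
      ext t
      constructor
      · rintro ⟨hlt, hpos⟩
        exact ⟨hpos, (ENNReal.ofReal_lt_iff_lt_toReal (le_of_lt hpos) hA).1 hlt⟩
      · rintro ⟨hpos, hlt⟩
        exact ⟨(ENNReal.ofReal_lt_iff_lt_toReal hpos.le hA).2 hlt, hpos⟩
    rw [hset, setLIntegral_congr (Ioo_ae_eq_Ioc (a := (0 : ℝ)) (b := A.toReal)),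
      mul_lintegral_Ioc _ ENNReal.toReal_nonneg, ENNReal.ofReal_toReal hA]

end PowerIntegrals

section LayerCake

variable {α : Type*} [MeasurableSpace α] {μ : Measure α}

lemma lintegral_mul_rpow_eq [SFinite μ] {w g : α → ℝ≥0∞} (hw : AEMeasurable w μ)
    (hg : AEMeasurable g μ) {c : ℝ} (hc : 0 < c) :
    ∫⁻ x, w x * g x ^ c ∂μ = ENNReal.ofReal c * ∫⁻ t in Ioi (0 : ℝ),
      ENNReal.ofReal (t ^ (c - 1)) * ∫⁻ x, {x | ENNReal.ofReal t < g x}.indicator w x ∂μ := by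
  have layers (x : α) : w x * g x ^ c = ENNReal.ofReal c * ∫⁻ t in Ioi (0 : ℝ),
      ENNReal.ofReal (t ^ (c - 1)) * {x | ENNReal.ofReal t < g x}.indicator w x := by
    rw [← mul_lintegral_indicator_rpow_sub_one hc (g x), mul_left_comm, ← lintegral_const_mul]
    · congr 1
      refine lintegral_congr fun t ↦ ?_
      simp only [indicator, mem_ofPred_eq]
      split_ifs <;> simp [mul_comm]
    · exact Measurable.indicator (by fun_prop)
        (measurableSet_lt ENNReal.measurable_ofReal measurable_const)
  have hmeas : AEMeasurable (Function.uncurry fun (x : α) (t : ℝ) ↦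
      ENNReal.ofReal (t ^ (c - 1)) * {x | ENNReal.ofReal t < g x}.indicator w x)
      (μ.prod (volume.restrict (Ioi 0))) := by
    have hw' := hw.comp_quasiMeasurePreserving
      (Measure.quasiMeasurePreserving_fst (ν := volume.restrict (Ioi (0 : ℝ))))
    have hg' := hg.comp_quasiMeasurePreserving
      (Measure.quasiMeasurePreserving_fst (ν := volume.restrict (Ioi (0 : ℝ))))
    exact AEMeasurable.mul (by fun_prop)
      (hw'.indicator₀ (nullMeasurableSet_lt (by fun_prop) hg'))
  simp_rw [layers]
  rw [lintegral_const_mul' _ _ (by simp), lintegral_lintegral_swap hmeas]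
  simp_rw [lintegral_const_mul' _ _ ENNReal.ofReal_ne_top]

lemma lintegral_rpow_eq [SFinite μ] {g : α → ℝ≥0∞} (hg : AEMeasurable g μ) {c : ℝ} (hc : 0 < c) :
    ∫⁻ x, g x ^ c ∂μ = ENNReal.ofReal c * ∫⁻ t in Ioi (0 : ℝ),
      ENNReal.ofReal (t ^ (c - 1)) * μ {x | ENNReal.ofReal t < g x} := by
  have h := lintegral_mul_rpow_eq (w := fun _ ↦ 1) (by fun_prop) hg hc
  simpa only [one_mul,
    lintegral_indicator_const₀ (nullMeasurableSet_lt aemeasurable_const hg)] using h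

lemma lintegral_rpow_mul_rearrangement_rpow (f : α → ℝ≥0∞) {b c : ℝ} (hb : 0 < b) (hc : 0 < c) :
    ENNReal.ofReal b * ∫⁻ τ in Ioi (0 : ℝ),
        ENNReal.ofReal (τ ^ (b - 1)) * rearrangement μ f (ENNReal.ofReal τ) ^ c =
      ENNReal.ofReal c * ∫⁻ t in Ioi (0 : ℝ),
        ENNReal.ofReal (t ^ (c - 1)) * μ {x | ENNReal.ofReal t < f x} ^ b := by
  rw [lintegral_mul_rpow_eq (by fun_prop) (measurable_rearrangement_ofReal f).aemeasurable hc,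
    mul_left_comm, ← lintegral_const_mul' _ _ (by simp)]
  simp_rw [lt_rearrangement_iff, mul_left_comm (ENNReal.ofReal b),
    mul_lintegral_indicator_rpow_sub_one hb]

lemma lintegral_rearrangement_rpow [SFinite μ] {f : α → ℝ≥0∞} (hf : AEMeasurable f μ) {c : ℝ}
    (hc : 0 < c) :
    ∫⁻ τ in Ioi (0 : ℝ), rearrangement μ f (ENNReal.ofReal τ) ^ c = ∫⁻ x, f x ^ c ∂μ := by
  have h := lintegral_rpow_mul_rearrangement_rpow (μ := μ) f one_pos hc
  simp only [ENNReal.rpow_one, ← lintegral_rpow_eq hf hc] at h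
  simpa using h

end LayerCake

/-! ### Weak Lebesgue bounds -/

section WeakBound

variable {α : Type*} [MeasurableSpace α] {μ : Measure α} {f g : α → ℝ≥0∞} {b : ℝ} {K : ℝ≥0∞}

/-- `f` belongs to `L^{1/b,∞}` with constant `K`, in terms of its rearrangement. -/
def HasWeakBound (μ : Measure α) (b : ℝ) (K : ℝ≥0∞) (f : α → ℝ≥0∞) : Prop :=
  ∀ τ : ℝ, 0 < τ → rearrangement μ f (ENNReal.ofReal τ) ≤ K * ENNReal.ofReal (τ ^ (-b))

lemma ofReal_rpow_mul_ofReal_rpow_neg {τ : ℝ} (hτ : 0 < τ) (b : ℝ) :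
    ENNReal.ofReal (τ ^ b) * ENNReal.ofReal (τ ^ (-b)) = 1 := by
  rw [← ENNReal.ofReal_mul (by positivity), ← Real.rpow_add hτ, add_neg_cancel, Real.rpow_zero,
    ENNReal.ofReal_one]

lemma HasWeakBound.mono (hg : HasWeakBound μ b K g) (h : f ≤ᵐ[μ] g) : HasWeakBound μ b K f :=
  fun τ hτ ↦ (rearrangement_mono h _).trans (hg τ hτ)

lemma HasWeakBound.mono_const {K' : ℝ≥0∞} (hf : HasWeakBound μ b K f) (h : K ≤ K') :
    HasWeakBound μ b K' f := fun τ hτ ↦ (hf τ hτ).trans (by gcongr)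

lemma HasWeakBound.add {K' : ℝ≥0∞} (hf : HasWeakBound μ b K f) (hg : HasWeakBound μ b K' g) :
    HasWeakBound μ b (ENNReal.ofReal (2 ^ b) * (K + K')) (f + g) := by
  intro τ hτ
  have half_rpow : (τ / 2) ^ (-b) = 2 ^ b * τ ^ (-b) := by
    rw [Real.div_rpow hτ.le zero_le_two, Real.rpow_neg zero_le_two, div_inv_eq_mul, mul_comm]
  calc rearrangement μ (f + g) (ENNReal.ofReal τ)
      = rearrangement μ (f + g) (ENNReal.ofReal (τ / 2) + ENNReal.ofReal (τ / 2)) := by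
        rw [← ENNReal.ofReal_add (by positivity) (by positivity), add_halves]
    _ ≤ K * ENNReal.ofReal ((τ / 2) ^ (-b)) + K' * ENNReal.ofReal ((τ / 2) ^ (-b)) :=
        (rearrangement_add_le f g _ _).trans
          (add_le_add (hf _ (by positivity)) (hg _ (by positivity)))
    _ = ENNReal.ofReal (2 ^ b) * (K + K') * ENNReal.ofReal (τ ^ (-b)) := by
        rw [half_rpow, ENNReal.ofReal_mul (by positivity)]
        ring

lemma HasWeakBound.rpow (hf : HasWeakBound μ b K f) {c : ℝ} (hc : 0 < c) :
    HasWeakBound μ (b * c) (K ^ c) (fun x ↦ f x ^ c) := by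
  intro τ hτ
  rw [rearrangement_rpow hc, ← neg_mul, Real.rpow_mul hτ.le,
    ← ENNReal.ofReal_rpow_of_pos (by positivity), ← ENNReal.mul_rpow_of_nonneg _ _ hc.le]
  gcongr
  exact hf τ hτ

lemma hasWeakBound_of_support {M : ℝ≥0∞} {s : Set α} (hM : ∀ x, f x ≤ M)
    (hs : ∀ x ∉ s, f x = 0) (hb : 0 ≤ b) : HasWeakBound μ b (M * μ s ^ b) f := by
  intro τ hτ
  rcases le_or_gt (μ s) (ENNReal.ofReal τ) with h | h
  · have hzero : rearrangement μ f (ENNReal.ofReal τ) ≤ 0 := by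
      refine rearrangement_le_iff.2 (le_trans (measure_mono fun x hx ↦ ?_) h)
      by_contra hxs
      exact hx.ne' (hs x hxs)
    exact hzero.trans zero_le
  · calc rearrangement μ f (ENNReal.ofReal τ)
        ≤ M * (ENNReal.ofReal τ ^ b * ENNReal.ofReal (τ ^ (-b))) := by
          rw [ENNReal.ofReal_rpow_of_pos hτ, ofReal_rpow_mul_ofReal_rpow_neg hτ, mul_one]
          exact rearrangement_le_of_forall_le hM _
      _ ≤ M * μ s ^ b * ENNReal.ofReal (τ ^ (-b)) := by
          rw [← mul_assoc]
          gcongr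

lemma HasWeakBound.measure_lt_top (hf : HasWeakBound μ b K f) (hb : 0 < b) (hK : K ≠ ∞)
    {s : ℝ≥0∞} (hs : 0 < s) : μ {x | s < f x} < ∞ := by
  have hlim : Filter.Tendsto (fun τ : ℝ ↦ K * ENNReal.ofReal (τ ^ (-b))) Filter.atTop
      (nhds 0) := by
    simpa using ENNReal.Tendsto.const_mul (ENNReal.tendsto_ofReal (tendsto_rpow_neg_atTop hb))
      (Or.inr hK)
  obtain ⟨τ, hlt, hτ⟩ := ((hlim.eventually (gt_mem_nhds hs)).and
    (Filter.eventually_gt_atTop 0)).exists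
  exact (rearrangement_le_iff.1 ((hf τ hτ).trans hlt.le)).trans_lt ENNReal.ofReal_lt_top

lemma lintegral_mul_le_rearrangement [SFinite μ] (hf : AEMeasurable f μ) (hg : AEMeasurable g μ) :
    ∫⁻ x, f x * g x ∂μ ≤ 2 * ∫⁻ τ in Ioi (0 : ℝ),
      rearrangement μ f (ENNReal.ofReal τ) * rearrangement μ g (ENNReal.ofReal τ) := by
  have h := lintegral_rearrangement_rpow (hf.mul hg) one_pos
  simp only [ENNReal.rpow_one, Pi.mul_apply] at h
  rw [← h, lintegral_Ioi_comp_mul _ two_pos, ENNReal.ofReal_ofNat]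
  gcongr 2 * ?_
  refine setLIntegral_mono' measurableSet_Ioi fun τ (hτ : 0 < τ) ↦ ?_
  rw [two_mul, ENNReal.ofReal_add hτ.le hτ.le]
  exact rearrangement_mul_le f g _ _

lemma HasWeakBound.rearrangement_mul_le_of_forall_le (hf : HasWeakBound μ b K f) {M : ℝ≥0∞}
    (hM : ∀ x, g x ≤ M) {τ : ℝ} (hτ : 0 < τ) :
    rearrangement μ f (ENNReal.ofReal τ) * rearrangement μ g (ENNReal.ofReal τ) ≤
      K * M * ENNReal.ofReal (τ ^ (1 - b - 1)) :=
  calc rearrangement μ f (ENNReal.ofReal τ) * rearrangement μ g (ENNReal.ofReal τ)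
      ≤ K * ENNReal.ofReal (τ ^ (-b)) * M :=
        mul_le_mul' (hf τ hτ) (rearrangement_le_of_forall_le hM _)
    _ = K * M * ENNReal.ofReal (τ ^ (1 - b - 1)) := by
        rw [mul_right_comm, sub_sub_cancel_left]

lemma HasWeakBound.rearrangement_mul_le_lintegral (hf : HasWeakBound μ b K f)
    (hg : AEMeasurable g μ) {τ : ℝ} (hτ : 0 < τ) :
    rearrangement μ f (ENNReal.ofReal τ) * rearrangement μ g (ENNReal.ofReal τ) ≤
      K * (∫⁻ x, g x ∂μ) * ENNReal.ofReal (τ ^ (-b - 1)) := by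
  have h₁ := ofReal_rpow_mul_ofReal_rpow_neg hτ 1
  rw [Real.rpow_one] at h₁
  calc rearrangement μ f (ENNReal.ofReal τ) * rearrangement μ g (ENNReal.ofReal τ)
      = ENNReal.ofReal (τ ^ (-1 : ℝ)) * rearrangement μ f (ENNReal.ofReal τ) *
          (ENNReal.ofReal τ * rearrangement μ g (ENNReal.ofReal τ)) := by
        rw [mul_mul_mul_comm, mul_comm (ENNReal.ofReal (τ ^ (-1 : ℝ))), h₁, one_mul]
    _ ≤ ENNReal.ofReal (τ ^ (-1 : ℝ)) * (K * ENNReal.ofReal (τ ^ (-b))) * ∫⁻ x, g x ∂μ := by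
        gcongr
        · exact hf τ hτ
        · exact mul_rearrangement_le_lintegral hg _
    _ = K * (∫⁻ x, g x ∂μ) * ENNReal.ofReal (τ ^ (-b - 1)) := by
        rw [sub_eq_add_neg, Real.rpow_add hτ, ENNReal.ofReal_mul (by positivity)]
        ring

lemma HasWeakBound.lintegral_mul_le [SFinite μ] (hK : HasWeakBound μ b K f) (hb : 0 < b)
    (hb1 : b < 1) (hf : AEMeasurable f μ) (hg : AEMeasurable g μ) {M : ℝ≥0∞}
    (hM : ∀ x, g x ≤ M) :
    ∫⁻ x, f x * g x ∂μ ≤ 2 * K * (ENNReal.ofReal (1 / (1 - b)) * M +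
      ENNReal.ofReal (1 / b) * ∫⁻ x, g x ∂μ) := by
  refine (lintegral_mul_le_rearrangement hf hg).trans ?_
  rw [mul_assoc, mul_add, ← Ioc_union_Ioi_eq_Ioi zero_le_one, lintegral_union measurableSet_Ioi
    (Set.disjoint_left.2 fun x hx hx' ↦ hx.2.not_gt hx')]
  gcongr 2 * (?_ + ?_)
  · refine (setLIntegral_mono' measurableSet_Ioc fun τ hτ ↦
      hK.rearrangement_mul_le_of_forall_le hM hτ.1).trans_eq ?_
    rw [lintegral_const_mul _ (by fun_prop),
      lintegral_Ioc_rpow_sub_one (sub_pos.2 hb1) zero_le_one, Real.one_rpow]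
    ring
  · refine (setLIntegral_mono' measurableSet_Ioi fun τ hτ ↦
      hK.rearrangement_mul_le_lintegral hg (one_pos.trans hτ)).trans_eq ?_
    rw [lintegral_const_mul _ (by fun_prop), lintegral_Ioi_rpow_neg_sub_one hb one_pos,
      Real.one_rpow]
    ring

end WeakBound

/-! ### Lorentz spaces with second index two -/

section Lorentz

variable {α : Type*} [MeasurableSpace α] {μ : Measure α} {f g : α → ℝ≥0∞}

/-- The quasi-norm of `L^{1/a,2}`, normalised as `‖τ^{a-1/2} f^*(τ)‖_{L²(0,∞)}`. -/
noncomputable def lorentzTwoNorm (μ : Measure α) (a : ℝ) (f : α → ℝ≥0∞) : ℝ≥0∞ :=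
  (∫⁻ τ in Ioi (0 : ℝ),
    (ENNReal.ofReal (τ ^ (a - 1 / 2)) * rearrangement μ f (ENNReal.ofReal τ)) ^ (2 : ℝ)) ^
      (1 / 2 : ℝ)

lemma lorentzTwoNorm_mono (h : f ≤ᵐ[μ] g) (a : ℝ) :
    lorentzTwoNorm μ a f ≤ lorentzTwoNorm μ a g := by
  unfold lorentzTwoNorm
  gcongr
  exact rearrangement_mono h _

lemma lorentzTwoNorm_congr (h : f =ᵐ[μ] g) (a : ℝ) :
    lorentzTwoNorm μ a f = lorentzTwoNorm μ a g := by
  rw [lorentzTwoNorm, rearrangement_congr h, lorentzTwoNorm]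

lemma measurable_ofReal_rpow_mul_rearrangement (a : ℝ) (f : α → ℝ≥0∞) :
    Measurable fun τ : ℝ ↦ ENNReal.ofReal (τ ^ a) * rearrangement μ f (ENNReal.ofReal τ) :=
  Measurable.mul (by fun_prop) (measurable_rearrangement_ofReal f)

lemma lorentzTwoNorm_sq (a : ℝ) (f : α → ℝ≥0∞) : lorentzTwoNorm μ a f ^ 2 =
    ∫⁻ τ in Ioi (0 : ℝ),
      ENNReal.ofReal (τ ^ (2 * a - 1)) * rearrangement μ f (ENNReal.ofReal τ) ^ 2 := by
  rw [lorentzTwoNorm, ← ENNReal.rpow_two, ← ENNReal.rpow_mul, one_div_mul_cancel two_ne_zero,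
    ENNReal.rpow_one]
  refine setLIntegral_congr_fun measurableSet_Ioi fun τ (hτ : 0 < τ) ↦ ?_
  rw [ENNReal.mul_rpow_of_nonneg _ _ zero_le_two, ENNReal.rpow_two (rearrangement μ f _),
    ENNReal.ofReal_rpow_of_nonneg (by positivity) zero_le_two, ← Real.rpow_mul hτ.le]
  ring_nf

lemma lorentzTwoNorm_eq_comp_add_self (a : ℝ) (f : α → ℝ≥0∞) :
    lorentzTwoNorm μ a f = ENNReal.ofReal (2 ^ a) * (∫⁻ τ in Ioi (0 : ℝ),
      (ENNReal.ofReal (τ ^ (a - 1 / 2)) *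
        rearrangement μ f (ENNReal.ofReal τ + ENNReal.ofReal τ)) ^ (2 : ℝ)) ^ (1 / 2 : ℝ) := by
  have hconst : ENNReal.ofReal (2 ^ a) =
      (ENNReal.ofReal 2 * ENNReal.ofReal (2 ^ (a - 1 / 2)) ^ (2 : ℝ)) ^ (1 / 2 : ℝ) := by
    rw [ENNReal.ofReal_rpow_of_pos (by positivity), ← ENNReal.ofReal_mul zero_le_two,
      ENNReal.ofReal_rpow_of_pos (by positivity), ← Real.rpow_mul zero_le_two,
      mul_comm 2, ← Real.rpow_add_one two_ne_zero, ← Real.rpow_mul zero_le_two]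
    ring_nf
  rw [hconst, ← ENNReal.mul_rpow_of_nonneg _ _ one_half_pos.le, lorentzTwoNorm,
    lintegral_Ioi_comp_mul _ two_pos, mul_assoc,
    ← lintegral_const_mul' (ENNReal.ofReal (2 ^ (a - 1 / 2)) ^ (2 : ℝ)) _ (by simp)]
  congr 2
  refine setLIntegral_congr_fun measurableSet_Ioi fun τ (hτ : 0 < τ) ↦ ?_
  rw [← ENNReal.ofReal_add hτ.le hτ.le, ← two_mul, Real.mul_rpow zero_le_two hτ.le,
    ENNReal.ofReal_mul (by positivity), mul_assoc, ENNReal.mul_rpow_of_nonneg _ _ zero_le_two]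

lemma lorentzTwoNorm_add_le (a : ℝ) (f g : α → ℝ≥0∞) : lorentzTwoNorm μ a (f + g) ≤
    ENNReal.ofReal (2 ^ a) * (lorentzTwoNorm μ a f + lorentzTwoNorm μ a g) := by
  rw [lorentzTwoNorm_eq_comp_add_self]
  gcongr
  refine le_trans ?_ (ENNReal.lintegral_Lp_add_le
    (measurable_ofReal_rpow_mul_rearrangement _ f).aemeasurable
    (measurable_ofReal_rpow_mul_rearrangement _ g).aemeasurable one_le_two)
  simp only [Pi.add_apply, ← mul_add]
  gcongr
  exact rearrangement_add_le f g _ _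

lemma lorentzTwoNorm_enorm_add_le {F : Type*} [NormedAddCommGroup F] (a : ℝ) (f g : α → F) :
    lorentzTwoNorm μ a (fun x ↦ ‖f x + g x‖ₑ) ≤ ENNReal.ofReal (2 ^ a) *
      (lorentzTwoNorm μ a (fun x ↦ ‖f x‖ₑ) + lorentzTwoNorm μ a (fun x ↦ ‖g x‖ₑ)) :=
  (lorentzTwoNorm_mono (.of_forall fun x ↦ enorm_add_le (f x) (g x)) a).trans
    (lorentzTwoNorm_add_le a _ _)

lemma HasWeakBound.lorentzTwoNorm_mul_le {b : ℝ} {K : ℝ≥0∞} (hf : HasWeakBound μ b K f)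
    (a : ℝ) (g : α → ℝ≥0∞) : lorentzTwoNorm μ (a + b) (f * g) ≤
      ENNReal.ofReal (2 ^ (a + b)) * (K * lorentzTwoNorm μ a g) := by
  have hconst : K = (K ^ (2 : ℝ)) ^ (1 / 2 : ℝ) := by
    rw [← ENNReal.rpow_mul, mul_one_div_cancel two_ne_zero, ENNReal.rpow_one]
  rw [lorentzTwoNorm_eq_comp_add_self, hconst, lorentzTwoNorm,
    ← ENNReal.mul_rpow_of_nonneg _ _ one_half_pos.le, ← lintegral_const_mul _
      ((measurable_ofReal_rpow_mul_rearrangement _ g).pow_const _)]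
  gcongr _ * ?_ ^ _
  refine setLIntegral_mono' measurableSet_Ioi fun τ (hτ : 0 < τ) ↦ ?_
  rw [← ENNReal.mul_rpow_of_nonneg _ _ zero_le_two]
  refine ENNReal.rpow_le_rpow ?_ zero_le_two
  calc ENNReal.ofReal (τ ^ (a + b - 1 / 2)) *
        rearrangement μ (f * g) (ENNReal.ofReal τ + ENNReal.ofReal τ)
      ≤ ENNReal.ofReal (τ ^ (a + b - 1 / 2)) *
          (K * ENNReal.ofReal (τ ^ (-b)) * rearrangement μ g (ENNReal.ofReal τ)) := by
        gcongr
        exact (rearrangement_mul_le f g _ _).trans (mul_le_mul_left (hf τ hτ) _)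
    _ = K * (ENNReal.ofReal (τ ^ (a - 1 / 2)) * rearrangement μ g (ENNReal.ofReal τ)) := by
        rw [mul_assoc K, mul_left_comm, ← mul_assoc (ENNReal.ofReal _),
          ← ENNReal.ofReal_mul (by positivity), ← Real.rpow_add hτ]
        ring_nf

lemma HasWeakBound.lorentzTwoNorm_enorm_mul_le {F : Type*} [NormedDivisionRing F] {W : α → F}
    {b : ℝ} {K : ℝ≥0∞} (hW : HasWeakBound μ b K (fun x ↦ ‖W x‖ₑ)) (a : ℝ) (f : α → F) :
    lorentzTwoNorm μ (a + b) (fun x ↦ ‖W x * f x‖ₑ) ≤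
      ENNReal.ofReal (2 ^ (a + b)) * (K * lorentzTwoNorm μ a (fun x ↦ ‖f x‖ₑ)) := by
  simpa only [enorm_mul] using! hW.lorentzTwoNorm_mul_le a (fun x ↦ ‖f x‖ₑ)

lemma lintegral_mul_le_lorentzTwoNorm [SFinite μ] (hf : AEMeasurable f μ)
    (hg : AEMeasurable g μ) (a : ℝ) :
    ∫⁻ x, f x * g x ∂μ ≤ 2 * (lorentzTwoNorm μ a f * lorentzTwoNorm μ (1 - a) g) := by
  refine (lintegral_mul_le_rearrangement hf hg).trans ?_
  gcongr
  refine le_trans (le_of_eq ?_) (ENNReal.lintegral_mul_le_Lp_mul_Lq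
    (volume.restrict (Ioi (0 : ℝ))) Real.HolderConjugate.two_two
    (measurable_ofReal_rpow_mul_rearrangement _ f).aemeasurable
    (measurable_ofReal_rpow_mul_rearrangement _ g).aemeasurable)
  refine setLIntegral_congr_fun measurableSet_Ioi fun τ (hτ : 0 < τ) ↦ ?_
  rw [Pi.mul_apply, mul_mul_mul_comm, show 1 - a - 1 / 2 = -(a - 1 / 2) by ring,
    ofReal_rpow_mul_ofReal_rpow_neg hτ, one_mul]

lemma hasWeakBound_lorentzTwoNorm {a : ℝ} (ha : 0 < a) (f : α → ℝ≥0∞) :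
    HasWeakBound μ a (ENNReal.ofReal (2 * a) ^ (1 / 2 : ℝ) * lorentzTwoNorm μ a f) f := by
  intro τ hτ
  have h2a : 0 < 2 * a := by positivity
  have hsq : (ENNReal.ofReal (τ ^ a) * rearrangement μ f (ENNReal.ofReal τ)) ^ 2 ≤
      ENNReal.ofReal (2 * a) * lorentzTwoNorm μ a f ^ 2 := by
    calc (ENNReal.ofReal (τ ^ a) * rearrangement μ f (ENNReal.ofReal τ)) ^ 2
        = ENNReal.ofReal (2 * a) * ((∫⁻ t in Ioc (0 : ℝ) τ, ENNReal.ofReal (t ^ (2 * a - 1))) *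
            rearrangement μ f (ENNReal.ofReal τ) ^ 2) := by
          rw [lintegral_Ioc_rpow_sub_one h2a hτ.le, ← mul_assoc, ← ENNReal.ofReal_mul h2a.le,
            mul_div_cancel₀ _ h2a.ne', mul_pow, ← ENNReal.ofReal_pow (by positivity), mul_comm 2 a,
            Real.rpow_mul hτ.le, Real.rpow_two]
      _ ≤ ENNReal.ofReal (2 * a) * ∫⁻ t in Ioc (0 : ℝ) τ, ENNReal.ofReal (t ^ (2 * a - 1)) *
            rearrangement μ f (ENNReal.ofReal t) ^ 2 := by
          rw [← lintegral_mul_const _ (by fun_prop)]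
          gcongr _ * ?_
          refine setLIntegral_mono' measurableSet_Ioc fun t ht ↦ ?_
          gcongr
          exact rearrangement_antitone f (ENNReal.ofReal_le_ofReal ht.2)
      _ ≤ ENNReal.ofReal (2 * a) * lorentzTwoNorm μ a f ^ 2 := by
          rw [lorentzTwoNorm_sq]
          gcongr
          exact Ioc_subset_Ioi_self
  have hroot := ENNReal.rpow_le_rpow hsq one_half_pos.le
  simp only [ENNReal.mul_rpow_of_nonneg _ _ one_half_pos.le, ← ENNReal.rpow_natCast,
    ← ENNReal.rpow_mul, Nat.cast_ofNat, mul_one_div_cancel (two_ne_zero' ℝ),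
    ENNReal.rpow_one] at hroot
  calc rearrangement μ f (ENNReal.ofReal τ)
      = ENNReal.ofReal (τ ^ a) * rearrangement μ f (ENNReal.ofReal τ) *
          ENNReal.ofReal (τ ^ (-a)) := by
        rw [mul_right_comm, ofReal_rpow_mul_ofReal_rpow_neg hτ, one_mul]
    _ ≤ ENNReal.ofReal (2 * a) ^ (1 / 2 : ℝ) * lorentzTwoNorm μ a f * ENNReal.ofReal (τ ^ (-a)) :=
        mul_le_mul_left hroot _

lemma measure_lt_top_of_lorentzTwoNorm {a : ℝ} (ha : 0 < a) (hf : lorentzTwoNorm μ a f < ∞)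
    {s : ℝ≥0∞} (hs : 0 < s) : μ {x | s < f x} < ∞ :=
  (hasWeakBound_lorentzTwoNorm ha f).measure_lt_top ha
    (ENNReal.mul_ne_top (ENNReal.rpow_ne_top_of_nonneg one_half_pos.le ENNReal.ofReal_ne_top)
      hf.ne) hs

lemma lorentzTwoNorm_half {F : Type*} [NormedAddCommGroup F] [SFinite μ] {f : α → F}
    (hf : AEStronglyMeasurable f μ) :
    lorentzTwoNorm μ (1 / 2) (fun x ↦ ‖f x‖ₑ) = eLpNorm f 2 μ := by
  simp only [lorentzTwoNorm, sub_self, Real.rpow_zero, ENNReal.ofReal_one, one_mul,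
    lintegral_rearrangement_rpow hf.enorm two_pos,
    eLpNorm_eq_lintegral_rpow_enorm_toReal two_ne_zero ENNReal.ofNat_ne_top, ENNReal.toReal_ofNat]

lemma ofReal_two_mul_mul_lorentzTwoNorm_sq {a : ℝ} (ha : 0 < a) (f : α → ℝ≥0∞) :
    ENNReal.ofReal (2 * a) * lorentzTwoNorm μ a f ^ 2 = 2 * ∫⁻ t in Ioi (0 : ℝ),
      ENNReal.ofReal t * μ {x | ENNReal.ofReal t < f x} ^ (2 * a) := by
  have h := lintegral_rpow_mul_rearrangement_rpow (μ := μ) f (mul_pos two_pos ha) two_pos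
  simp only [ENNReal.rpow_two, ENNReal.ofReal_ofNat] at h
  rw [lorentzTwoNorm_sq, h]
  norm_num

lemma tendsto_rearrangement_indicator (hf : AEMeasurable f μ) {s : ℕ → Set α}
    (hs : ∀ n, NullMeasurableSet (s n) μ) (hanti : Antitone s) (hinter : ⋂ n, s n = ∅)
    (hfin : ∀ t : ℝ≥0∞, 0 < t → μ {x | t < f x} < ∞) {τ : ℝ≥0∞} (hτ : 0 < τ) :
    Filter.Tendsto (fun n ↦ rearrangement μ ((s n).indicator f) τ) Filter.atTop (nhds 0) := by
  refine ENNReal.tendsto_nhds_zero.2 fun t ht ↦ ?_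
  have superlevel_eq (n : ℕ) : {x | t < (s n).indicator f x} = s n ∩ {x | t < f x} := by
    ext x
    by_cases hx : x ∈ s n <;> simp [hx]
  have hlim : Filter.Tendsto (fun n ↦ μ (s n ∩ {x | t < f x})) Filter.atTop (nhds 0) := by
    have h := tendsto_measure_iInter_atTop (μ := μ) (s := fun n ↦ s n ∩ {x | t < f x})
      (fun n ↦ (hs n).inter (nullMeasurableSet_lt aemeasurable_const hf))
      (fun i j hij ↦ inter_subset_inter_left _ (hanti hij))
      ⟨0, ((measure_mono inter_subset_right).trans_lt (hfin t ht)).ne⟩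
    rwa [← iInter_inter, hinter, empty_inter, measure_empty] at h
  filter_upwards [hlim.eventually (ge_mem_nhds hτ)] with n hn
  rwa [rearrangement_le_iff, superlevel_eq]

lemma tendsto_lorentzTwoNorm_indicator {a : ℝ} (ha : 0 < a) (hf : AEMeasurable f μ)
    (hfin : lorentzTwoNorm μ a f < ∞) {s : ℕ → Set α} (hs : ∀ n, NullMeasurableSet (s n) μ)
    (hanti : Antitone s) (hinter : ⋂ n, s n = ∅) :
    Filter.Tendsto (fun n ↦ lorentzTwoNorm μ a ((s n).indicator f)) Filter.atTop (nhds 0) := by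
  have hmeas (g : α → ℝ≥0∞) := (measurable_ofReal_rpow_mul_rearrangement (μ := μ)
    (a - 1 / 2) g).pow_const (2 : ℝ)
  have hlim : Filter.Tendsto (fun n ↦ ∫⁻ τ in Ioi (0 : ℝ), (ENNReal.ofReal (τ ^ (a - 1 / 2)) *
      rearrangement μ ((s n).indicator f) (ENNReal.ofReal τ)) ^ (2 : ℝ)) Filter.atTop
      (nhds (∫⁻ _ in Ioi (0 : ℝ), 0)) := by
    refine tendsto_lintegral_of_dominated_convergence _ (fun n ↦ hmeas _) (fun n ↦ ?_)
      ((ENNReal.rpow_lt_top_iff_of_pos one_half_pos).1 hfin).ne ?_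
    · refine .of_forall fun τ ↦ ?_
      dsimp only
      gcongr
      exact rearrangement_mono (.of_forall (indicator_le_self _ _)) _
    · filter_upwards [ae_restrict_mem measurableSet_Ioi] with τ hτ
      have h := tendsto_rearrangement_indicator hf hs hanti hinter
        (fun t ht ↦ measure_lt_top_of_lorentzTwoNorm ha hfin ht) (ENNReal.ofReal_pos.2 hτ)
      simpa [Function.comp_def] using (ENNReal.continuous_rpow_const (y := 2)).tendsto _ |>.comp
        (ENNReal.Tendsto.const_mul h (Or.inr ENNReal.ofReal_ne_top))
  simpa [lorentzTwoNorm, Function.comp_def] using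
    (ENNReal.continuous_rpow_const (y := 1 / 2)).tendsto _ |>.comp hlim

lemma lorentzTwoNorm_comp_measurableEquiv {β : Type*} [MeasurableSpace β] {ν : Measure β}
    {e : β ≃ᵐ α} (he : MeasurePreserving e ν μ) (a : ℝ) (f : α → ℝ≥0∞) :
    lorentzTwoNorm ν a (f ∘ e) = lorentzTwoNorm μ a f := by
  have hrearr (τ : ℝ≥0∞) : rearrangement ν (f ∘ e) τ = rearrangement μ f τ := by
    refine eq_of_forall_lt_iff fun s ↦ ?_
    rw [lt_rearrangement_iff, lt_rearrangement_iff, ← he.measure_preimage_equiv]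
    rfl
  simp only [lorentzTwoNorm, hrearr]

end Lorentz

/-! ### Hardy's inequality and convolution with measures of fractional dimension -/

section Hardy

variable {κ a τ : ℝ} {F : ℝ → ℝ≥0∞}

lemma sq_lintegral_mul_le {α : Type*} [MeasurableSpace α] {μ : Measure α} {w u f : α → ℝ≥0∞}
    (hw : AEMeasurable w μ) (hu : AEMeasurable u μ) (hf : AEMeasurable f μ)
    (hu₀ : ∀ᵐ x ∂μ, u x ≠ 0) (hu_top : ∀ᵐ x ∂μ, u x ≠ ∞) :
    (∫⁻ x, w x * f x ∂μ) ^ 2 ≤ (∫⁻ x, w x * u x ∂μ) * ∫⁻ x, w x * ((u x)⁻¹ * f x ^ 2) ∂μ := by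
  have sqrt_sq (z : ℝ≥0∞) : (z ^ (1 / 2 : ℝ)) ^ (2 : ℝ) = z := by
    rw [← ENNReal.rpow_mul]
    norm_num
  have holder := ENNReal.lintegral_mul_le_Lp_mul_Lq μ Real.HolderConjugate.two_two
    (f := fun x ↦ (w x * u x) ^ (1 / 2 : ℝ))
    (g := fun x ↦ (w x * ((u x)⁻¹ * f x ^ 2)) ^ (1 / 2 : ℝ)) (by fun_prop) (by fun_prop)
  simp_rw [sqrt_sq] at holder
  have integrand : ∀ᵐ x ∂μ, w x * f x =
      (w x * u x) ^ (1 / 2 : ℝ) * (w x * ((u x)⁻¹ * f x ^ 2)) ^ (1 / 2 : ℝ) := by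
    filter_upwards [hu₀, hu_top] with x hx₀ hx_top
    rw [← ENNReal.mul_rpow_of_nonneg _ _ (by norm_num),
      show w x * u x * (w x * ((u x)⁻¹ * f x ^ 2)) = u x * (u x)⁻¹ * (w x * f x) ^ 2 by ring,
      ENNReal.mul_inv_cancel hx₀ hx_top, one_mul, ← ENNReal.rpow_two, ← ENNReal.rpow_mul]
    norm_num
  calc (∫⁻ x, w x * f x ∂μ) ^ 2
      ≤ ((∫⁻ x, w x * u x ∂μ) ^ (1 / 2 : ℝ) *
          (∫⁻ x, w x * ((u x)⁻¹ * f x ^ 2) ∂μ) ^ (1 / 2 : ℝ)) ^ 2 := by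
        gcongr
        exact (lintegral_congr_ae integrand).trans_le holder
    _ = _ := by rw [mul_pow, ← ENNReal.rpow_two, ← ENNReal.rpow_two, sqrt_sq, sqrt_sq]

lemma lintegral_min_one_rpow_mul_rpow_neg_lt_top (hκ : κ < a) (ha : a < 1) :
    ∫⁻ ρ in Ioi (0 : ℝ), ENNReal.ofReal (min 1 (ρ ^ (κ - 1)) * ρ ^ (-a)) < ∞ := by
  simpa only [mul_comm, neg_sub, sub_sub_cancel_left] using
    lintegral_rpow_sub_one_mul_min_rpow_neg_lt_top (sub_pos.2 ha) (sub_lt_sub_left hκ 1)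

lemma lintegral_min_rpow_mul_eq (F : ℝ → ℝ≥0∞) (hτ : 0 < τ) :
    ∫⁻ σ in Ioi (0 : ℝ), ENNReal.ofReal (min (τ ^ (κ - 1)) (σ ^ (κ - 1))) * F σ =
      ENNReal.ofReal (τ ^ κ) *
        ∫⁻ ρ in Ioi (0 : ℝ), ENNReal.ofReal (min 1 (ρ ^ (κ - 1))) * F (τ * ρ) := by
  rw [lintegral_Ioi_comp_mul _ hτ, ← lintegral_const_mul' _ _ ENNReal.ofReal_ne_top,
    ← lintegral_const_mul' _ _ ENNReal.ofReal_ne_top]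
  refine setLIntegral_congr_fun measurableSet_Ioi fun ρ (hρ : 0 < ρ) ↦ ?_
  have hmin : τ * min (τ ^ (κ - 1)) ((τ * ρ) ^ (κ - 1)) = τ ^ κ * min 1 (ρ ^ (κ - 1)) := by
    rw [Real.mul_rpow hτ.le hρ.le, Real.rpow_sub_one hτ.ne', mul_min_of_nonneg _ _ hτ.le,
      mul_min_of_nonneg _ _ (by positivity), mul_one, ← mul_assoc, mul_div_cancel₀ _ hτ.ne']
  rw [← mul_assoc, ← mul_assoc, ← ENNReal.ofReal_mul hτ.le,
    ← ENNReal.ofReal_mul (by positivity), hmin]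

lemma rpow_mul_sq_lintegral_min_rpow_mul_le (hF : Measurable F) (hτ : 0 < τ) :
    ENNReal.ofReal (τ ^ (2 * (a - κ) - 1)) * (∫⁻ σ in Ioi (0 : ℝ),
        ENNReal.ofReal (min (τ ^ (κ - 1)) (σ ^ (κ - 1))) * F σ) ^ 2 ≤
      (∫⁻ ρ in Ioi (0 : ℝ), ENNReal.ofReal (min 1 (ρ ^ (κ - 1)) * ρ ^ (-a))) *
        ∫⁻ ρ in Ioi (0 : ℝ), ENNReal.ofReal (min 1 (ρ ^ (κ - 1))) * (ENNReal.ofReal (ρ ^ a) *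
          (ENNReal.ofReal (τ ^ (2 * a - 1)) * F (τ * ρ) ^ 2)) := by
  have hexp : τ ^ (2 * (a - κ) - 1) * (τ ^ κ) ^ 2 = τ ^ (2 * a - 1) := by
    rw [← Real.rpow_natCast, ← Real.rpow_mul hτ.le, ← Real.rpow_add hτ]
    congr 1
    push_cast
    ring
  have hpos : ∀ᵐ ρ ∂(volume.restrict (Ioi (0 : ℝ))), ENNReal.ofReal (ρ ^ (-a)) ≠ 0 := by
    filter_upwards [ae_restrict_mem measurableSet_Ioi] with ρ hρ
    simpa using Real.rpow_pos_of_pos hρ _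
  have schur := sq_lintegral_mul_le (μ := volume.restrict (Ioi (0 : ℝ)))
    (w := fun ρ ↦ ENNReal.ofReal (min 1 (ρ ^ (κ - 1)))) (u := fun ρ ↦ ENNReal.ofReal (ρ ^ (-a)))
    (f := fun ρ ↦ F (τ * ρ)) (by fun_prop) (by fun_prop) (by fun_prop) hpos (by simp)
  have hweight : ∫⁻ ρ in Ioi (0 : ℝ), ENNReal.ofReal (min 1 (ρ ^ (κ - 1)) * ρ ^ (-a)) =
      ∫⁻ ρ in Ioi (0 : ℝ), ENNReal.ofReal (min 1 (ρ ^ (κ - 1))) * ENNReal.ofReal (ρ ^ (-a)) :=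
    setLIntegral_congr_fun measurableSet_Ioi fun ρ (hρ : 0 < ρ) ↦
      ENNReal.ofReal_mul (by positivity)
  rw [lintegral_min_rpow_mul_eq F hτ, mul_pow, ← mul_assoc, ← ENNReal.ofReal_pow (by positivity),
    ← ENNReal.ofReal_mul (by positivity), hexp, hweight]
  refine (mul_le_mul_right schur _).trans_eq ?_
  rw [mul_left_comm, ← lintegral_const_mul' _ _ ENNReal.ofReal_ne_top]
  congr 1
  refine setLIntegral_congr_fun measurableSet_Ioi fun ρ (hρ : 0 < ρ) ↦ ?_
  rw [← ENNReal.ofReal_inv_of_pos (by positivity), ← Real.rpow_neg hρ.le, neg_neg]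
  ring

lemma rpow_mul_lintegral_rpow_mul_comp_mul (F : ℝ → ℝ≥0∞) {ρ : ℝ} (hρ : 0 < ρ) :
    ENNReal.ofReal (ρ ^ a) *
        ∫⁻ τ in Ioi (0 : ℝ), ENNReal.ofReal (τ ^ (2 * a - 1)) * F (τ * ρ) ^ 2 =
      ENNReal.ofReal (ρ ^ (-a)) *
        ∫⁻ τ in Ioi (0 : ℝ), ENNReal.ofReal (τ ^ (2 * a - 1)) * F τ ^ 2 := by
  rw [lintegral_Ioi_comp_mul (fun τ ↦ ENNReal.ofReal (τ ^ (2 * a - 1)) * F τ ^ 2) hρ,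
    ← mul_assoc, ← lintegral_const_mul' _ _ ENNReal.ofReal_ne_top,
    ← lintegral_const_mul' _ _ (ENNReal.mul_ne_top ENNReal.ofReal_ne_top ENNReal.ofReal_ne_top)]
  refine setLIntegral_congr_fun measurableSet_Ioi fun τ (hτ : 0 < τ) ↦ ?_
  have hexp : ρ ^ a * τ ^ (2 * a - 1) = ρ ^ (-a) * ρ * (ρ * τ) ^ (2 * a - 1) := by
    rw [Real.mul_rpow hρ.le hτ.le, ← mul_assoc, ← Real.rpow_add_one hρ.ne', ← Real.rpow_add hρ]
    ring_nf
  rw [← mul_assoc, ← mul_assoc, ← ENNReal.ofReal_mul (by positivity),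
    ← ENNReal.ofReal_mul (by positivity), ← ENNReal.ofReal_mul (by positivity), hexp, mul_comm ρ τ]

lemma lintegral_rpow_mul_sq_lintegral_min_rpow_mul_le (hF : Measurable F) :
    ∫⁻ τ in Ioi (0 : ℝ), ENNReal.ofReal (τ ^ (2 * (a - κ) - 1)) * (∫⁻ σ in Ioi (0 : ℝ),
        ENNReal.ofReal (min (τ ^ (κ - 1)) (σ ^ (κ - 1))) * F σ) ^ 2 ≤
      (∫⁻ ρ in Ioi (0 : ℝ), ENNReal.ofReal (min 1 (ρ ^ (κ - 1)) * ρ ^ (-a))) ^ 2 *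
        ∫⁻ τ in Ioi (0 : ℝ), ENNReal.ofReal (τ ^ (2 * a - 1)) * F τ ^ 2 := by
  set I := ∫⁻ τ in Ioi (0 : ℝ), ENNReal.ofReal (τ ^ (2 * a - 1)) * F τ ^ 2 with hI
  refine (setLIntegral_mono' measurableSet_Ioi fun τ hτ ↦
    rpow_mul_sq_lintegral_min_rpow_mul_le hF hτ).trans ?_
  have hmeas : Measurable fun z : ℝ × ℝ ↦ ENNReal.ofReal (min 1 (z.2 ^ (κ - 1))) *
      (ENNReal.ofReal (z.2 ^ a) * (ENNReal.ofReal (z.1 ^ (2 * a - 1)) * F (z.1 * z.2) ^ 2)) := by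
    fun_prop
  rw [lintegral_const_mul _ hmeas.lintegral_prod_right', sq, mul_assoc,
    lintegral_lintegral_swap hmeas.aemeasurable, ← lintegral_mul_const I (by fun_prop)]
  gcongr _ * ?_
  refine (setLIntegral_congr_fun measurableSet_Ioi fun ρ (hρ : 0 < ρ) ↦ ?_).le
  simp only
  rw [lintegral_const_mul' _ _ ENNReal.ofReal_ne_top,
    lintegral_const_mul' _ _ ENNReal.ofReal_ne_top, rpow_mul_lintegral_rpow_mul_comp_mul F hρ,
    ← mul_assoc, ← hI, ← ENNReal.ofReal_mul (by positivity)]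

end Hardy

section Convolution

variable {κ : ℝ} {C : ℝ≥0}

lemma min_rpow_le_lintegral_indicator {τ : ℝ} (hκ : κ < 1) {x : ℝ≥0∞} (hx : x ≠ ∞) :
    min (x ^ κ) (ENNReal.ofReal (τ ^ (κ - 1)) * x) ≤ ∫⁻ σ in Ioi (0 : ℝ),
      {σ : ℝ | ENNReal.ofReal σ < x}.indicator
        (fun σ ↦ ENNReal.ofReal (min (τ ^ (κ - 1)) (σ ^ (κ - 1)))) σ := by
  obtain rfl | hx₀ := eq_or_ne x 0
  · simp
  obtain ⟨X, hX, rfl⟩ : ∃ X : ℝ, 0 < X ∧ x = ENNReal.ofReal X :=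
    ⟨x.toReal, ENNReal.toReal_pos hx₀ hx, (ENNReal.ofReal_toReal hx).symm⟩
  calc min (ENNReal.ofReal X ^ κ) (ENNReal.ofReal (τ ^ (κ - 1)) * ENNReal.ofReal X)
      = ENNReal.ofReal (min (τ ^ (κ - 1)) (X ^ (κ - 1)) * X) := by
        rw [min_mul_of_nonneg _ _ hX.le, ← Real.rpow_add_one hX.ne', sub_add_cancel, min_comm,
          ENNReal.ofReal_min, ENNReal.ofReal_rpow_of_pos hX, ENNReal.ofReal_mul' hX.le]
    _ = ∫⁻ _ in Ioo (0 : ℝ) X, ENNReal.ofReal (min (τ ^ (κ - 1)) (X ^ (κ - 1))) := by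
        rw [setLIntegral_const, Real.volume_Ioo, sub_zero, ENNReal.ofReal_mul' hX.le]
    _ ≤ ∫⁻ σ in Ioo (0 : ℝ) X, {σ : ℝ | ENNReal.ofReal σ < ENNReal.ofReal X}.indicator
        (fun σ ↦ ENNReal.ofReal (min (τ ^ (κ - 1)) (σ ^ (κ - 1)))) σ := by
        refine setLIntegral_mono' measurableSet_Ioo fun σ hσ ↦ ?_
        rw [indicator_of_mem (mem_ofPred_eq ▸ (ENNReal.ofReal_lt_ofReal_iff hX).2 hσ.2)]
        exact ENNReal.ofReal_le_ofReal (min_le_min_left _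
          (Real.rpow_le_rpow_of_nonpos hσ.1 hσ.2.le (by linarith)))
    _ ≤ _ := lintegral_mono_set Ioo_subset_Ioi_self

lemma rpow_le_ofReal_rpow_sub_one_mul {τ : ℝ} (hκ : κ < 1) (hτ : 0 < τ) {x : ℝ≥0∞}
    (hx : ENNReal.ofReal τ ≤ x) (hx_top : x ≠ ∞) :
    x ^ κ ≤ ENNReal.ofReal (τ ^ (κ - 1)) * x := by
  have hx₀ : x ≠ 0 := ((ENNReal.ofReal_pos.2 hτ).trans_le hx).ne'
  calc x ^ κ = x ^ (κ - 1) * x := by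
        nth_rewrite 3 [← ENNReal.rpow_one x]
        rw [← ENNReal.rpow_add _ _ hx₀ hx_top, sub_add_cancel]
    _ ≤ ENNReal.ofReal (τ ^ (κ - 1)) * x := by
        gcongr
        rw [← ENNReal.ofReal_rpow_of_pos hτ, ← neg_sub, ENNReal.rpow_neg, ENNReal.rpow_neg]
        exact ENNReal.inv_le_inv.2 (ENNReal.rpow_le_rpow hx (by linarith))

variable {G : Type*} [MeasurableSpace G] [AddCommGroup G] [MeasurableAdd₂ G]
  {μ ν : Measure G} [SFinite ν]

lemma lintegral_comp_add_ae_congr [SFinite μ] [μ.IsAddLeftInvariant] {f g : G → ℝ≥0∞}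
    (h : f =ᵐ[μ] g) :
    (fun x ↦ ∫⁻ y, f (y + x) ∂ν) =ᵐ[μ] fun x ↦ ∫⁻ y, g (y + x) ∂ν := by
  have hadd : Measure.QuasiMeasurePreserving (fun z : G × G ↦ z.1 + z.2) (ν.prod μ) μ :=
    Measure.quasiMeasurePreserving_snd.comp (measurePreserving_prod_add ν μ).quasiMeasurePreserving
  have hae := Measure.ae_ae_of_ae_prod
    (Measure.measurePreserving_swap.quasiMeasurePreserving.ae (hadd.ae h))
  filter_upwards [hae] with x hx using lintegral_congr_ae hx

lemma prod_restrict_add_mem_le_mul_measure [SFinite μ] [μ.IsAddLeftInvariant]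
    (hν : ∀ A, MeasurableSet A → ν A ≤ C * μ A ^ κ) {A B : Set G} (hA : MeasurableSet A) :
    ν.prod (μ.restrict B) {z | z.1 + z.2 ∈ A} ≤ C * (μ A ^ κ * μ B) := by
  have hm : MeasurableSet {z : G × G | z.1 + z.2 ∈ A} := measurable_add hA
  rw [Measure.prod_apply_symm hm]
  calc ∫⁻ x in B, ν ((fun y ↦ (y, x)) ⁻¹' {z | z.1 + z.2 ∈ A}) ∂μ
      ≤ ∫⁻ _ in B, C * μ A ^ κ ∂μ := by
        refine lintegral_mono fun x ↦ ?_
        rw [← measure_preimage_add_right μ x A]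
        exact hν _ (hm.preimage measurable_prodMk_right)
    _ = C * (μ A ^ κ * μ B) := by rw [setLIntegral_const, mul_assoc]

variable [MeasurableNeg G]

lemma prod_restrict_add_mem_le_mul_measure' [SFinite μ] [μ.IsAddLeftInvariant] [μ.IsNegInvariant]
    (hν : ∀ A, MeasurableSet A → ν A ≤ C * μ A ^ κ) {A B : Set G} (hA : MeasurableSet A)
    (hB : MeasurableSet B) :
    ν.prod (μ.restrict B) {z | z.1 + z.2 ∈ A} ≤ C * (μ B ^ κ * μ A) := by
  have hS : MeasurableSet {z : G × G | z.2 - z.1 ∈ B ∧ z.2 ∈ A} :=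
    ((measurable_snd.sub measurable_fst) hB).inter (measurable_snd hA)
  have hadd : MeasurableSet {z : G × G | z.1 + z.2 ∈ A} := measurable_add hA
  have change_variables : ν.prod (μ.restrict B) {z | z.1 + z.2 ∈ A} =
      ν.prod μ {z : G × G | z.2 - z.1 ∈ B ∧ z.2 ∈ A} := by
    have hrestrict : ν.prod (μ.restrict B) = (ν.prod μ).restrict (univ ×ˢ B) := by
      rw [← Measure.prod_restrict, Measure.restrict_univ]
    rw [← (measurePreserving_prod_add ν μ).measure_preimage hS.nullMeasurableSet, hrestrict,
      Measure.restrict_apply hadd]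
    congr 1
    ext z
    simp [and_comm]
  rw [change_variables, Measure.prod_apply_symm hS]
  calc ∫⁻ x, ν ((fun y ↦ (y, x)) ⁻¹' {z | z.2 - z.1 ∈ B ∧ z.2 ∈ A}) ∂μ
      ≤ ∫⁻ x, A.indicator (fun _ ↦ C * μ B ^ κ) x ∂μ := by
        refine lintegral_mono fun x ↦ ?_
        by_cases hx : x ∈ A
        · have hslice : (fun y ↦ (y, x)) ⁻¹' {z : G × G | z.2 - z.1 ∈ B ∧ z.2 ∈ A} =
              (fun y ↦ x - y) ⁻¹' B := by
            ext y
            simp [hx]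
          rw [hslice, indicator_of_mem hx,
            ← (Measure.measurePreserving_sub_left μ x).measure_preimage hB.nullMeasurableSet]
          exact hν _ (hB.preimage (by fun_prop))
        · simp [hx]
    _ = C * (μ B ^ κ * μ A) := by rw [lintegral_indicator_const hA, mul_assoc]

lemma prod_restrict_lt_comp_add_le [SFinite μ] [μ.IsAddLeftInvariant] [μ.IsNegInvariant]
    (hκ : κ < 1)
    (hν : ∀ A, MeasurableSet A → ν A ≤ C * μ A ^ κ) {f : G → ℝ≥0∞} (hf : Measurable f)
    {s : ℝ≥0∞} (hs : μ {x | s < f x} ≠ ∞) {B : Set G} (hB : MeasurableSet B) (hB_top : μ B ≠ ∞)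
    {τ : ℝ} (hτ : 0 < τ) (hτB : ENNReal.ofReal τ ≤ μ B) :
    ν.prod (μ.restrict B) {z | s < f (z.1 + z.2)} ≤
      C * ((∫⁻ σ in Ioi (0 : ℝ), {σ : ℝ | ENNReal.ofReal σ < μ {x | s < f x}}.indicator
        (fun σ ↦ ENNReal.ofReal (min (τ ^ (κ - 1)) (σ ^ (κ - 1)))) σ) * μ B) := by
  have hA : MeasurableSet {x | s < f x} := measurableSet_lt measurable_const hf
  set A := {x | s < f x}
  calc ν.prod (μ.restrict B) {z | z.1 + z.2 ∈ A}
      ≤ C * min (μ A ^ κ * μ B) (μ B ^ κ * μ A) := by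
        rw [mul_min]
        exact le_min (prod_restrict_add_mem_le_mul_measure hν hA)
          (prod_restrict_add_mem_le_mul_measure' hν hA hB)
    _ ≤ C * (min (μ A ^ κ) (ENNReal.ofReal (τ ^ (κ - 1)) * μ A) * μ B) := by
        rw [min_mul_of_nonneg _ _ zero_le, mul_right_comm]
        gcongr
        exact rpow_le_ofReal_rpow_sub_one_mul hκ hτ hτB hB_top
    _ ≤ _ := by
        gcongr
        exact min_rpow_le_lintegral_indicator hκ hs

-- To bound `(ν * f)^*(τ)` by `s`, integrate `f (y + x)` over `ν ⊗ μ|_B` for a set `B` of measure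
-- larger than `τ` on which the convolution exceeds `s`.
lemma rearrangement_lintegral_comp_add_le [SigmaFinite μ] [μ.IsAddLeftInvariant]
    [μ.IsNegInvariant] (hκ : κ < 1) (hν : ∀ A, MeasurableSet A → ν A ≤ C * μ A ^ κ)
    {f : G → ℝ≥0∞} (hf : Measurable f) (hfin : ∀ s, 0 < s → μ {x | s < f x} < ∞)
    {τ : ℝ} (hτ : 0 < τ) :
    rearrangement μ (fun x ↦ ∫⁻ y, f (y + x) ∂ν) (ENNReal.ofReal τ) ≤
      C * ∫⁻ σ in Ioi (0 : ℝ), ENNReal.ofReal (min (τ ^ (κ - 1)) (σ ^ (κ - 1))) *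
        rearrangement μ f (ENNReal.ofReal σ) := by
  have hadd : Measurable fun z : G × G ↦ f (z.1 + z.2) := hf.comp measurable_add
  refine le_of_forall_lt_imp_le_of_dense fun s hs ↦ ?_
  obtain ⟨B, hB, hBs, hτB, hB_top⟩ := Measure.exists_subset_measure_lt_top
    (measurableSet_lt measurable_const hadd.lintegral_prod_left') (lt_rearrangement_iff.1 hs)
  refine (ENNReal.mul_le_mul_iff_left (zero_le.trans_lt hτB).ne' hB_top.ne).1 ?_
  have layers_conv := lintegral_rpow_eq (μ := ν.prod (μ.restrict B)) hadd.aemeasurable one_pos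
  have layers_rearrangement := lintegral_mul_rpow_eq (μ := volume.restrict (Ioi (0 : ℝ)))
    (w := fun σ : ℝ ↦ ENNReal.ofReal (min (τ ^ (κ - 1)) (σ ^ (κ - 1)))) (by fun_prop)
    (measurable_rearrangement_ofReal (μ := μ) f).aemeasurable one_pos
  simp only [ENNReal.rpow_one, ENNReal.ofReal_one, one_mul, sub_self, Real.rpow_zero,
    lt_rearrangement_iff] at layers_conv layers_rearrangement
  calc s * μ B = ∫⁻ _ in B, s ∂μ := (setLIntegral_const _ _).symm
    _ ≤ ∫⁻ x in B, ∫⁻ y, f (y + x) ∂ν ∂μ := setLIntegral_mono' hB fun x hx ↦ (hBs hx).le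
    _ = ∫⁻ z, f (z.1 + z.2) ∂(ν.prod (μ.restrict B)) := (lintegral_prod_symm' _ hadd).symm
    _ ≤ _ := by
        rw [layers_conv, layers_rearrangement, mul_assoc, ← lintegral_mul_const' _ _ hB_top.ne,
          ← lintegral_const_mul' _ _ ENNReal.coe_ne_top]
        exact setLIntegral_mono' measurableSet_Ioi fun t ht ↦ prod_restrict_lt_comp_add_le hκ hν hf
          (hfin _ (ENNReal.ofReal_pos.2 ht)).ne hB hB_top.ne hτ hτB.le

theorem lorentzTwoNorm_lintegral_comp_add_le [SigmaFinite μ] [μ.IsAddLeftInvariant]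
    [μ.IsNegInvariant] {a : ℝ} (hκ₀ : 0 ≤ κ) (hκ : κ < a) (ha : a < 1)
    (hν : ∀ A, MeasurableSet A → ν A ≤ C * μ A ^ κ) {f : G → ℝ≥0∞} (hf : AEMeasurable f μ)
    (hfin : lorentzTwoNorm μ a f < ∞) :
    lorentzTwoNorm μ (a - κ) (fun x ↦ ∫⁻ y, f (y + x) ∂ν) ≤
      C * (∫⁻ ρ in Ioi (0 : ℝ), ENNReal.ofReal (min 1 (ρ ^ (κ - 1)) * ρ ^ (-a))) *
        lorentzTwoNorm μ a f := by
  rw [lorentzTwoNorm_congr hf.ae_eq_mk] at hfin ⊢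
  rw [lorentzTwoNorm_congr (lintegral_comp_add_ae_congr hf.ae_eq_mk)]
  refine (ENNReal.pow_le_pow_left_iff two_ne_zero).1 ?_
  rw [lorentzTwoNorm_sq, mul_pow, lorentzTwoNorm_sq, mul_pow, mul_assoc]
  refine le_trans ?_ (mul_le_mul_right
    (lintegral_rpow_mul_sq_lintegral_min_rpow_mul_le (measurable_rearrangement_ofReal _)) _)
  rw [← lintegral_const_mul' _ _ (ENNReal.pow_ne_top ENNReal.coe_ne_top)]
  refine setLIntegral_mono' measurableSet_Ioi fun τ hτ ↦ ?_
  rw [mul_left_comm, ← mul_pow]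
  gcongr
  exact rearrangement_lintegral_comp_add_le (hκ.trans ha) hν hf.measurable_mk
    (fun s hs ↦ measure_lt_top_of_lorentzTwoNorm (hκ₀.trans_lt hκ) hfin hs) hτ

end Convolution

section Euclidean

variable {d : ℕ}

lemma distFun_eq (f : E d → ℂ) {t : ℝ} (ht : 0 ≤ t) :
    distFun f t = volume {x | ENNReal.ofReal t < ‖f x‖ₑ} := by
  simp only [distFun, ← ofReal_norm, ENNReal.ofReal_lt_ofReal_iff_of_nonneg ht]

lemma lorentzNorm_two_eq {p : ℝ} (hp : 0 < p) (f : E d → ℂ) : lorentzNorm p 2 f =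
    ENNReal.ofReal (2 / p) ^ (1 / 2 : ℝ) * lorentzTwoNorm volume (1 / p) (‖f ·‖ₑ) := by
  have hsq : ENNReal.ofReal 2 * ∫⁻ t in Ioi (0 : ℝ), ENNReal.ofReal (t ^ ((2 : ℝ) - 1)) *
      distFun f t ^ (2 / p) =
        ENNReal.ofReal (2 / p) * lorentzTwoNorm volume (1 / p) (‖f ·‖ₑ) ^ 2 := by
    rw [show 2 / p = 2 * (1 / p) by ring,
      ofReal_two_mul_mul_lorentzTwoNorm_sq (by positivity), ENNReal.ofReal_ofNat]
    congr 1
    refine setLIntegral_congr_fun measurableSet_Ioi fun t (ht : 0 < t) ↦ ?_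
    norm_num [distFun_eq f ht.le]
  rw [lorentzNorm, hsq, ENNReal.mul_rpow_of_nonneg _ _ (by norm_num), ← ENNReal.rpow_two,
    ← ENNReal.rpow_mul]
  norm_num

lemma lorentzNorm_two_lt_top_iff {p : ℝ} (hp : 0 < p) {f : E d → ℂ} :
    lorentzNorm p 2 f < ∞ ↔ lorentzTwoNorm volume (1 / p) (‖f ·‖ₑ) < ∞ := by
  have h₀ : ENNReal.ofReal (2 / p) ^ (1 / 2 : ℝ) ≠ 0 := by simp [hp]
  rw [lorentzNorm_two_eq hp]
  refine ⟨fun h ↦ ENNReal.lt_top_of_mul_ne_top_right h.ne h₀, fun h ↦ ENNReal.mul_lt_top ?_ h⟩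
  exact ENNReal.rpow_lt_top_of_nonneg (by norm_num) ENNReal.ofReal_ne_top

lemma hasWeakBound_weakNorm {q : ℝ} (hq : 0 < q) (f : E d → ℂ) :
    HasWeakBound volume (1 / q) (weakNorm q f) (‖f ·‖ₑ) := by
  intro τ hτ
  refine le_of_forall_lt_imp_le_of_dense fun s hs ↦ ?_
  obtain rfl | hs₀ := eq_zero_or_pos s
  · exact zero_le
  obtain ⟨t, ht, rfl⟩ : ∃ t : ℝ, 0 < t ∧ ENNReal.ofReal t = s :=
    ⟨s.toReal, ENNReal.toReal_pos hs₀.ne' hs.ne_top, ENNReal.ofReal_toReal hs.ne_top⟩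
  have hlt := lt_rearrangement_iff.1 hs
  rw [← distFun_eq f ht.le] at hlt
  calc ENNReal.ofReal t
      = ENNReal.ofReal t * ENNReal.ofReal τ ^ (1 / q) * ENNReal.ofReal (τ ^ (-(1 / q))) := by
        rw [ENNReal.ofReal_rpow_of_pos hτ, mul_assoc, ofReal_rpow_mul_ofReal_rpow_neg hτ, mul_one]
    _ ≤ weakNorm q f * ENNReal.ofReal (τ ^ (-(1 / q))) := by
        gcongr
        refine le_trans ?_ (le_iSup₂ (f := fun (t : ℝ) (_ : 0 < t) ↦
          ENNReal.ofReal t * distFun f t ^ (1 / q)) t ht)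
        gcongr

end Euclidean

/-! ### The Bessel kernel as a Gaussian mixture -/

section Bessel

open ProbabilityTheory

lemma gaussianReal_zero_one_le_volume : gaussianReal 0 1 ≤ volume := by
  rw [gaussianReal_of_var_ne_zero 0 one_ne_zero]
  refine (withDensity_mono (ae_of_all _ fun x ↦ ?_)).trans_eq withDensity_one
  rw [gaussianPDF, gaussianPDFReal, Pi.one_apply, ENNReal.ofReal_le_one]
  refine mul_le_one₀ (inv_le_one_of_one_le₀ (Real.one_le_sqrt.2 ?_)) (Real.exp_nonneg _)
    (Real.exp_le_one_iff.2 ?_)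
  · have := Real.pi_gt_three
    rw [NNReal.coe_one]
    linarith
  · rw [neg_div]
    exact neg_nonpos.2 (by positivity)

lemma pi_measure_mono {ι : Type*} [Fintype ι] {α : ι → Type*} [∀ i, MeasurableSpace (α i)]
    {μ ν : ∀ i, Measure (α i)} [∀ i, SigmaFinite (μ i)] (h : ∀ i, μ i ≤ ν i) :
    Measure.pi μ ≤ Measure.pi ν := by
  have houter : (Measure.pi μ).toOuterMeasure ≤
      OuterMeasure.pi fun i ↦ (ν i).toOuterMeasure := by
    refine OuterMeasure.le_pi.2 fun s _ ↦ ?_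
    rw [Measure.coe_toOuterMeasure, Measure.pi_pi]
    exact Finset.prod_le_prod' fun i _ ↦ h i (s i)
  refine Measure.le_iff.2 fun A hA ↦ (houter A).trans_eq ?_
  rw [Measure.pi_def, toMeasure_apply _ _ hA]

lemma stdGaussian_le_volume (d : ℕ) : stdGaussian (E d) ≤ volume := by
  rw [← map_pi_eq_stdGaussian, ← (PiLp.volume_preserving_toLp (Fin d)).map_eq]
  exact Measure.map_mono (pi_measure_mono fun _ ↦ gaussianReal_zero_one_le_volume)
    (PiLp.volume_preserving_toLp (Fin d)).measurable

/-- The law of `√(2 t) z`, where `t` has the `Γ(α/2, 1)` distribution and `z` is a standard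
Gaussian vector; its density is the kernel of `S_{-α}`. -/
noncomputable def besselMeasure (d : ℕ) (α : ℝ) : Measure (E d) :=
  ((gammaMeasure (α / 2) 1).prod (stdGaussian (E d))).map fun z ↦ √(2 * z.1) • z.2

variable {d : ℕ} {α : ℝ}

lemma isProbabilityMeasure_besselMeasure (hα : 0 < α) :
    IsProbabilityMeasure (besselMeasure d α) := by
  have := isProbabilityMeasure_gammaMeasure (half_pos hα) one_pos
  exact Measure.isProbabilityMeasure_map (by fun_prop)

lemma measurable_gammaPDF (a r : ℝ) : Measurable (gammaPDF a r) :=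
  (measurable_gammaPDFReal a r).ennreal_ofReal

lemma ae_gammaMeasure_pos (a : ℝ) : ∀ᵐ t ∂(gammaMeasure a 1), 0 < t := by
  rw [gammaMeasure, ae_withDensity_iff (measurable_gammaPDF a 1)]
  filter_upwards [Measure.ae_ne volume 0] with t ht₀ ht
  by_contra hneg
  exact ht (gammaPDF_of_neg (lt_of_le_of_ne (not_lt.1 hneg) ht₀))

lemma integral_exp_neg_mul_gammaMeasure {a s : ℝ} (ha : 0 < a) (hs : 0 ≤ s) :
    ∫ t, Real.exp (-(t * s)) ∂(gammaMeasure a 1) = (1 + s) ^ (-a) := by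
  have hG := Real.Gamma_pos_of_pos ha
  have integrand (t : ℝ) : (gammaPDF a 1 t).toReal • Real.exp (-(t * s)) =
      (Ici (0 : ℝ)).indicator (fun t ↦ (Real.Gamma a)⁻¹ *
        (t ^ (a - 1) * Real.exp (-((1 + s) * t)))) t := by
    obtain ht | ht := lt_or_ge t 0
    · simp [gammaPDF_of_neg ht, ht]
    · rw [gammaPDF_of_nonneg ht, indicator_of_mem (mem_Ici.2 ht),
        ENNReal.toReal_ofReal (by positivity), smul_eq_mul, Real.one_rpow, one_div, one_mul,
        mul_assoc, mul_assoc, ← Real.exp_add]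
      ring_nf
  rw [gammaMeasure, integral_withDensity_eq_integral_toReal_smul (measurable_gammaPDF a 1)
    (by simp [gammaPDF])]
  simp_rw [integrand]
  rw [integral_indicator measurableSet_Ici, integral_const_mul, integral_Ici_eq_integral_Ioi,
    Real.integral_rpow_mul_exp_neg_mul_Ioi ha (by linarith), mul_comm, mul_assoc,
    mul_inv_cancel₀ hG.ne', mul_one, one_div, Real.inv_rpow (by linarith),
    Real.rpow_neg (by linarith)]

lemma charFun_besselMeasure (hα : 0 < α) (ξ : E d) :
    charFun (besselMeasure d α) ξ = (((1 + ‖ξ‖ ^ 2) ^ (-α / 2) : ℝ) : ℂ) := by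
  have := isProbabilityMeasure_gammaMeasure (half_pos hα) one_pos
  have hcont : Continuous fun v : E d ↦ Complex.exp (inner ℝ v ξ * Complex.I) := by fun_prop
  have hmeas : Measurable fun z : ℝ × E d ↦ √(2 * z.1) • z.2 := by fun_prop
  have hint : Integrable (fun z : ℝ × E d ↦ Complex.exp (inner ℝ (√(2 * z.1) • z.2) ξ * Complex.I))
      ((gammaMeasure (α / 2) 1).prod (stdGaussian (E d))) :=
    .of_bound (hcont.measurable.comp hmeas).aestronglyMeasurable 1
      (ae_of_all _ fun z ↦ (Complex.norm_exp_ofReal_mul_I _).le)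
  have gaussian : ∀ᵐ t ∂(gammaMeasure (α / 2) 1),
      ∫ z, Complex.exp (inner ℝ (√(2 * t) • z) ξ * Complex.I) ∂(stdGaussian (E d)) =
        ((Real.exp (-(t * ‖ξ‖ ^ 2)) : ℝ) : ℂ) := by
    filter_upwards [ae_gammaMeasure_pos (α / 2)] with t ht
    have h := charFun_stdGaussian (E := E d) (√(2 * t) • ξ)
    simp only [charFun_apply, inner_smul_left, inner_smul_right, conj_trivial] at h ⊢
    rw [h, norm_smul, Real.norm_of_nonneg (Real.sqrt_nonneg _), ← Complex.ofReal_pow, mul_pow,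
      Real.sq_sqrt (by positivity)]
    push_cast
    ring_nf
  rw [charFun_apply, besselMeasure, integral_map hmeas.aemeasurable hcont.aestronglyMeasurable,
    integral_prod _ hint, integral_congr_ae gaussian, integral_complex_ofReal,
    integral_exp_neg_mul_gammaMeasure (half_pos hα) (by positivity), neg_div]

lemma stdGaussian_preimage_smul_le {s : ℝ} (hs : 0 < s) {A : Set (E d)} :
    stdGaussian (E d) ((fun z ↦ s • z) ⁻¹' A) ≤ ENNReal.ofReal (s ^ (-(d : ℝ))) * volume A := by
  refine (stdGaussian_le_volume d _).trans_eq ?_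
  rw [Measure.addHaar_preimage_smul _ hs.ne', finrank_euclideanSpace, Fintype.card_fin,
    abs_of_pos (by positivity), Real.rpow_neg hs.le, Real.rpow_natCast]

lemma besselMeasure_apply_le (hα : 0 < α) {A : Set (E d)} (hA : MeasurableSet A) :
    besselMeasure d α A ≤ ∫⁻ t in Ioi (0 : ℝ), gammaPDF (α / 2) 1 t *
      min 1 (ENNReal.ofReal (t ^ (-((d : ℝ) / 2))) * volume A) := by
  have := isProbabilityMeasure_gammaMeasure (half_pos hα) one_pos
  have hmeas : Measurable fun z : ℝ × E d ↦ √(2 * z.1) • z.2 := by fun_prop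
  have slice_le : ∀ᵐ t ∂(gammaMeasure (α / 2) 1),
      stdGaussian (E d) ((fun z ↦ √(2 * t) • z) ⁻¹' A) ≤
        min 1 (ENNReal.ofReal (t ^ (-((d : ℝ) / 2))) * volume A) := by
    filter_upwards [ae_gammaMeasure_pos (α / 2)] with t ht
    refine le_min prob_le_one ((stdGaussian_preimage_smul_le (by positivity)).trans ?_)
    gcongr ENNReal.ofReal ?_ * _
    rw [Real.sqrt_eq_rpow, ← Real.rpow_mul (by positivity), one_div_mul_eq_div, neg_div]
    exact Real.rpow_le_rpow_of_nonpos ht (by linarith) (neg_nonpos.2 (by positivity))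
  rw [besselMeasure, Measure.map_apply hmeas hA, Measure.prod_apply (hmeas hA)]
  refine (lintegral_mono_ae slice_le).trans_eq ?_
  rw [← Measure.restrict_eq_self_of_ae_mem (s := Ioi 0) (ae_gammaMeasure_pos (α / 2)),
    gammaMeasure, restrict_withDensity measurableSet_Ioi,
    lintegral_withDensity_eq_lintegral_mul _ (measurable_gammaPDF _ _) (by fun_prop)]
  rfl

lemma rpow_mul_exp_neg_le {δ t : ℝ} (hδ : 0 ≤ δ) (ht : 0 ≤ t) :
    t ^ δ * Real.exp (-t) ≤ δ ^ δ := by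
  obtain rfl | hδ := hδ.eq_or_lt
  · simpa using ht
  have hexp : (t / δ) ^ δ ≤ Real.exp t := by
    calc (t / δ) ^ δ ≤ Real.exp (t / δ) ^ δ := by
          gcongr
          linarith [Real.add_one_le_exp (t / δ)]
      _ = Real.exp t := by rw [← Real.exp_mul, div_mul_cancel₀ _ hδ.ne']
  rwa [Real.div_rpow ht hδ.le, div_le_iff₀ (by positivity), mul_comm, ← div_le_iff₀
    (Real.exp_pos t), div_eq_mul_inv, ← Real.exp_neg] at hexp

lemma gammaPDF_le {a b t : ℝ} (ha : 0 < a) (hba : b ≤ a) (ht : 0 < t) :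
    gammaPDF a 1 t ≤ ENNReal.ofReal ((a - b) ^ (a - b) / Real.Gamma a) *
      ENNReal.ofReal (t ^ (b - 1)) := by
  have := Real.Gamma_pos_of_pos ha
  have hba := sub_nonneg.2 hba
  rw [gammaPDF_of_nonneg ht.le, ← ENNReal.ofReal_mul (by positivity)]
  refine ENNReal.ofReal_le_ofReal ?_
  calc 1 ^ a / Real.Gamma a * t ^ (a - 1) * Real.exp (-(1 * t))
      = t ^ (a - b) * Real.exp (-t) / Real.Gamma a * t ^ (b - 1) := by
        rw [Real.one_rpow, one_mul, show a - 1 = a - b + (b - 1) by ring, Real.rpow_add ht]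
        ring
    _ ≤ (a - b) ^ (a - b) / Real.Gamma a * t ^ (b - 1) := by
        gcongr
        exact rpow_mul_exp_neg_le hba ht.le

lemma lintegral_rpow_sub_one_mul_min_rpow_neg_mul_eq {b c v : ℝ} (hc : 0 < c) (hv : 0 < v) :
    ∫⁻ t in Ioi (0 : ℝ), ENNReal.ofReal (t ^ (b - 1) * min 1 (t ^ (-c) * v)) =
      ENNReal.ofReal (v ^ (b / c)) *
        ∫⁻ t in Ioi (0 : ℝ), ENNReal.ofReal (t ^ (b - 1) * min 1 (t ^ (-c))) := by
  set r := v ^ (1 / c) with hr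
  have hr₀ : 0 < r := by positivity
  have hrc : r ^ (-c) * v = 1 := by
    rw [hr, ← Real.rpow_mul hv.le, show 1 / c * -c = -1 by field_simp, Real.rpow_neg_one,
      inv_mul_cancel₀ hv.ne']
  have hrb : r ^ b = v ^ (b / c) := by rw [hr, ← Real.rpow_mul hv.le, one_div_mul_eq_div]
  rw [lintegral_Ioi_comp_mul _ hr₀, ← lintegral_const_mul' _ _ ENNReal.ofReal_ne_top,
    ← lintegral_const_mul' _ _ ENNReal.ofReal_ne_top]
  refine setLIntegral_congr_fun measurableSet_Ioi fun s (hs : 0 < s) ↦ ?_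
  rw [← ENNReal.ofReal_mul hr₀.le, ← ENNReal.ofReal_mul (by positivity),
    Real.mul_rpow hr₀.le hs.le, Real.mul_rpow hr₀.le hs.le, mul_right_comm (r ^ (-c)), hrc,
    one_mul, ← hrb, Real.rpow_sub_one hr₀.ne']
  field_simp

theorem exists_besselMeasure_le_mul_rpow {κ : ℝ} (hd : 0 < d) (hα : 0 < α) (hκ₀ : 0 ≤ κ)
    (hκ₁ : κ < 1) (hκ : κ ≤ α / d) :
    ∃ C : ℝ≥0, ∀ A : Set (E d), MeasurableSet A → besselMeasure d α A ≤ C * volume A ^ κ := by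
  have hprob := isProbabilityMeasure_besselMeasure (d := d) hα
  have hd₀ : (0 : ℝ) < d := Nat.cast_pos.2 hd
  obtain rfl | hκ₀ := hκ₀.eq_or_lt
  · exact ⟨1, fun A _ ↦ by simpa using prob_le_one⟩
  have hb : κ * (d / 2) ≤ α / 2 := by
    rw [le_div_iff₀ hd₀] at hκ
    linarith
  set b := κ * ((d : ℝ) / 2) with hb_def
  set J := ∫⁻ t in Ioi (0 : ℝ), ENNReal.ofReal (t ^ (b - 1) * min 1 (t ^ (-((d : ℝ) / 2))))
  have hJ : J ≠ ∞ := (lintegral_rpow_sub_one_mul_min_rpow_neg_lt_top (by positivity)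
    (mul_lt_of_lt_one_left (by positivity) hκ₁)).ne
  set M := (α / 2 - b) ^ (α / 2 - b) / Real.Gamma (α / 2)
  refine ⟨1 + M.toNNReal * J.toNNReal, fun A hA ↦ ?_⟩
  obtain hA_top | hA_top := eq_or_ne (volume A) ∞
  · simp [hA_top, ENNReal.top_rpow_of_pos hκ₀]
  refine (besselMeasure_apply_le hα hA).trans ?_
  obtain hA₀ | hA₀ := eq_or_ne (volume A) 0
  · simp [hA₀]
  obtain ⟨v, hv, hAv⟩ : ∃ v : ℝ, 0 < v ∧ volume A = ENNReal.ofReal v :=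
    ⟨_, ENNReal.toReal_pos hA₀ hA_top, (ENNReal.ofReal_toReal hA_top).symm⟩
  calc ∫⁻ t in Ioi (0 : ℝ), gammaPDF (α / 2) 1 t *
        min 1 (ENNReal.ofReal (t ^ (-((d : ℝ) / 2))) * volume A)
      ≤ ∫⁻ t in Ioi (0 : ℝ), ENNReal.ofReal M *
          ENNReal.ofReal (t ^ (b - 1) * min 1 (t ^ (-((d : ℝ) / 2)) * v)) := by
        refine setLIntegral_mono' measurableSet_Ioi fun t (ht : 0 < t) ↦ ?_
        rw [ENNReal.ofReal_mul (by positivity), ENNReal.ofReal_min, ENNReal.ofReal_one,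
          ENNReal.ofReal_mul (by positivity), hAv, ← mul_assoc]
        gcongr
        exact gammaPDF_le (half_pos hα) hb ht
    _ = ENNReal.ofReal M * J * volume A ^ κ := by
        rw [lintegral_const_mul' _ _ ENNReal.ofReal_ne_top,
          lintegral_rpow_sub_one_mul_min_rpow_neg_mul_eq (by positivity) hv, hb_def,
          mul_div_cancel_right₀ _ (by positivity), hAv, ENNReal.ofReal_rpow_of_pos hv]
        ring
    _ ≤ (1 + M.toNNReal * J.toNNReal : ℝ≥0) * volume A ^ κ := by
        rw [ENNReal.coe_add, ENNReal.coe_mul, ENNReal.coe_toNNReal hJ]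
        gcongr
        exact le_add_self

end Bessel

/-! ### Bessel potentials of Schwartz functions -/

section Schwartz

open FourierTransform

variable {d : ℕ}

/-- The symbol `(1 + |2 π ξ|²)^{α/2}` of `S_α`. -/
noncomputable def besselSymbol (d : ℕ) (α : ℝ) (ξ : E d) : ℂ :=
  (((1 + ‖(2 * Real.pi) • ξ‖ ^ 2) ^ (α / 2) : ℝ) : ℂ)

lemma besselSymbol_hasTemperateGrowth (α : ℝ) : (besselSymbol d α).HasTemperateGrowth :=
  S_symbol_hasTemperateGrowth α

/-- The operator `S_α` on Schwartz functions, which is the transpose of `S_α` on tempered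
distributions. -/
noncomputable def schwartzS (α : ℝ) (φ : 𝓢(E d, ℂ)) : 𝓢(E d, ℂ) :=
  𝓕 (SchwartzMap.smulLeftCLM ℂ (besselSymbol d α) (𝓕⁻ φ))

lemma S_apply_schwartz (α : ℝ) (T : 𝓢'(E d, ℂ)) (φ : 𝓢(E d, ℂ)) : S α T φ = T (schwartzS α φ) :=
  rfl

lemma schwartzS_schwartzS (α β : ℝ) (φ : 𝓢(E d, ℂ)) :
    schwartzS α (schwartzS β φ) = schwartzS (α + β) φ := by
  have hmul : besselSymbol d α * besselSymbol d β = besselSymbol d (α + β) := by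
    ext ξ
    simp only [Pi.mul_apply, besselSymbol]
    rw [← Complex.ofReal_mul, ← Real.rpow_add (by positivity), add_div]
  rw [schwartzS, schwartzS, fourierInv_fourier_eq, SchwartzMap.smulLeftCLM_smulLeftCLM_apply
    (besselSymbol_hasTemperateGrowth _) (besselSymbol_hasTemperateGrowth _), hmul, schwartzS]

lemma schwartzS_zero (φ : 𝓢(E d, ℂ)) : schwartzS 0 φ = φ := by
  have hone : besselSymbol d 0 = fun _ ↦ 1 := by
    ext ξ
    simp [besselSymbol]
  rw [schwartzS, hone, SchwartzMap.smulLeftCLM_const]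
  simp

lemma S_S (α β : ℝ) (T : 𝓢'(E d, ℂ)) : S α (S β T) = S (α + β) T := by
  ext φ
  rw [S_apply_schwartz, S_apply_schwartz, S_apply_schwartz, schwartzS_schwartzS, add_comm]

lemma S_neg_S (α : ℝ) (T : 𝓢'(E d, ℂ)) : S (-α) (S α T) = T := by
  ext φ
  rw [S_S, neg_add_cancel, S_apply_schwartz, schwartzS_zero]

lemma S_S_neg (α : ℝ) (T : 𝓢'(E d, ℂ)) : S α (S (-α) T) = T := by
  simpa using S_neg_S (-α) T

lemma fourier_smulLeft_fourierInv_apply {ν : Measure (E d)} [IsFiniteMeasure ν] {g : E d → ℂ}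
    (hg : g.HasTemperateGrowth) (hν : ∀ ξ, charFun ν ((2 * Real.pi) • ξ) = g ξ)
    (φ : 𝓢(E d, ℂ)) (x : E d) :
    (𝓕 (SchwartzMap.smulLeftCLM ℂ g (𝓕⁻ φ)) : 𝓢(E d, ℂ)) x = ∫ y, φ (x - y) ∂ν := by
  obtain ⟨ψ, rfl⟩ : ∃ ψ : 𝓢(E d, ℂ), 𝓕 ψ = φ := ⟨𝓕⁻ φ, fourier_fourierInv_eq φ⟩
  have hint : Integrable (fun z : E d × E d ↦
      Complex.exp (↑(-2 * Real.pi * inner ℝ z.2 (x - z.1)) * Complex.I) • ψ z.2)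
      (ν.prod volume) := by
    refine (ψ.integrable.comp_snd ν).bdd_mul (c := 1) (Continuous.aestronglyMeasurable
      (by fun_prop)) (ae_of_all _ fun z ↦ (Complex.norm_exp_ofReal_mul_I _).le)
  simp_rw [fourierInv_fourier_eq, SchwartzMap.fourier_coe, Real.fourier_eq']
  rw [integral_integral_swap hint]
  refine integral_congr_ae (ae_of_all _ fun ξ ↦ ?_)
  dsimp only
  rw [SchwartzMap.smulLeftCLM_apply_apply hg, integral_smul_const, ← hν, charFun_apply,
    ← smul_assoc, ← integral_smul]
  congr 2 with y
  rw [smul_eq_mul, ← Complex.exp_add, inner_sub_right, inner_smul_right, real_inner_comm y ξ]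
  push_cast
  ring_nf

lemma schwartzS_neg_apply {α : ℝ} (hα : 0 < α) (φ : 𝓢(E d, ℂ)) (x : E d) :
    schwartzS (-α) φ x = ∫ y, φ (x - y) ∂(besselMeasure d α) := by
  have := isProbabilityMeasure_besselMeasure (d := d) hα
  exact fourier_smulLeft_fourierInv_apply (besselSymbol_hasTemperateGrowth _)
    (fun ξ ↦ charFun_besselMeasure hα _) φ x

lemma isNegInvariant_besselMeasure {α : ℝ} (hα : 0 < α) : (besselMeasure d α).IsNegInvariant := by
  have := isProbabilityMeasure_besselMeasure (d := d) hα
  have := Measure.isFiniteMeasure_map (besselMeasure d α) fun y : E d ↦ (-1 : ℝ) • y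
  refine ⟨?_⟩
  have hneg : (besselMeasure d α).map (fun y ↦ (-1 : ℝ) • y) = besselMeasure d α :=
    Measure.ext_of_charFun <| funext fun ξ ↦ by
      rw [charFun_map_smul, charFun_besselMeasure hα, charFun_besselMeasure hα, norm_smul]
      simp
  simp only [neg_one_smul] at hneg
  exact hneg

lemma schwartzS_comm_of_neg {β : ℝ} {R : 𝓢(E d, ℂ) → 𝓢(E d, ℂ)}
    (hR : ∀ φ, schwartzS (-β) (R φ) = R (schwartzS (-β) φ)) (φ : 𝓢(E d, ℂ)) :
    schwartzS β (R φ) = R (schwartzS β φ) := by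
  have h := hR (schwartzS β φ)
  rw [schwartzS_schwartzS, neg_add_cancel, schwartzS_zero] at h
  rw [← h, schwartzS_schwartzS, add_neg_cancel, schwartzS_zero]

/-- The Schwartz function `x ↦ φ (w - x)`. -/
noncomputable def reflect (w : E d) (φ : 𝓢(E d, ℂ)) : 𝓢(E d, ℂ) :=
  SchwartzMap.compSubConstCLM ℂ w (SchwartzMap.compCLMOfContinuousLinearEquiv ℂ
    (ContinuousLinearEquiv.neg ℝ) φ)

lemma reflect_apply (w : E d) (φ : 𝓢(E d, ℂ)) (x : E d) : reflect w φ x = φ (w - x) := by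
  simp [reflect]

/-- The complex conjugate of a Schwartz function. -/
noncomputable def schwartzConj (φ : 𝓢(E d, ℂ)) : 𝓢(E d, ℂ) :=
  SchwartzMap.postcompCLM (𝕜 := ℝ) Complex.conjCLE.toContinuousLinearMap φ

lemma schwartzConj_apply (φ : 𝓢(E d, ℂ)) (x : E d) : schwartzConj φ x = conj (φ x) := rfl

lemma schwartzS_reflect {β : ℝ} (hβ : 0 < β) (w : E d) (φ : 𝓢(E d, ℂ)) :
    schwartzS β (reflect w φ) = reflect w (schwartzS β φ) := by
  have := isNegInvariant_besselMeasure (d := d) hβ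
  refine schwartzS_comm_of_neg (fun φ ↦ ?_) φ
  ext x
  simp_rw [reflect_apply, schwartzS_neg_apply hβ, reflect_apply]
  rw [← integral_neg_eq_self]
  simp only [sub_neg_eq_add, sub_sub]

lemma schwartzS_conj {β : ℝ} (hβ : 0 < β) (φ : 𝓢(E d, ℂ)) :
    schwartzS β (schwartzConj φ) = schwartzConj (schwartzS β φ) := by
  refine schwartzS_comm_of_neg (fun φ ↦ ?_) φ
  ext x
  simp_rw [schwartzConj_apply, schwartzS_neg_apply hβ, schwartzConj_apply, integral_conj]

end Schwartz

/-! ### Functions as tempered distributions -/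

section Distributions

variable {d : ℕ} {T U : 𝓢'(E d, ℂ)} {f g : E d → ℂ}

lemma IsFun.locallyIntegrable (hf : IsFun T f) : LocallyIntegrable f := by
  intro x
  let b : ContDiffBump (0 : E d) := ⟨‖x‖ + 1, ‖x‖ + 2, by positivity, by linarith⟩
  have hb : ContDiff ℝ (⊤ : ℕ∞) fun y ↦ ((b y : ℝ) : ℂ) :=
    Complex.ofRealCLM.contDiff.comp b.contDiff
  have hbc : HasCompactSupport fun y ↦ ((b y : ℝ) : ℂ) :=
    b.hasCompactSupport.comp_left Complex.ofReal_zero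
  refine ⟨Metric.ball 0 (‖x‖ + 1), Metric.isOpen_ball.mem_nhds (by simp), ?_⟩
  refine (hf.2 (hbc.toSchwartzMap hb)).1.integrableOn.congr_fun (fun y hy ↦ ?_) measurableSet_ball
  have hby : b y = 1 := b.one_of_mem_closedBall (Metric.ball_subset_closedBall hy)
  change ((b y : ℝ) : ℂ) * f y = f y
  rw [hby, Complex.ofReal_one, one_mul]

lemma IsFun.ae_eq (hf : IsFun T f) (hg : IsFun T g) : f =ᵐ[volume] g := by
  refine ae_eq_of_integral_contDiff_smul_eq hf.locallyIntegrable hg.locallyIntegrable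
    fun b hb hbc ↦ ?_
  have hb' : ContDiff ℝ (⊤ : ℕ∞) fun y ↦ ((b y : ℝ) : ℂ) := Complex.ofRealCLM.contDiff.comp hb
  have hbc' : HasCompactSupport fun y ↦ ((b y : ℝ) : ℂ) := hbc.comp_left Complex.ofReal_zero
  exact (hf.2 (hbc'.toSchwartzMap hb')).2.symm.trans (hg.2 (hbc'.toSchwartzMap hb')).2

lemma IsFun.congr (hf : IsFun T f) (h : f =ᵐ[volume] g) : IsFun T g := by
  refine ⟨hf.1.congr h, fun φ ↦ ?_⟩
  have hφ : (fun x ↦ φ x * f x) =ᵐ[volume] fun x ↦ φ x * g x := by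
    filter_upwards [h] with x hx
    rw [hx]
  exact ⟨(hf.2 φ).1.congr hφ, (hf.2 φ).2.trans (integral_congr_ae hφ)⟩

lemma IsFun.dist_ext (hT : IsFun T f) (hU : IsFun U f) : T = U := by
  ext φ
  rw [(hT.2 φ).2, (hU.2 φ).2]

lemma IsFun.mulMu (hT : IsFun T f) (N : ℝ) {γ : ℝ} (hγ : 0 < γ) :
    IsFun (mulMu N γ T) fun x ↦ (mu N γ x : ℂ) * f x := by
  have hμ := mu_hasTemperateGrowth (d := d) N hγ
  refine ⟨hμ.1.continuous.aestronglyMeasurable.mul hT.1, fun φ ↦ ?_⟩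
  have h := hT.2 (SchwartzMap.smulLeftCLM ℂ (fun x : E d ↦ (mu N γ x : ℂ)) φ)
  simp only [SchwartzMap.smulLeftCLM_apply_apply hμ, smul_eq_mul, mul_right_comm _ (φ _)] at h
  simp only [mul_comm (φ _)]
  exact h

lemma IsFun.integral_schwartzS_mul {β : ℝ} (hf : IsFun T f) (hg : IsFun (S β T) g)
    (φ : 𝓢(E d, ℂ)) : ∫ x, schwartzS β φ x * f x = ∫ x, φ x * g x := by
  rw [← (hf.2 _).2, ← S_apply_schwartz, (hg.2 φ).2]

lemma IsFun.integral_schwartzS_mul_conj {β : ℝ} (hβ : 0 < β) (hf : IsFun T f)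
    (hg : IsFun (S β T) g) (φ : 𝓢(E d, ℂ)) :
    ∫ x, schwartzS β φ x * conj (f x) = ∫ x, φ x * conj (g x) := by
  have h := congrArg conj (hf.integral_schwartzS_mul hg (schwartzConj φ))
  rw [← integral_conj, ← integral_conj] at h
  simpa [schwartzS_conj hβ, schwartzConj_apply] using h

/-- `f ∈ L¹ + L^∞`, expressed by duality: `|f|` pairs boundedly with `L¹ ∩ L^∞`. -/
def MemLOneAddLTop (f : E d → ℂ) : Prop :=
  AEStronglyMeasurable f volume ∧ ∃ C : ℝ≥0, ∀ φ : E d → ℝ≥0∞, AEMeasurable φ →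
    ∀ M, (∀ x, φ x ≤ M) → ∫⁻ x, ‖f x‖ₑ * φ x ≤ C * (M + ∫⁻ x, φ x)

lemma memLOneAddLTop_of_lorentzTwoNorm {a : ℝ} (ha : 0 < a) (ha₁ : a < 1)
    (hf : AEStronglyMeasurable f volume) (hfin : lorentzTwoNorm volume a (‖f ·‖ₑ) < ∞) :
    MemLOneAddLTop f := by
  set K := ENNReal.ofReal (2 * a) ^ (1 / 2 : ℝ) * lorentzTwoNorm volume a (‖f ·‖ₑ)
  have hK : K ≠ ∞ := ENNReal.mul_ne_top (by finiteness) hfin.ne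
  refine ⟨hf, (2 * K * (ENNReal.ofReal (1 / (1 - a)) + ENNReal.ofReal (1 / a))).toNNReal,
    fun φ hφ M hM ↦ ?_⟩
  rw [ENNReal.coe_toNNReal (by finiteness)]
  refine ((hasWeakBound_lorentzTwoNorm ha _).lintegral_mul_le ha ha₁ hf.enorm hφ hM).trans ?_
  rw [mul_assoc _ _ (M + _), mul_add (_ + _)]
  gcongr
  · exact le_self_add
  · exact le_add_self

lemma enorm_schwartz_le (φ : 𝓢(E d, ℂ)) (x : E d) :
    ‖φ x‖ₑ ≤ ENNReal.ofReal (SchwartzMap.seminorm ℂ 0 0 φ) := by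
  rw [← ofReal_norm]
  exact ENNReal.ofReal_le_ofReal (φ.norm_le_seminorm ℂ x)

lemma MemLOneAddLTop.integrable (hf : MemLOneAddLTop f) (φ : 𝓢(E d, ℂ)) :
    Integrable fun x ↦ φ x * f x := by
  obtain ⟨hfm, C, hC⟩ := hf
  refine ⟨φ.continuous.aestronglyMeasurable.mul hfm, ?_⟩
  rw [HasFiniteIntegral]
  simp_rw [enorm_mul, mul_comm ‖φ _‖ₑ]
  refine (hC _ φ.continuous.enorm.aemeasurable _ (enorm_schwartz_le φ)).trans_lt ?_
  exact ENNReal.mul_lt_top (by simp) (ENNReal.add_lt_top.2 ⟨by simp, φ.integrable.2⟩)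

lemma MemLOneAddLTop.exists_norm_integral_mul_le (hf : MemLOneAddLTop f) :
    ∃ (s : Finset (ℕ × ℕ)) (c : ℝ), 0 ≤ c ∧ ∀ φ : 𝓢(E d, ℂ),
      ‖∫ x, φ x * f x‖ ≤ c * s.sup (schwartzSeminormFamily ℂ (E d) ℂ) φ := by
  obtain ⟨-, C, hC⟩ := hf
  obtain ⟨k, D, hD⟩ := SchwartzMap.eLpNorm_le_seminorm (E := E d) ℂ ℂ 1
  refine ⟨Finset.Iic (k, 0), C * (1 + D), by positivity, fun φ ↦ ?_⟩
  set s := (Finset.Iic (k, 0)).sup (schwartzSeminormFamily ℂ (E d) ℂ) φ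
  have : 0 ≤ s := apply_nonneg _ _
  have hsup : SchwartzMap.seminorm ℂ 0 0 φ ≤ s :=
    (Finset.le_sup (f := schwartzSeminormFamily ℂ (E d) ℂ) (b := (0, 0))
      (by simp [Prod.le_def]) : _ ≤ (Finset.Iic (k, 0)).sup _) φ
  rw [← ENNReal.ofReal_le_ofReal_iff (by positivity), ofReal_norm]
  calc ‖∫ x, φ x * f x‖ₑ ≤ ∫⁻ x, ‖φ x * f x‖ₑ := enorm_integral_le_lintegral_enorm _
    _ = ∫⁻ x, ‖f x‖ₑ * ‖φ x‖ₑ := by simp_rw [enorm_mul, mul_comm ‖φ _‖ₑ]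
    _ ≤ C * (ENNReal.ofReal s + ∫⁻ x, ‖φ x‖ₑ) :=
      hC _ φ.continuous.enorm.aemeasurable _ fun x ↦
        (enorm_schwartz_le φ x).trans (ENNReal.ofReal_le_ofReal hsup)
    _ ≤ C * (ENNReal.ofReal s + D * ENNReal.ofReal s) := by
      gcongr
      rw [← eLpNorm_one_eq_lintegral_enorm]
      exact hD φ
    _ = ENNReal.ofReal (C * (1 + D) * s) := by
      rw [ENNReal.ofReal_mul (by positivity), ENNReal.ofReal_mul (by positivity),
        ENNReal.ofReal_add zero_le_one (by positivity), ENNReal.ofReal_coe_nnreal,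
        ENNReal.ofReal_coe_nnreal, ENNReal.ofReal_one]
      ring

lemma MemLOneAddLTop.exists_isFun (hf : MemLOneAddLTop f) : ∃ T : 𝓢'(E d, ℂ), IsFun T f := by
  refine ⟨ContinuousLinearMap.toPointwiseConvergenceCLM _ _ _ _
    (SchwartzMap.mkCLMtoNormedSpace (𝕜 := ℂ) (𝕜' := ℂ) (σ := RingHom.id ℂ)
      (fun φ : 𝓢(E d, ℂ) ↦ ∫ x, φ x * f x) (fun φ ψ ↦ ?_) (fun c φ ↦ ?_)
      hf.exists_norm_integral_mul_le), hf.1, fun φ ↦ ⟨hf.integrable φ, rfl⟩⟩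
  · rw [← integral_add (hf.integrable φ) (hf.integrable ψ)]
    simp only [add_apply, add_mul]
  · simp only [smul_apply, smul_eq_mul, mul_assoc, RingHom.id_apply]
    exact integral_const_mul _ _

lemma quasiMeasurePreserving_add (ν : Measure (E d)) [SFinite ν] :
    Measure.QuasiMeasurePreserving (fun z : E d × E d ↦ z.1 + z.2) (ν.prod volume) volume :=
  Measure.quasiMeasurePreserving_snd.comp
    (measurePreserving_prod_add ν (volume : Measure (E d))).quasiMeasurePreserving

lemma MemLOneAddLTop.integrable_comp_sub_mul (hf : MemLOneAddLTop f) (ν : Measure (E d))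
    [IsFiniteMeasure ν] (φ : 𝓢(E d, ℂ)) :
    Integrable (fun z : E d × E d ↦ φ (z.2 - z.1) * f z.2) (ν.prod volume) := by
  obtain ⟨hfm, C, hC⟩ := hf
  set B := ENNReal.ofReal (SchwartzMap.seminorm ℂ 0 0 φ)
  have hφ : Continuous fun z : E d × E d ↦ φ (z.2 - z.1) := φ.continuous.comp (by fun_prop)
  have hm : AEStronglyMeasurable (fun z : E d × E d ↦ φ (z.2 - z.1) * f z.2) (ν.prod volume) :=
    hφ.aestronglyMeasurable.mul hfm.comp_snd
  have hbound (x : E d) : ∫⁻ y, ‖φ (x - y)‖ₑ ∂ν ≤ B * ν univ := by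
    rw [← lintegral_const]
    exact lintegral_mono fun y ↦ enorm_schwartz_le φ _
  have hintegral : ∫⁻ x, ∫⁻ y, ‖φ (x - y)‖ₑ ∂ν = (∫⁻ x, ‖φ x‖ₑ) * ν univ := by
    rw [lintegral_lintegral_swap (φ.continuous.comp continuous_sub).enorm.aemeasurable,
      ← lintegral_const]
    exact lintegral_congr fun y ↦ lintegral_sub_right_eq_self (‖φ ·‖ₑ) y
  refine ⟨hm, ?_⟩
  calc ∫⁻ z, ‖φ (z.2 - z.1) * f z.2‖ₑ ∂(ν.prod volume)
      = ∫⁻ x, ‖f x‖ₑ * ∫⁻ y, ‖φ (x - y)‖ₑ ∂ν := by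
        rw [lintegral_prod_symm _ hm.enorm]
        refine lintegral_congr fun x ↦ ?_
        simp_rw [enorm_mul, mul_comm _ ‖f x‖ₑ]
        exact lintegral_const_mul' _ _ enorm_ne_top
    _ ≤ C * (B * ν univ + ∫⁻ x, ∫⁻ y, ‖φ (x - y)‖ₑ ∂ν) :=
        hC _ hφ.enorm.measurable.lintegral_prod_left'.aemeasurable _ hbound
    _ < ∞ := by
        rw [hintegral]
        have := φ.integrable (μ := volume).2.ne
        finiteness

lemma integral_prod_comp_add (ν : Measure (E d)) [SFinite ν] (Φ : E d × E d → ℂ) :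
    ∫ z, Φ (z.1, z.1 + z.2) ∂(ν.prod volume) = ∫ z, Φ z ∂(ν.prod volume) :=
  (measurePreserving_prod_add ν (volume : Measure (E d))).integral_comp
    (MeasurableEquiv.shearAddRight (E d)).measurableEmbedding Φ

/-- The Bessel potential `(1 - Δ)^{-α/2} f` of a function, for `α > 0`: the convolution of `f`
with the Bessel kernel. The kernel is even, so it may be written with `f (y + x)`. -/
noncomputable def besselPotential (α : ℝ) (f : E d → ℂ) (x : E d) : ℂ :=
  ∫ y, f (y + x) ∂besselMeasure d α

lemma MemLOneAddLTop.isFun_S_neg (hf : MemLOneAddLTop f) {α : ℝ} (hα : 0 < α) (hT : IsFun T f) :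
    IsFun (S (-α) T) (besselPotential α f) := by
  have := isProbabilityMeasure_besselMeasure (d := d) hα
  set ν := besselMeasure d α
  refine ⟨((hf.1.comp_quasiMeasurePreserving
    (quasiMeasurePreserving_add ν)).prod_swap).integral_prod_right', fun φ ↦ ?_⟩
  have hint := hf.integrable_comp_sub_mul ν φ
  have hint_add : Integrable (fun z : E d × E d ↦ φ z.2 * f (z.1 + z.2)) (ν.prod volume) := by
    simpa [Function.comp_def] using
      (measurePreserving_prod_add ν (volume : Measure (E d))).integrable_comp_of_integrable hint
  constructor
  · simpa [besselPotential, integral_const_mul] using hint_add.swap.integral_prod_left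
  · calc S (-α) T φ = ∫ x, (∫ y, φ (x - y) ∂ν) * f x := by
          simp_rw [S_apply_schwartz, (hT.2 _).2, schwartzS_neg_apply hα, ν]
      _ = ∫ x, ∫ y, φ (x - y) * f x ∂ν := by simp_rw [integral_mul_const]
      _ = ∫ z, φ (z.2 - z.1) * f z.2 ∂(ν.prod volume) := (integral_prod_symm _ hint).symm
      _ = ∫ z, φ z.2 * f (z.1 + z.2) ∂(ν.prod volume) := by
          simpa using (integral_prod_comp_add ν fun z ↦ φ (z.2 - z.1) * f z.2).symm
      _ = ∫ x, ∫ y, φ x * f (y + x) ∂ν := integral_prod_symm _ hint_add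
      _ = ∫ x, φ x * ∫ y, f (y + x) ∂ν := by simp_rw [integral_const_mul]

end Distributions

/-! ### The duality of `B` and `B^*` -/

section LTwo

variable {α : Type*} [MeasurableSpace α] {μ : Measure α} {F G : α → ℂ}

lemma eLpNorm_two_sq (F : α → ℂ) : eLpNorm F 2 μ ^ 2 = ∫⁻ x, ‖F x‖ₑ ^ 2 ∂μ := by
  rw [eLpNorm_eq_lintegral_rpow_enorm_toReal two_ne_zero ENNReal.ofNat_ne_top,
    ← ENNReal.rpow_natCast, ← ENNReal.rpow_mul]
  simp

lemma lintegral_mul_le_eLpNorm_two (hF : AEStronglyMeasurable F μ)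
    (hG : AEStronglyMeasurable G μ) :
    ∫⁻ x, ‖F x‖ₑ * ‖G x‖ₑ ∂μ ≤ eLpNorm F 2 μ * eLpNorm G 2 μ := by
  have h := ENNReal.lintegral_mul_le_Lp_mul_Lq μ Real.HolderConjugate.two_two hF.enorm hG.enorm
  simpa [eLpNorm_eq_lintegral_rpow_enorm_toReal two_ne_zero ENNReal.ofNat_ne_top] using h

lemma tendsto_eLpNorm_two_indicator (hF : MemLp F 2 μ) {s : ℕ → Set α}
    (hs : ∀ n, NullMeasurableSet (s n) μ) (hlim : ∀ x, ∀ᶠ n in Filter.atTop, x ∉ s n) :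
    Filter.Tendsto (fun n ↦ eLpNorm ((s n).indicator F) 2 μ) Filter.atTop (nhds 0) := by
  have hfin : ∫⁻ x, ‖F x‖ₑ ^ 2 ∂μ ≠ ∞ := by
    rw [← eLpNorm_two_sq]
    exact ENNReal.pow_ne_top hF.2.ne
  have hsq : Filter.Tendsto (fun n ↦ eLpNorm ((s n).indicator F) 2 μ ^ 2) Filter.atTop
      (nhds 0) := by
    simp_rw [eLpNorm_two_sq]
    rw [← lintegral_zero (μ := μ)]
    refine tendsto_lintegral_of_dominated_convergence' (fun x ↦ ‖F x‖ₑ ^ 2)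
      (fun n ↦ (hF.1.indicator₀ (hs n)).enorm.pow_const 2)
      (fun n ↦ ae_of_all _ fun x ↦ pow_le_pow_left' (enorm_indicator_le_enorm_self _ _) 2) hfin
      (ae_of_all _ fun x ↦ tendsto_const_nhds.congr' ?_)
    filter_upwards [hlim x] with n hn
    simp [indicator_of_notMem hn]
  have hroot := (ENNReal.continuous_rpow_const (y := (1 / 2 : ℝ))).tendsto 0 |>.comp hsq
  rw [ENNReal.zero_rpow_of_pos (by norm_num)] at hroot
  refine hroot.congr fun n ↦ ?_
  rw [Function.comp_apply, ← ENNReal.rpow_natCast, ← ENNReal.rpow_mul]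
  simp

end LTwo

section Shells

variable {d : ℕ} {F G : E d → ℂ}

lemma iUnion_shell : ⋃ j, shell d j = univ := by
  refine iUnion_eq_univ_iff.2 fun x ↦ ?_
  by_cases h : ‖x‖ ≤ 1
  · exact ⟨0, h⟩
  · obtain ⟨n, hn, hn'⟩ := exists_nat_pow_near (not_le.1 h).le one_lt_two
    exact ⟨n + 1, hn, hn'.le⟩

lemma measurableSet_shell (j : ℕ) : MeasurableSet (shell d j) := by
  cases j with
  | zero => exact measurableSet_le measurable_norm measurable_const
  | succ j =>
    exact (measurableSet_le measurable_const measurable_norm).inter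
      (measurableSet_le measurable_norm measurable_const)

lemma norm_le_of_mem_shell {x : E d} {j : ℕ} (hx : x ∈ shell d j) : ‖x‖ ≤ 2 ^ j := by
  cases j with
  | zero => simpa [shell] using hx
  | succ j => exact hx.2

lemma eLpNorm_shell_le (G : E d → ℂ) (j : ℕ) :
    eLpNorm G 2 (volume.restrict (shell d j)) ≤ 2 ^ ((j : ℝ) / 2) * normBStar G := by
  calc eLpNorm G 2 (volume.restrict (shell d j))
      = 2 ^ ((j : ℝ) / 2) * (2 ^ (-((j : ℝ) / 2)) * eLpNorm G 2 (volume.restrict (shell d j))) := by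
        rw [← mul_assoc, ← ENNReal.rpow_add _ _ two_ne_zero ENNReal.ofNat_ne_top, add_neg_cancel,
          ENNReal.rpow_zero, one_mul]
    _ ≤ 2 ^ ((j : ℝ) / 2) * normBStar G := by
        gcongr
        exact le_iSup (fun j : ℕ ↦ (2 : ℝ≥0∞) ^ (-((j : ℝ) / 2)) *
          eLpNorm G 2 (volume.restrict (shell d j))) j

lemma lintegral_mul_le_normB (hF : AEStronglyMeasurable F volume)
    (hG : AEStronglyMeasurable G volume) :
    ∫⁻ x, ‖F x‖ₑ * ‖G x‖ₑ ≤ normB F * normBStar G :=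
  calc ∫⁻ x, ‖F x‖ₑ * ‖G x‖ₑ = ∫⁻ x in ⋃ j, shell d j, ‖F x‖ₑ * ‖G x‖ₑ := by
        rw [iUnion_shell, Measure.restrict_univ]
    _ ≤ ∑' j, ∫⁻ x in shell d j, ‖F x‖ₑ * ‖G x‖ₑ := lintegral_iUnion_le _ _
    _ ≤ ∑' j : ℕ, 2 ^ ((j : ℝ) / 2) * eLpNorm F 2 (volume.restrict (shell d j)) *
          normBStar G := ENNReal.tsum_le_tsum fun j ↦ by
        refine (lintegral_mul_le_eLpNorm_two hF.restrict hG.restrict).trans ?_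
        rw [mul_right_comm, mul_comm _ (eLpNorm F 2 _)]
        gcongr
        exact eLpNorm_shell_le G j
    _ = normB F * normBStar G := by rw [ENNReal.tsum_mul_right, normB]

lemma two_rpow_half_mul_sq (t : ℝ) (M : ℝ≥0∞) : (2 ^ (t / 2) * M) ^ 2 = 2 ^ t * M ^ 2 := by
  rw [mul_pow, ← ENNReal.rpow_natCast (2 ^ _), ← ENNReal.rpow_mul, Nat.cast_ofNat,
    div_mul_cancel₀ _ two_ne_zero]

lemma lintegral_shell_sq_le (G : E d → ℂ) (j : ℕ) :
    ∫⁻ x in shell d j, ‖G x‖ₑ ^ 2 ≤ 2 ^ j * normBStar G ^ 2 := by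
  rw [← eLpNorm_two_sq, ← ENNReal.rpow_natCast 2 j, ← two_rpow_half_mul_sq]
  gcongr
  exact eLpNorm_shell_le G j

lemma lintegral_norm_le_two_pow_sq_le (G : E d → ℂ) (j : ℕ) :
    ∫⁻ x in {x | ‖x‖ ≤ 2 ^ j}, ‖G x‖ₑ ^ 2 ≤ 2 ^ (j + 1) * normBStar G ^ 2 := by
  induction j with
  | zero =>
    have h := lintegral_shell_sq_le G 0
    simp only [shell, pow_zero, one_mul, zero_add, pow_one] at h ⊢
    exact h.trans (le_mul_of_one_le_left' one_le_two)
  | succ j ih =>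
    have hsub : {x : E d | ‖x‖ ≤ 2 ^ (j + 1)} ⊆ {x | ‖x‖ ≤ 2 ^ j} ∪ shell d (j + 1) :=
      fun x hx ↦ (le_total ‖x‖ (2 ^ j)).imp id fun h ↦ ⟨h, hx⟩
    calc ∫⁻ x in {x | ‖x‖ ≤ 2 ^ (j + 1)}, ‖G x‖ₑ ^ 2
        ≤ ∫⁻ x in {x | ‖x‖ ≤ 2 ^ j} ∪ shell d (j + 1), ‖G x‖ₑ ^ 2 := lintegral_mono_set hsub
      _ ≤ 2 ^ (j + 1) * normBStar G ^ 2 + 2 ^ (j + 1) * normBStar G ^ 2 :=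
        (lintegral_union_le _ _ _).trans (add_le_add ih (lintegral_shell_sq_le G (j + 1)))
      _ = 2 ^ (j + 1 + 1) * normBStar G ^ 2 := by ring

lemma lintegral_shell_comp_add_sq_le (G : E d → ℂ) {z : E d} (hz : ‖z‖ ≤ 1) (j : ℕ) :
    ∫⁻ x in shell d j, ‖G (x + z)‖ₑ ^ 2 ≤ 2 ^ (j + 2) * normBStar G ^ 2 :=
  calc ∫⁻ x in shell d j, ‖G (x + z)‖ₑ ^ 2
      = ∫⁻ x, (shell d j).indicator (fun x ↦ ‖G (x + z)‖ₑ ^ 2) x :=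
        (lintegral_indicator (measurableSet_shell j) _).symm
    _ ≤ ∫⁻ x, {x : E d | ‖x‖ ≤ 2 ^ (j + 1)}.indicator (fun x ↦ ‖G x‖ₑ ^ 2) (x + z) := by
        refine lintegral_mono (indicator_le' (fun x hx ↦ ?_) fun _ _ ↦ zero_le)
        have hxz : x + z ∈ {x : E d | ‖x‖ ≤ 2 ^ (j + 1)} := by
          have hone : (1 : ℝ) ≤ 2 ^ j := one_le_pow₀ one_le_two
          rw [mem_ofPred_eq, pow_succ]
          linarith [norm_add_le x z, norm_le_of_mem_shell hx]
        exact (indicator_of_mem hxz (‖G ·‖ₑ ^ 2)).ge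
    _ = ∫⁻ x, {x : E d | ‖x‖ ≤ 2 ^ (j + 1)}.indicator (fun x ↦ ‖G x‖ₑ ^ 2) x :=
        lintegral_add_right_eq_self _ z
    _ = ∫⁻ x in {x : E d | ‖x‖ ≤ 2 ^ (j + 1)}, ‖G x‖ₑ ^ 2 :=
        lintegral_indicator (measurableSet_le measurable_norm measurable_const) _
    _ ≤ 2 ^ (j + 2) * normBStar G ^ 2 := lintegral_norm_le_two_pow_sq_le G (j + 1)

lemma normBStar_comp_add_le (G : E d → ℂ) {z : E d} (hz : ‖z‖ ≤ 1) :
    normBStar (fun x ↦ G (x + z)) ≤ 2 * normBStar G := by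
  refine iSup_le fun j ↦ ?_
  have hj : eLpNorm (fun x ↦ G (x + z)) 2 (volume.restrict (shell d j)) ≤
      2 ^ (((j + 2 : ℕ) : ℝ) / 2) * normBStar G := by
    rw [← (ENNReal.pow_right_strictMono two_ne_zero).le_iff_le, eLpNorm_two_sq,
      two_rpow_half_mul_sq, ENNReal.rpow_natCast]
    exact lintegral_shell_comp_add_sq_le G hz j
  calc (2 : ℝ≥0∞) ^ (-((j : ℝ) / 2)) *
        eLpNorm (fun x ↦ G (x + z)) 2 (volume.restrict (shell d j))
      ≤ 2 ^ (-((j : ℝ) / 2)) * (2 ^ (((j + 2 : ℕ) : ℝ) / 2) * normBStar G) := by gcongr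
    _ = 2 ^ (1 : ℝ) * normBStar G := by
      rw [← mul_assoc, ← ENNReal.rpow_add _ _ two_ne_zero ENNReal.ofNat_ne_top]
      congr 2
      push_cast
      ring
    _ = 2 * normBStar G := by rw [ENNReal.rpow_one]

lemma normBStar_congr (h : F =ᵐ[volume] G) : normBStar F = normBStar G :=
  iSup_congr fun j ↦ by rw [eLpNorm_congr_ae (ae_restrict_of_ae h)]

lemma normBStar_conj (G : E d → ℂ) : normBStar (fun x ↦ conj (G x)) = normBStar G :=
  iSup_congr fun j ↦ by
    rw [eLpNorm_congr_enorm_ae (ae_of_all _ fun x ↦ RCLike.enorm_conj (G x))]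

lemma memLp_shell_of_normB (hF : AEStronglyMeasurable F volume) (h : normB F < ∞) (j : ℕ) :
    MemLp F 2 (volume.restrict (shell d j)) := by
  refine ⟨hF.restrict,
    (ENNReal.mul_lt_top_iff.1 ((ENNReal.le_tsum j).trans_lt h)).elim And.right ?_⟩
  rintro (h₀ | h₀)
  · simp [ENNReal.rpow_eq_zero_iff] at h₀
  · simp [h₀]

lemma tendsto_normB_indicator (hF : AEStronglyMeasurable F volume) (h : normB F < ∞)
    {s : ℕ → Set (E d)} (hs : ∀ n, NullMeasurableSet (s n))
    (hlim : ∀ x, ∀ᶠ n in Filter.atTop, x ∉ s n) :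
    Filter.Tendsto (fun n ↦ normB ((s n).indicator F)) Filter.atTop (nhds 0) := by
  have hcount (F : E d → ℂ) : normB F = ∫⁻ j : ℕ, (2 : ℝ≥0∞) ^ ((j : ℝ) / 2) *
      eLpNorm F 2 (volume.restrict (shell d j)) ∂Measure.count := by
    rw [lintegral_count, normB]
  simp_rw [hcount]
  rw [← lintegral_zero (μ := (Measure.count : Measure ℕ))]
  refine tendsto_lintegral_of_dominated_convergence
    (fun j ↦ (2 : ℝ≥0∞) ^ ((j : ℝ) / 2) * eLpNorm F 2 (volume.restrict (shell d j)))
    (fun n ↦ measurable_of_countable _) (fun n ↦ ae_of_all _ fun j ↦ ?_)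
    (by rw [← hcount]; exact h.ne) (ae_of_all _ fun j ↦ ?_)
  · dsimp only
    gcongr
    exact eLpNorm_indicator_le F
  · have hj := tendsto_eLpNorm_two_indicator (memLp_shell_of_normB hF h j)
      (fun n ↦ (hs n).mono_ac Measure.restrict_le_self.absolutelyContinuous) hlim
    simpa using ENNReal.Tendsto.const_mul hj
      (Or.inr (ENNReal.rpow_ne_top_of_nonneg (by positivity) ENNReal.ofNat_ne_top))

end Shells

/-! ### Moving Bessel potentials across the duality -/

section Correlation

variable {d : ℕ} {F G : E d → ℂ}

/-- The correlation of `F` and `G`. Its value at `0` is the bilinear pairing of `F` and `G`, and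
it turns identities tested against Schwartz functions into pointwise ones. -/
noncomputable def correlation (F G : E d → ℂ) (z : E d) : ℂ := ∫ x, F x * G (x + z)

lemma correlation_zero (F G : E d → ℂ) : correlation F G 0 = ∫ x, F x * G x := by
  simp [correlation]

lemma aestronglyMeasurable_comp_add (hG : AEStronglyMeasurable G volume) (z : E d) :
    AEStronglyMeasurable (fun x ↦ G (x + z)) volume :=
  hG.comp_measurePreserving (measurePreserving_add_right volume z)

lemma aestronglyMeasurable_correlation (hF : AEStronglyMeasurable F volume)
    (hG : AEStronglyMeasurable G volume) : AEStronglyMeasurable (correlation F G) volume := by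
  have h : AEStronglyMeasurable (fun p : E d × E d ↦ F p.1 * G (p.1 + p.2))
      ((volume : Measure (E d)).prod volume) :=
    hF.comp_fst.mul (hG.comp_quasiMeasurePreserving (quasiMeasurePreserving_add volume))
  exact h.prod_swap.integral_prod_right'

/-- The set where `F` or its argument exceeds `n`; truncating `F` there makes it bounded with
bounded support. -/
def tailSet (F : E d → ℂ) (n : ℕ) : Set (E d) := {x | (n : ℝ) < ‖x‖ ∨ (n : ℝ) < ‖F x‖}

lemma nullMeasurableSet_tailSet (hF : AEStronglyMeasurable F volume) (n : ℕ) :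
    NullMeasurableSet (tailSet F n) volume :=
  (nullMeasurableSet_lt aemeasurable_const measurable_norm.aemeasurable).union
    (nullMeasurableSet_lt aemeasurable_const hF.norm.aemeasurable)

lemma antitone_tailSet (F : E d → ℂ) : Antitone (tailSet F) := fun m n hmn x hx ↦ by
  have hmn' : (m : ℝ) ≤ n := by exact_mod_cast hmn
  exact hx.imp hmn'.trans_lt hmn'.trans_lt

lemma eventually_notMem_tailSet (F : E d → ℂ) (x : E d) :
    ∀ᶠ n in Filter.atTop, x ∉ tailSet F n := by
  obtain ⟨n, hn⟩ := exists_nat_gt (max ‖x‖ ‖F x‖)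
  filter_upwards [Filter.eventually_ge_atTop n] with k hk hx
  rcases antitone_tailSet F hk hx with h | h
  · exact (h.trans_le (le_max_left _ _)).not_gt hn
  · exact (h.trans_le (le_max_right _ _)).not_gt hn

lemma iInter_tailSet (F : E d → ℂ) : ⋂ n, tailSet F n = ∅ :=
  eq_empty_of_forall_notMem fun x hx ↦
    (eventually_notMem_tailSet F x).exists.elim fun n hn ↦ hn (mem_iInter.1 hx n)

lemma tendsto_lintegral_enorm_comp_add_sub (hG : Integrable G) :
    Filter.Tendsto (fun z ↦ ∫⁻ x, ‖G (x + z) - G x‖ₑ) (nhds 0) (nhds 0) := by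
  have : Fact ((1 : ℝ≥0∞) ≠ ∞) := ⟨ENNReal.one_ne_top⟩
  have hG' : MemLp G 1 volume := memLp_one_iff_integrable.2 hG
  have hcont : Continuous fun z : E d ↦ DomAddAct.mk z +ᵥ hG'.toLp G :=
    (continuous_id.vadd continuous_const).comp DomAddAct.continuous_mk
  have hmk_zero : DomAddAct.mk (0 : E d) = 0 := rfl
  refine (tendsto_iff_edist_tendsto_0.1 (hcont.tendsto 0)).congr fun z ↦ ?_
  rw [hmk_zero, zero_vadd, DomAddAct.mk_vadd_toLp, Lp.edist_toLp_toLp,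
    eLpNorm_one_eq_lintegral_enorm]
  simp [vadd_eq_add, add_comm z]

lemma enorm_mul_comp_add_sub_le (F G : E d → ℂ) (n : ℕ) {z : E d} (hz : ‖z‖ ≤ 1) (x : E d) :
    ‖F x * G (x + z) - F x * G x‖ₑ ≤ ‖(tailSet F n).indicator F x‖ₑ * ‖G (x + z)‖ₑ +
      ‖(tailSet F n).indicator F x‖ₑ * ‖G x‖ₑ +
      n * ‖(Metric.closedBall 0 (n + 1)).indicator G (x + z) -
        (Metric.closedBall 0 (n + 1)).indicator G x‖ₑ := by
  by_cases hx : x ∈ tailSet F n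
  · rw [indicator_of_mem hx, ← enorm_mul, ← enorm_mul]
    exact enorm_sub_le.trans le_self_add
  · rw [indicator_of_notMem hx]
    simp only [tailSet, mem_ofPred_eq, not_or, not_lt] at hx
    have hxz : x + z ∈ Metric.closedBall 0 ((n : ℝ) + 1) := by
      rw [mem_closedBall_zero_iff]
      linarith [norm_add_le x z, hx.1]
    have hx' : x ∈ Metric.closedBall 0 ((n : ℝ) + 1) := by
      rw [mem_closedBall_zero_iff]
      linarith [hx.1]
    rw [indicator_of_mem hxz, indicator_of_mem hx', ← mul_sub, enorm_mul]
    simp only [enorm_zero, zero_mul, zero_add]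
    gcongr
    rw [← ofReal_norm, ← ENNReal.ofReal_natCast]
    exact ENNReal.ofReal_le_ofReal hx.2

lemma edist_correlation_zero_le (hF : AEStronglyMeasurable F volume)
    (hG : AEStronglyMeasurable G volume)
    (hint : ∀ z, ‖z‖ ≤ 1 → Integrable fun x ↦ F x * G (x + z)) (n : ℕ) {z : E d} (hz : ‖z‖ ≤ 1) :
    edist (correlation F G z) (correlation F G 0) ≤
      (∫⁻ x, ‖(tailSet F n).indicator F x‖ₑ * ‖G (x + z)‖ₑ) +
      (∫⁻ x, ‖(tailSet F n).indicator F x‖ₑ * ‖G (x + 0)‖ₑ) +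
      n * ∫⁻ x, ‖(Metric.closedBall 0 (n + 1)).indicator G (x + z) -
        (Metric.closedBall 0 (n + 1)).indicator G x‖ₑ := by
  have hmeas (z : E d) :
      AEMeasurable (fun x ↦ ‖(tailSet F n).indicator F x‖ₑ * ‖G (x + z)‖ₑ) volume :=
    (hF.indicator₀ (nullMeasurableSet_tailSet hF n)).enorm.mul
      (aestronglyMeasurable_comp_add hG z).enorm
  have hsum : AEMeasurable (fun x ↦ ‖(tailSet F n).indicator F x‖ₑ * ‖G (x + z)‖ₑ +
      ‖(tailSet F n).indicator F x‖ₑ * ‖G (x + 0)‖ₑ) volume := (hmeas z).add (hmeas 0)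
  rw [edist_eq_enorm_sub, correlation, correlation, ← integral_sub (hint z hz) (hint 0 (by simp)),
    ← lintegral_const_mul' _ _ (ENNReal.natCast_ne_top n), ← lintegral_add_left' (hmeas z),
    ← lintegral_add_left' hsum]
  refine (enorm_integral_le_lintegral_enorm _).trans (lintegral_mono fun x ↦ ?_)
  simpa only [add_zero] using enorm_mul_comp_add_sub_le F G n hz x

lemma continuousAt_correlation (hF : AEStronglyMeasurable F volume) (hG : LocallyIntegrable G)
    {N : (E d → ℂ) → ℝ≥0∞} {M : ℝ≥0∞} (hM : M ≠ ∞)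
    (hN : ∀ P, AEStronglyMeasurable P volume → ∀ z, ‖z‖ ≤ 1 →
      ∫⁻ x, ‖P x‖ₑ * ‖G (x + z)‖ₑ ≤ N P * M) (hfin : N F < ∞)
    (hlim : Filter.Tendsto (fun n ↦ N ((tailSet F n).indicator F)) Filter.atTop (nhds 0)) :
    ContinuousAt (correlation F G) 0 := by
  have hGm := hG.aestronglyMeasurable
  have hint (z : E d) (hz : ‖z‖ ≤ 1) : Integrable fun x ↦ F x * G (x + z) := by
    refine ⟨hF.mul (aestronglyMeasurable_comp_add hGm z), ?_⟩
    simp_rw [HasFiniteIntegral, enorm_mul]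
    exact (hN F hF z hz).trans_lt (ENNReal.mul_lt_top hfin hM.lt_top)
  have htail := ENNReal.Tendsto.mul_const hlim (Or.inr hM)
  rw [zero_mul] at htail
  rw [ContinuousAt, tendsto_iff_edist_tendsto_0, ENNReal.tendsto_nhds_zero]
  intro ε hε
  have hε₃ : 0 < ε / 3 := ENNReal.div_pos hε.ne' (by simp)
  obtain ⟨n, hn⟩ := (ENNReal.tendsto_nhds_zero.1 htail _ hε₃).exists
  have hAF := hF.indicator₀ (nullMeasurableSet_tailSet hF n)
  have hg : Integrable ((Metric.closedBall (0 : E d) (n + 1)).indicator G) :=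
    (integrable_indicator_iff measurableSet_closedBall).2
      (hG.integrableOn_isCompact (isCompact_closedBall _ _))
  have hcont := ENNReal.Tendsto.const_mul (tendsto_lintegral_enorm_comp_add_sub hg)
    (Or.inr (ENNReal.natCast_ne_top n))
  rw [mul_zero] at hcont
  filter_upwards [ENNReal.tendsto_nhds_zero.1 hcont _ hε₃, Metric.closedBall_mem_nhds 0 one_pos]
    with z hz hz₁
  rw [mem_closedBall_zero_iff] at hz₁
  calc edist (correlation F G z) (correlation F G 0)
      ≤ ε / 3 + ε / 3 + ε / 3 := by
        refine (edist_correlation_zero_le hF hGm hint n hz₁).trans ?_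
        gcongr
        · exact (hN _ hAF z hz₁).trans hn
        · exact (hN _ hAF 0 (by simp)).trans hn
    _ = ε := ENNReal.add_thirds ε

lemma lintegral_mul_comp_add_le_lorentzTwoNorm (hF : AEStronglyMeasurable F volume)
    (hG : AEStronglyMeasurable G volume) (a : ℝ) (z : E d) :
    ∫⁻ x, ‖F x‖ₑ * ‖G (x + z)‖ₑ ≤
      lorentzTwoNorm volume a (‖F ·‖ₑ) * (2 * lorentzTwoNorm volume (1 - a) (‖G ·‖ₑ)) := by
  refine (lintegral_mul_le_lorentzTwoNorm hF.enorm
    (aestronglyMeasurable_comp_add hG z).enorm a).trans_eq ?_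
  have htranslate := lorentzTwoNorm_comp_measurableEquiv (e := MeasurableEquiv.addRight z)
    (measurePreserving_add_right (volume : Measure (E d)) z) (1 - a) (‖G ·‖ₑ)
  rw [← htranslate, mul_left_comm]
  rfl

lemma lintegral_mul_comp_add_le_normB (hF : AEStronglyMeasurable F volume)
    (hG : AEStronglyMeasurable G volume) {z : E d} (hz : ‖z‖ ≤ 1) :
    ∫⁻ x, ‖F x‖ₑ * ‖G (x + z)‖ₑ ≤ normB F * (2 * normBStar G) :=
  (lintegral_mul_le_normB hF (aestronglyMeasurable_comp_add hG z)).trans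
    (mul_le_mul_right (normBStar_comp_add_le G hz) _)

lemma continuousAt_correlation_of_lorentzTwoNorm {a : ℝ} (ha : 0 < a)
    (hF : AEStronglyMeasurable F volume) (hFfin : lorentzTwoNorm volume a (‖F ·‖ₑ) < ∞)
    (hG : LocallyIntegrable G) (hGfin : lorentzTwoNorm volume (1 - a) (‖G ·‖ₑ) < ∞) :
    ContinuousAt (correlation F G) 0 := by
  refine continuousAt_correlation (N := fun P ↦ lorentzTwoNorm volume a (‖P ·‖ₑ)) hF hG
    (ENNReal.mul_ne_top ENNReal.ofNat_ne_top hGfin.ne)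
    (fun P hP z _ ↦ lintegral_mul_comp_add_le_lorentzTwoNorm hP hG.aestronglyMeasurable a z)
    hFfin ?_
  simp_rw [enorm_indicator_eq_indicator_enorm]
  exact tendsto_lorentzTwoNorm_indicator ha hF.enorm hFfin (nullMeasurableSet_tailSet hF)
    (antitone_tailSet F) (iInter_tailSet F)

lemma continuousAt_correlation_of_normB (hF : AEStronglyMeasurable F volume)
    (hFfin : normB F < ∞) (hG : LocallyIntegrable G) (hGfin : normBStar G < ∞) :
    ContinuousAt (correlation F G) 0 :=
  continuousAt_correlation hF hG (ENNReal.mul_ne_top ENNReal.ofNat_ne_top hGfin.ne)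
    (fun _ hP _ hz ↦ lintegral_mul_comp_add_le_normB hP hG.aestronglyMeasurable hz) hFfin
    (tendsto_normB_indicator hF hFfin (nullMeasurableSet_tailSet hF) (eventually_notMem_tailSet F))

end Correlation

section Duality

variable {d : ℕ} {F G H G₁ G₂ : E d → ℂ}

lemma integrable_comp_sub_mul_mul {φ : 𝓢(E d, ℂ)} (hF : AEStronglyMeasurable F volume)
    (hG : AEStronglyMeasurable G volume) {M : ℝ≥0∞} (hM : M ≠ ∞)
    (h : ∀ z, φ z ≠ 0 → ∫⁻ x, ‖F x‖ₑ * ‖G (x + z)‖ₑ ≤ M) :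
    Integrable (fun p : E d × E d ↦ φ (p.2 - p.1) * (F p.1 * G p.2)) (volume.prod volume) := by
  have hm : AEStronglyMeasurable (fun p : E d × E d ↦ φ p.2 * (F p.1 * G (p.1 + p.2)))
      (volume.prod volume) :=
    (φ.continuous.comp continuous_snd).aestronglyMeasurable.mul
      (hF.comp_fst.mul (hG.comp_quasiMeasurePreserving (quasiMeasurePreserving_add volume)))
  have hm' : AEStronglyMeasurable (fun p : E d × E d ↦ φ (p.2 - p.1) * (F p.1 * G p.2))
      (volume.prod volume) :=
    (φ.continuous.comp (by fun_prop)).aestronglyMeasurable.mul (hF.comp_fst.mul hG.comp_snd)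
  rw [← (measurePreserving_prod_add volume volume).integrable_comp hm']
  simp only [Function.comp_def, add_sub_cancel_left]
  refine ⟨hm, ?_⟩
  calc ∫⁻ p, ‖φ p.2 * (F p.1 * G (p.1 + p.2))‖ₑ ∂(volume.prod volume)
      = ∫⁻ z, ‖φ z‖ₑ * ∫⁻ x, ‖F x‖ₑ * ‖G (x + z)‖ₑ := by
        rw [lintegral_prod_symm _ hm.enorm]
        simp_rw [enorm_mul, lintegral_const_mul' _ _ enorm_ne_top]
    _ ≤ ∫⁻ z, ‖φ z‖ₑ * M := lintegral_mono fun z ↦ by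
        by_cases hz : φ z = 0
        · simp [hz]
        · exact mul_le_mul_right (h z hz) _
    _ < ∞ := by
        rw [lintegral_mul_const' _ _ hM]
        exact ENNReal.mul_lt_top φ.integrable.2 hM.lt_top

lemma integral_mul_correlation {φ : E d → ℂ}
    (h : Integrable (fun p : E d × E d ↦ φ (p.2 - p.1) * (F p.1 * G p.2)) (volume.prod volume)) :
    ∫ z, φ z * correlation F G z =
      ∫ p, φ (p.2 - p.1) * (F p.1 * G p.2) ∂(volume.prod volume) := by
  have hint : Integrable (fun p : E d × E d ↦ φ p.2 * (F p.1 * G (p.1 + p.2)))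
      (volume.prod volume) := by
    simpa [Function.comp_def] using
      (measurePreserving_prod_add volume volume).integrable_comp_of_integrable h
  rw [← integral_prod_comp_add]
  simp only [add_sub_cancel_left]
  simp_rw [integral_prod_symm _ hint, integral_const_mul, correlation]

lemma integral_mul_correlation_eq_integral_left {φ : E d → ℂ}
    (h : Integrable (fun p : E d × E d ↦ φ (p.2 - p.1) * (F p.1 * G p.2)) (volume.prod volume)) :
    ∫ z, φ z * correlation F G z = ∫ x, F x * ∫ w, φ (w - x) * G w := by
  simp_rw [integral_mul_correlation h, integral_prod _ h, mul_left_comm, integral_const_mul]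

lemma integral_mul_correlation_eq_integral_right {φ : E d → ℂ}
    (h : Integrable (fun p : E d × E d ↦ φ (p.2 - p.1) * (F p.1 * G p.2)) (volume.prod volume)) :
    ∫ z, φ z * correlation F G z = ∫ w, G w * ∫ x, φ (w - x) * F x := by
  simp_rw [integral_mul_correlation h, integral_prod_symm _ h, ← mul_assoc, integral_mul_const,
    mul_comm]

/-- The smooth bump functions of integral one with support in the ball of radius `1 / (n + 1)`. -/
noncomputable def shrinkingBump (d n : ℕ) : ContDiffBump (0 : E d) where
  rIn := 1 / (n + 1) / 2
  rOut := 1 / (n + 1)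
  rIn_pos := by positivity
  rIn_lt_rOut := half_lt_self (by positivity)

lemma tendsto_integral_shrinkingBump_mul {c : E d → ℂ} (hm : AEStronglyMeasurable c volume)
    (hc : ContinuousAt c 0) :
    Filter.Tendsto (fun n ↦ ∫ z, ((shrinkingBump d n).normed volume z : ℂ) * c z) Filter.atTop
      (nhds (c 0)) := by
  have hneg : Filter.Tendsto (fun p : ℕ × E d ↦ c (-p.2)) (Filter.atTop ×ˢ nhds 0)
      (nhds (c 0)) := by
    have : Filter.Tendsto (fun x : E d ↦ -x) (nhds 0) (nhds 0) := by
      simpa using (continuous_neg (G := E d)).tendsto 0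
    exact (hc.tendsto.comp this).comp Filter.tendsto_snd
  have h := ContDiffBump.convolution_tendsto_right (μ := volume) (φ := shrinkingBump d)
    (g := fun _ x ↦ c (-x)) (k := fun _ ↦ 0) tendsto_one_div_add_atTop_nhds_zero_nat
    (Filter.Eventually.of_forall fun _ ↦
      hm.comp_measurePreserving (Measure.measurePreserving_neg volume)) hneg tendsto_const_nhds
  simpa [convolution_def] using h

lemma eq_at_zero_of_integral_schwartz_mul_eq {c₁ c₂ : E d → ℂ}
    (hm₁ : AEStronglyMeasurable c₁ volume) (hm₂ : AEStronglyMeasurable c₂ volume)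
    (hc₁ : ContinuousAt c₁ 0) (hc₂ : ContinuousAt c₂ 0)
    (h : ∀ φ : 𝓢(E d, ℂ), (∀ z, φ z ≠ 0 → ‖z‖ ≤ 1) → ∫ z, φ z * c₁ z = ∫ z, φ z * c₂ z) :
    c₁ 0 = c₂ 0 := by
  refine tendsto_nhds_unique (tendsto_integral_shrinkingBump_mul hm₁ hc₁)
    ((tendsto_integral_shrinkingBump_mul hm₂ hc₂).congr fun n ↦ ?_)
  set b := shrinkingBump d n
  have hsmooth : ContDiff ℝ (⊤ : ℕ∞) fun z ↦ ((b.normed volume z : ℝ) : ℂ) :=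
    Complex.ofRealCLM.contDiff.comp b.contDiff_normed
  have hsupp : HasCompactSupport fun z ↦ ((b.normed volume z : ℝ) : ℂ) :=
    b.hasCompactSupport_normed.comp_left Complex.ofReal_zero
  refine (h (hsupp.toSchwartzMap hsmooth) fun z hz ↦ ?_).symm
  have hz' : z ∈ Function.support (b.normed volume) := fun h₀ ↦ hz (by
    rw [HasCompactSupport.toSchwartzMap_toFun, h₀, Complex.ofReal_zero])
  rw [b.support_normed_eq, mem_ball_zero_iff] at hz'
  exact hz'.le.trans (by simp [b, shrinkingBump, inv_le_one_iff₀])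

lemma integral_schwartzS_sub_left_mul {β : ℝ} (hβ : 0 < β)
    (h : ∀ φ : 𝓢(E d, ℂ), ∫ x, schwartzS β φ x * F x = ∫ x, φ x * H x) (φ : 𝓢(E d, ℂ)) (w : E d) :
    ∫ x, schwartzS β φ (w - x) * F x = ∫ x, φ (w - x) * H x := by
  simpa only [schwartzS_reflect hβ, reflect_apply] using h (reflect w φ)

lemma integral_schwartzS_sub_right_mul {β : ℝ} (hβ : 0 < β)
    (h : ∀ φ : 𝓢(E d, ℂ), ∫ x, schwartzS β φ x * F x = ∫ x, φ x * H x) (φ : 𝓢(E d, ℂ)) (w : E d) :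
    ∫ x, schwartzS β φ (x - w) * F x = ∫ x, φ (x - w) * H x := by
  simpa [schwartzS_reflect hβ, reflect_apply] using h (reflect w (reflect 0 φ))

theorem integral_mul_eq_integral_mul_of_schwartzS {β a : ℝ} (hβ : 0 < β) (ha : 0 < a)
    (hFH : ∀ φ : 𝓢(E d, ℂ), ∫ x, schwartzS β φ x * F x = ∫ x, φ x * H x)
    (hG : ∀ φ : 𝓢(E d, ℂ), ∫ x, schwartzS β φ x * G₁ x = ∫ x, φ x * G₂ x)
    (hH : AEStronglyMeasurable H volume) (hHfin : lorentzTwoNorm volume a (‖H ·‖ₑ) < ∞)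
    (hF : AEStronglyMeasurable F volume) (hFfin : lorentzTwoNorm volume a (‖F ·‖ₑ) < ∞)
    (hFB : normB F < ∞) (hG₁ : LocallyIntegrable G₁)
    (hG₁fin : lorentzTwoNorm volume (1 - a) (‖G₁ ·‖ₑ) < ∞) (hG₂ : LocallyIntegrable G₂)
    (hG₂B : normBStar G₂ < ∞) : ∫ x, H x * G₁ x = ∫ x, F x * G₂ x := by
  have hG₁m := hG₁.aestronglyMeasurable
  have hG₂m := hG₂.aestronglyMeasurable
  have hfubini {P : E d → ℂ} (hP : AEStronglyMeasurable P volume)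
      (hPfin : lorentzTwoNorm volume a (‖P ·‖ₑ) < ∞) (φ : 𝓢(E d, ℂ)) :=
    integrable_comp_sub_mul_mul (φ := φ) hP hG₁m
      (ENNReal.mul_lt_top hPfin (ENNReal.mul_lt_top (by simp) hG₁fin)).ne
      fun z _ ↦ lintegral_mul_comp_add_le_lorentzTwoNorm hP hG₁m a z
  rw [← correlation_zero, ← correlation_zero]
  refine eq_at_zero_of_integral_schwartz_mul_eq (aestronglyMeasurable_correlation hH hG₁m)
    (aestronglyMeasurable_correlation hF hG₂m)
    (continuousAt_correlation_of_lorentzTwoNorm ha hH hHfin hG₁ hG₁fin)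
    (continuousAt_correlation_of_normB hF hFB hG₂ hG₂B) fun φ hφ ↦ ?_
  have hfubiniB := integrable_comp_sub_mul_mul (φ := φ) hF hG₂m
    (ENNReal.mul_lt_top hFB (ENNReal.mul_lt_top (by simp) hG₂B)).ne
    fun z hz ↦ lintegral_mul_comp_add_le_normB hF hG₂m (hφ z hz)
  calc ∫ z, φ z * correlation H G₁ z
      = ∫ w, G₁ w * ∫ x, φ (w - x) * H x :=
        integral_mul_correlation_eq_integral_right (hfubini hH hHfin φ)
    _ = ∫ w, G₁ w * ∫ x, schwartzS β φ (w - x) * F x := by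
        simp_rw [integral_schwartzS_sub_left_mul hβ hFH]
    _ = ∫ x, F x * ∫ w, schwartzS β φ (w - x) * G₁ w := by
        rw [← integral_mul_correlation_eq_integral_right (hfubini hF hFfin _),
          integral_mul_correlation_eq_integral_left (hfubini hF hFfin _)]
    _ = ∫ x, F x * ∫ w, φ (w - x) * G₂ w := by
        simp_rw [integral_schwartzS_sub_right_mul hβ hG]
    _ = ∫ z, φ z * correlation F G₂ z :=
        (integral_mul_correlation_eq_integral_left hfubiniB).symm

lemma locallyIntegrable_conj (hG : LocallyIntegrable G) :
    LocallyIntegrable fun x ↦ conj (G x) :=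
  fun x ↦ (hG x).elim fun s hs ↦
    ⟨s, hs.1, (Complex.conjLIE.integrable_comp_iff).2 hs.2⟩

lemma IsFun.lorentzTwoNorm_lt_top_of_S_neg {β a : ℝ} {U : 𝓢'(E d, ℂ)} (hβ : 0 < β) (ha : 0 < a)
    (ha₁ : a < 1) (hH : IsFun U H) (hHfin : lorentzTwoNorm volume a (‖H ·‖ₑ) < ∞)
    (hF : IsFun (S (-β) U) F) : lorentzTwoNorm volume a (‖F ·‖ₑ) < ∞ := by
  have hprob := isProbabilityMeasure_besselMeasure (d := d) hβ
  have hpot := (memLOneAddLTop_of_lorentzTwoNorm ha ha₁ hH.1 hHfin).isFun_S_neg hβ hH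
  have hle : (‖F ·‖ₑ) ≤ᵐ[volume] fun x ↦ ∫⁻ y, ‖H (y + x)‖ₑ ∂besselMeasure d β := by
    filter_upwards [hF.ae_eq hpot] with x hx
    exact hx ▸ enorm_integral_le_lintegral_enorm _
  have hbound := lorentzTwoNorm_lintegral_comp_add_le (C := 1) le_rfl ha ha₁
    (ν := besselMeasure d β) (fun A _ ↦ by simpa using prob_le_one) hH.1.enorm hHfin
  rw [sub_zero] at hbound
  exact (lorentzTwoNorm_mono hle a).trans_lt (hbound.trans_lt (ENNReal.mul_lt_top
    (ENNReal.mul_lt_top ENNReal.one_lt_top (lintegral_min_one_rpow_mul_rpow_neg_lt_top ha ha₁))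
    hHfin))

theorem integral_mul_conj_eq_integral_mul_conj_of_S {β a : ℝ} (hβ : 0 < β) (ha : 0 < a)
    (ha₁ : a < 1) {U g : 𝓢'(E d, ℂ)} (hH : IsFun U H)
    (hHfin : lorentzTwoNorm volume a (‖H ·‖ₑ) < ∞) (hF : IsFun (S (-β) U) F) (hFB : normB F < ∞)
    (hG₁ : IsFun g G₁) (hG₁fin : lorentzTwoNorm volume (1 - a) (‖G₁ ·‖ₑ) < ∞)
    (hG₂ : IsFun (S β g) G₂) (hG₂B : normBStar G₂ < ∞) :
    ∫ x, H x * conj (G₁ x) = ∫ x, F x * conj (G₂ x) := by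
  have hH' : IsFun (S β (S (-β) U)) H := by rwa [S_S_neg]
  exact integral_mul_eq_integral_mul_of_schwartzS hβ ha (hF.integral_schwartzS_mul hH')
    (hG₁.integral_schwartzS_mul_conj hβ hG₂) hH.1 hHfin hF.1
    (hH.lorentzTwoNorm_lt_top_of_S_neg hβ ha ha₁ hHfin hF) hFB
    (locallyIntegrable_conj hG₁.locallyIntegrable) (by simpa only [RCLike.enorm_conj] using hG₁fin)
    (locallyIntegrable_conj hG₂.locallyIntegrable) (by rwa [normBStar_conj])

end Duality

/-! ### Bessel potentials between Lorentz spaces -/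

section Potentials

variable {d : ℕ}

lemma distNorm_eq {N : (E d → ℂ) → ℝ≥0∞} (hN : ∀ f g, f =ᵐ[volume] g → N f = N g)
    {T : 𝓢'(E d, ℂ)} {f : E d → ℂ} (hT : IsFun T f) : distNorm N T = N f :=
  le_antisymm (iInf₂_le f hT) (le_iInf₂ fun _ hg ↦ (hN _ _ (hT.ae_eq hg)).le)

lemma lorentzNorm_two_congr {p : ℝ} (hp : 0 < p) {f g : E d → ℂ} (h : f =ᵐ[volume] g) :
    lorentzNorm p 2 f = lorentzNorm p 2 g := by
  rw [lorentzNorm_two_eq hp, lorentzNorm_two_eq hp]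
  congr 1
  exact lorentzTwoNorm_congr (h.fun_comp (‖·‖ₑ)) _

lemma distNorm_lorentzNorm_two_eq {p : ℝ} (hp : 0 < p) {T : 𝓢'(E d, ℂ)} {f : E d → ℂ}
    (hT : IsFun T f) : distNorm (lorentzNorm p 2) T = lorentzNorm p 2 f :=
  distNorm_eq (fun _ _ ↦ lorentzNorm_two_congr hp) hT

lemma lorentzTwoNorm_eq_mul_lorentzNorm_two {p : ℝ} (hp : 0 < p) (f : E d → ℂ) :
    lorentzTwoNorm volume (1 / p) (‖f ·‖ₑ) =
      ENNReal.ofReal (p / 2) ^ (1 / 2 : ℝ) * lorentzNorm p 2 f := by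
  rw [lorentzNorm_two_eq hp, ← mul_assoc, ← ENNReal.mul_rpow_of_nonneg _ _ (by norm_num),
    ← ENNReal.ofReal_mul (by positivity), div_mul_div_cancel₀ two_ne_zero, div_self hp.ne',
    ENNReal.ofReal_one, ENNReal.one_rpow, one_mul]

lemma enorm_besselPotential_le (α : ℝ) (f : E d → ℂ) (x : E d) :
    ‖besselPotential α f x‖ₑ ≤ ∫⁻ y, ‖f (y + x)‖ₑ ∂besselMeasure d α :=
  enorm_integral_le_lintegral_enorm _

lemma exists_lorentzTwoNorm_lintegral_besselMeasure_le {α κ a : ℝ} (hd : 0 < d) (hα : 0 < α)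
    (hκ₀ : 0 ≤ κ) (hκ : κ ≤ α / d) (hκa : κ < a) (ha : a < 1) :
    ∃ C : ℝ≥0, ∀ f : E d → ℂ, AEStronglyMeasurable f →
      lorentzTwoNorm volume (a - κ) (fun x ↦ ∫⁻ y, ‖f (y + x)‖ₑ ∂besselMeasure d α) ≤
        C * lorentzTwoNorm volume a (‖f ·‖ₑ) := by
  have := isProbabilityMeasure_besselMeasure (d := d) hα
  obtain ⟨C, hC⟩ := exists_besselMeasure_le_mul_rpow hd hα hκ₀ (hκa.trans ha) hκ
  have hI := lintegral_min_one_rpow_mul_rpow_neg_lt_top hκa ha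
  set I := ∫⁻ ρ in Ioi (0 : ℝ), ENNReal.ofReal (min 1 (ρ ^ (κ - 1)) * ρ ^ (-a))
  refine ⟨C * I.toNNReal + 1, fun f hf ↦ ?_⟩
  obtain hfin | hfin := (le_top (a := lorentzTwoNorm volume a (‖f ·‖ₑ))).lt_or_eq
  · refine (lorentzTwoNorm_lintegral_comp_add_le hκ₀ hκa ha hC hf.enorm hfin).trans ?_
    rw [ENNReal.coe_add, ENNReal.coe_mul, ENNReal.coe_toNNReal hI.ne]
    gcongr
    exact le_self_add
  · rw [hfin, ENNReal.mul_top (by simp)]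
    exact le_top

lemma measurePreserving_neg_fst_add (ν : Measure (E d)) [SFinite ν] [ν.IsNegInvariant] :
    MeasurePreserving (fun z : E d × E d ↦ (-z.1, z.1 + z.2)) (ν.prod volume) (ν.prod volume) :=
  ((Measure.measurePreserving_neg ν).prod (MeasurePreserving.id volume)).comp
    (measurePreserving_prod_add ν volume)

lemma integral_besselPotential_mul {α : ℝ} (hα : 0 < α) {f g : E d → ℂ}
    (hf : AEStronglyMeasurable f) (hg : AEStronglyMeasurable g)
    (hfin : ∫⁻ x, (∫⁻ y, ‖f (y + x)‖ₑ ∂besselMeasure d α) * ‖g x‖ₑ < ∞) :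
    ∫ x, besselPotential α f x * g x = ∫ x, f x * besselPotential α g x := by
  have := isProbabilityMeasure_besselMeasure (d := d) hα
  have := isNegInvariant_besselMeasure (d := d) hα
  unfold besselPotential
  set ν := besselMeasure d α
  have hmp := measurePreserving_neg_fst_add ν
  have hΦm : AEStronglyMeasurable (fun z : E d × E d ↦ f (z.1 + z.2) * g z.2) (ν.prod volume) :=
    (hf.comp_quasiMeasurePreserving (quasiMeasurePreserving_add ν)).mul hg.comp_snd
  have hΨm : AEStronglyMeasurable (fun z : E d × E d ↦ f z.2 * g (z.1 + z.2)) (ν.prod volume) :=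
    hf.comp_snd.mul (hg.comp_quasiMeasurePreserving (quasiMeasurePreserving_add ν))
  have hΦ : Integrable (fun z : E d × E d ↦ f (z.1 + z.2) * g z.2) (ν.prod volume) := by
    refine ⟨hΦm, ?_⟩
    rw [HasFiniteIntegral, lintegral_prod_symm _ hΦm.enorm]
    simpa only [enorm_mul, lintegral_mul_const' _ _ enorm_ne_top] using hfin
  have hΨ : Integrable (fun z : E d × E d ↦ f z.2 * g (z.1 + z.2)) (ν.prod volume) := by
    rw [← hmp.integrable_comp hΨm]
    simpa [Function.comp_def] using hΦ
  calc ∫ x, (∫ y, f (y + x) ∂ν) * g x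
      = ∫ z, f (z.1 + z.2) * g z.2 ∂(ν.prod volume) := by
        simp_rw [integral_prod_symm _ hΦ, integral_mul_const]
    _ = ∫ z, f z.2 * g (z.1 + z.2) ∂(ν.prod volume) := by
        have h := integral_map hmp.aemeasurable (hmp.map_eq.symm ▸ hΨm)
        rw [hmp.map_eq] at h
        simpa using h.symm
    _ = ∫ x, f x * ∫ y, g (y + x) ∂ν := by
        simp_rw [integral_prod_symm _ hΨ, integral_const_mul]

lemma integrable_mul_of_lorentzTwoNorm {f g : E d → ℂ} (hf : AEStronglyMeasurable f)
    (hg : AEStronglyMeasurable g) {a : ℝ} (hffin : lorentzTwoNorm volume a (‖f ·‖ₑ) < ∞)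
    (hgfin : lorentzTwoNorm volume (1 - a) (‖g ·‖ₑ) < ∞) : Integrable fun x ↦ f x * g x := by
  refine ⟨hf.mul hg, ?_⟩
  simp_rw [HasFiniteIntegral, enorm_mul]
  refine (lintegral_mul_le_lorentzTwoNorm hf.enorm hg.enorm a).trans_lt ?_
  have := hffin.ne
  have := hgfin.ne
  finiteness

end Potentials

/-! ### Weak Lebesgue functions approximable by bounded functions of bounded support -/

section WeakApproximation

variable {d : ℕ} {W : E d → ℂ} {b : ℝ}

/-- `W` lies in the closure in `L^{1/b,∞}` of the bounded functions with bounded support. -/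
def IsWeakApproximable (b : ℝ) (W : E d → ℂ) : Prop :=
  ∀ ε : ℝ≥0∞, 0 < ε → ∃ (φ : E d → ℂ) (M : ℝ≥0) (R : ℝ), 1 ≤ R ∧ (∀ x, ‖φ x‖ₑ ≤ M) ∧
    (∀ x, R < ‖x‖ → φ x = 0) ∧ HasWeakBound volume b ε fun x ↦ ‖W x - φ x‖ₑ

lemma MemWeakZero.isWeakApproximable {q : ℝ} (hq : 0 < q) (hW : MemWeakZero q W) :
    IsWeakApproximable (1 / q) W := by
  intro ε hε
  obtain ⟨φ, hφ, hφc, hlt⟩ := hW.2 ε hε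
  obtain ⟨M, hM⟩ := hφ.continuous.bounded_above_of_compact_support hφc
  obtain ⟨R, hR⟩ := hφc.isCompact.isBounded.subset_closedBall 0
  refine ⟨φ, M.toNNReal, max 1 R, le_max_left _ _, fun x ↦ ?_, fun x hx ↦ ?_,
    (hasWeakBound_weakNorm hq _).mono_const hlt.le⟩
  · rw [← ofReal_norm]
    exact ENNReal.ofReal_le_ofReal (hM x)
  · by_contra hφx
    have hxR : ‖x‖ ≤ R := mem_closedBall_zero_iff.1 (hR (subset_tsupport φ hφx))
    exact (hxR.trans (le_max_right 1 R)).not_gt hx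

lemma IsWeakApproximable.exists_hasWeakBound (hb : 0 ≤ b) (hW : IsWeakApproximable b W) :
    ∃ K : ℝ≥0, HasWeakBound volume b K (‖W ·‖ₑ) := by
  obtain ⟨φ, M, R, -, hM, hφ, hweak⟩ := hW 1 one_pos
  have hφ_weak : HasWeakBound volume b (M * volume (Metric.closedBall (0 : E d) R) ^ b) (‖φ ·‖ₑ) :=
    hasWeakBound_of_support hM (fun x hx ↦ by simp [hφ x (by simpa using hx)]) hb
  have hball : volume (Metric.closedBall (0 : E d) R) ≠ ∞ := measure_closedBall_lt_top.ne
  refine ⟨_, ((hweak.add hφ_weak).mono (.of_forall fun x ↦ ?_)).mono_const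
    (ENNReal.coe_toNNReal (by finiteness)).ge⟩
  simpa using enorm_add_le (W x - φ x) (φ x)

end WeakApproximation

/-! ### Embeddings of `X^*` and into `X` -/

section Embeddings

variable {d m : ℕ} {c : ℝ}

/-- The exponents `c = 1 / (2q)` for which potentials in `L^{q,∞}` map `X^*` to `X`: `X^*`
embeds into the Lorentz space `L^{1/(1/2-c),2}`, multiplication by such a potential raises the
exponent by `2c`, and `L^{1/(1/2+c),2}` embeds into `X`. -/
structure Exponents (d m : ℕ) (c : ℝ) : Prop where
  two_le : 2 ≤ d
  one_le : 1 ≤ m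
  lt_half : c < 1 / 2
  lower : 1 / ((d : ℝ) + 1) ≤ c
  upper : c ≤ m / d

lemma exponents_one_div_two_mul {q : ℝ} (hd : 2 ≤ d) (hm : 1 ≤ m) (hq : 1 < q)
    (hq_lower : (d : ℝ) / (2 * m) ≤ q) (hq_upper : q ≤ ((d : ℝ) + 1) / 2) :
    Exponents d m (1 / (2 * q)) where
  two_le := hd
  one_le := hm
  lt_half := one_div_lt_one_div_of_lt two_pos (by linarith)
  lower := one_div_le_one_div_of_le (by linarith) (by linarith)
  upper := by
    have hm₀ : (0 : ℝ) < m := by exact_mod_cast hm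
    have hd₀ : (0 : ℝ) < d := by exact_mod_cast two_pos.trans_le hd
    rw [div_le_iff₀ (by positivity)] at hq_lower
    rw [div_le_div_iff₀ (by positivity) hd₀]
    linarith

lemma Exponents.pos (h : Exponents d m c) : 0 < c :=
  lt_of_lt_of_le (by positivity) h.lower

lemma Exponents.sub_le_theta_div (h : Exponents d m c) :
    c - 1 / ((d : ℝ) + 1) ≤ theta m d / d := by
  have hd : (2 : ℝ) ≤ d := by exact_mod_cast h.two_le
  have hθ : theta m d / d = m / d - 1 / ((d : ℝ) + 1) := by
    unfold theta
    field_simp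
  linarith [h.upper]

lemma theta_pos (d : ℕ) (hm : 1 ≤ m) : 0 < theta m d := by
  have hm' : (1 : ℝ) ≤ m := by exact_mod_cast hm
  exact sub_pos.2 (((div_lt_one (by positivity)).2 (lt_add_one _)).trans_le hm')

lemma one_div_pd (d : ℕ) : 1 / pd d = 1 / 2 + 1 / ((d : ℝ) + 1) := by
  unfold pd
  field_simp
  ring

lemma one_div_pd' (hd : 2 ≤ d) : 1 / pd' d = 1 / 2 - 1 / ((d : ℝ) + 1) := by
  have hd' : (2 : ℝ) ≤ d := by exact_mod_cast hd
  have : (d : ℝ) - 1 ≠ 0 := by linarith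
  unfold pd'
  field_simp
  ring

lemma one_div_add_one_lt_half (hd : 2 ≤ d) : 1 / ((d : ℝ) + 1) < 1 / 2 := by
  have hd' : (2 : ℝ) ≤ d := by exact_mod_cast hd
  exact one_div_lt_one_div_of_lt two_pos (by linarith)

lemma one_div_pd_lt_one (hd : 2 ≤ d) : 1 / pd d < 1 := by
  linarith [one_div_pd d, one_div_add_one_lt_half hd]

lemma one_div_pd'_lt_one (hd : 2 ≤ d) : 1 / pd' d < 1 := by
  have : 0 < 1 / ((d : ℝ) + 1) := by positivity
  linarith [one_div_pd' hd]

lemma one_sub_one_div_pd (hd : 2 ≤ d) : 1 - 1 / pd d = 1 / pd' d := by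
  rw [one_div_pd, one_div_pd' hd]
  ring

lemma Exponents.exists_lorentzTwoNorm_lintegral_besselMeasure_le (h : Exponents d m c) {a b : ℝ}
    (hab : a - b = c - 1 / ((d : ℝ) + 1)) (hb : 0 < b) (ha : a < 1) :
    ∃ C : ℝ≥0, ∀ f : E d → ℂ, AEStronglyMeasurable f →
      lorentzTwoNorm volume b (fun x ↦ ∫⁻ y, ‖f (y + x)‖ₑ ∂besselMeasure d (theta m d)) ≤
        C * lorentzTwoNorm volume a (‖f ·‖ₑ) := by
  obtain rfl : b = a - (c - 1 / ((d : ℝ) + 1)) := by linarith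
  exact HighOrderSchrodinger.exists_lorentzTwoNorm_lintegral_besselMeasure_le
    (two_pos.trans_le h.two_le) (theta_pos d h.one_le) (sub_nonneg.2 h.lower) h.sub_le_theta_div
    (sub_pos.1 hb) ha

lemma lorentzTwoNorm_lt_top_of_normXStar_lt_top (hd : 2 ≤ d) {u : 𝓢'(E d, ℂ)} {G : E d → ℂ}
    (hu : normXStar m u < ∞) (hG : IsFun (S (theta m d) u) G) :
    lorentzTwoNorm volume (1 / pd' d) (‖G ·‖ₑ) < ∞ := by
  rw [← lorentzNorm_two_lt_top_iff (pd'_pos hd), ← distNorm_lorentzNorm_two_eq (pd'_pos hd) hG]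
  exact (normXStar_lt_top.1 hu).1

lemma isFun_besselPotential_of_normXStar_lt_top (hd : 2 ≤ d) (hm : 1 ≤ m) {u : 𝓢'(E d, ℂ)}
    {G : E d → ℂ} (hu : normXStar m u < ∞) (hG : IsFun (S (theta m d) u) G) :
    IsFun u (besselPotential (theta m d) G) := by
  have hGL := memLOneAddLTop_of_lorentzTwoNorm (one_div_pos.2 (pd'_pos hd)) (one_div_pd'_lt_one hd)
    hG.1 (lorentzTwoNorm_lt_top_of_normXStar_lt_top hd hu hG)
  simpa only [S_neg_S] using hGL.isFun_S_neg (theta_pos d hm) hG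

lemma exists_isFun_of_normXStar_lt_top (hd : 2 ≤ d) (hm : 1 ≤ m) {u : 𝓢'(E d, ℂ)}
    (hu : normXStar m u < ∞) : ∃ f, IsFun u f := by
  obtain ⟨G, hG, -⟩ := distNorm_lt_top.1 (normXStar_lt_top.1 hu).1
  exact ⟨_, isFun_besselPotential_of_normXStar_lt_top hd hm hu hG⟩

lemma exists_lorentzTwoNorm_le_normXStar (h : Exponents d m c) :
    ∃ C : ℝ≥0, ∀ (u : 𝓢'(E d, ℂ)) f, IsFun u f →
      lorentzTwoNorm volume (1 / 2 - c) (‖f ·‖ₑ) ≤ C * normXStar m u := by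
  have hd := h.two_le
  have hp := pd'_pos hd
  obtain ⟨C, hC⟩ := h.exists_lorentzTwoNorm_lintegral_besselMeasure_le (a := 1 / pd' d)
    (b := 1 / 2 - c) (by linarith [one_div_pd' hd]) (sub_pos.2 h.lt_half) (one_div_pd'_lt_one hd)
  set P := ENNReal.ofReal (pd' d / 2) ^ (1 / 2 : ℝ)
  have hP : P ≠ ∞ := by finiteness
  refine ⟨C * P.toNNReal + 1, fun u f hf ↦ ?_⟩
  obtain hu | hu := (le_top (a := normXStar m u)).lt_or_eq
  swap
  · rw [hu, ENNReal.mul_top (by simp)]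
    exact le_top
  obtain ⟨G, hG, -⟩ := distNorm_lt_top.1 (normXStar_lt_top.1 hu).1
  have hfG := hf.ae_eq (isFun_besselPotential_of_normXStar_lt_top hd h.one_le hu hG)
  calc lorentzTwoNorm volume (1 / 2 - c) (‖f ·‖ₑ)
      ≤ lorentzTwoNorm volume (1 / 2 - c)
          (fun x ↦ ∫⁻ y, ‖G (y + x)‖ₑ ∂besselMeasure d (theta m d)) :=
        lorentzTwoNorm_mono (hfG.mono fun x hx ↦ hx ▸ enorm_besselPotential_le _ _ _) _
    _ ≤ C * (P * distNorm (lorentzNorm (pd' d) 2) (S (theta m d) u)) := by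
        rw [distNorm_lorentzNorm_two_eq hp hG, ← lorentzTwoNorm_eq_mul_lorentzNorm_two hp]
        exact hC G hG.1
    _ ≤ (C * P.toNNReal + 1 : ℝ≥0) * normXStar m u := by
        rw [ENNReal.coe_add, ENNReal.coe_mul, ENNReal.coe_toNNReal hP, ← mul_assoc]
        gcongr
        · exact le_self_add
        · exact le_max_left _ _

lemma normX_le_distNorm (T : 𝓢'(E d, ℂ)) :
    normX m T ≤ distNorm (lorentzNorm (pd d) 2) (S (-theta m d) T) := by
  have h₀ : distNorm normB (S (-(m : ℝ)) (0 : 𝓢'(E d, ℂ))) = 0 := by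
    rw [map_zero]
    exact le_antisymm ((iInf₂_le 0 isFun_zero).trans (by simp [normB])) zero_le
  refine (iInf₂_le_of_le T 0 (iInf_le _ (add_zero T).symm)).trans_eq ?_
  rw [h₀, add_zero]

lemma Exponents.memLOneAddLTop (h : Exponents d m c) {k : E d → ℂ} (hk : AEStronglyMeasurable k)
    (hfin : lorentzTwoNorm volume (1 / 2 + c) (‖k ·‖ₑ) < ∞) : MemLOneAddLTop k :=
  memLOneAddLTop_of_lorentzTwoNorm (by linarith [h.pos]) (by linarith [h.lt_half]) hk hfin

lemma exists_normX_le_lorentzTwoNorm (h : Exponents d m c) :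
    ∃ C : ℝ≥0, ∀ (T : 𝓢'(E d, ℂ)) k, IsFun T k →
      normX m T ≤ C * lorentzTwoNorm volume (1 / 2 + c) (‖k ·‖ₑ) := by
  have hp := pd_pos d
  obtain ⟨C, hC⟩ := h.exists_lorentzTwoNorm_lintegral_besselMeasure_le (a := 1 / 2 + c)
    (b := 1 / pd d) (by linarith [one_div_pd d]) (one_div_pos.2 hp) (by linarith [h.lt_half])
  set P := ENNReal.ofReal (2 / pd d) ^ (1 / 2 : ℝ)
  have hP : P ≠ ∞ := by finiteness
  refine ⟨P.toNNReal * C + 1, fun T k hT ↦ ?_⟩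
  obtain hfin | hfin := (le_top (a := lorentzTwoNorm volume (1 / 2 + c) (‖k ·‖ₑ))).lt_or_eq
  swap
  · rw [hfin, ENNReal.mul_top (by simp)]
    exact le_top
  have hpot := (h.memLOneAddLTop hT.1 hfin).isFun_S_neg (theta_pos d h.one_le) hT
  calc normX m T ≤ distNorm (lorentzNorm (pd d) 2) (S (-theta m d) T) := normX_le_distNorm T
    _ = P * lorentzTwoNorm volume (1 / pd d) (‖besselPotential (theta m d) k ·‖ₑ) := by
        rw [distNorm_lorentzNorm_two_eq hp hpot, lorentzNorm_two_eq hp]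
    _ ≤ P * (C * lorentzTwoNorm volume (1 / 2 + c) (‖k ·‖ₑ)) := by
        gcongr
        exact (lorentzTwoNorm_mono (.of_forall fun x ↦ enorm_besselPotential_le _ _ x) _).trans
          (hC k hT.1)
    _ ≤ (P.toNNReal * C + 1 : ℝ≥0) * lorentzTwoNorm volume (1 / 2 + c) (‖k ·‖ₑ) := by
        rw [ENNReal.coe_add, ENNReal.coe_mul, ENNReal.coe_toNNReal hP, ← mul_assoc]
        gcongr
        exact le_self_add

end Embeddings

/-! ### The duality of `X` and `X^*` on functions -/

section Pairing

variable {d m : ℕ} {c : ℝ} {hd : 2 ≤ d}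

lemma lorentzTwoNorm_S_theta_lt_top (g : XStar d m hd) {G : E d → ℂ}
    (hG : IsFun (S (theta m d) (g : 𝓢'(E d, ℂ))) G) :
    lorentzTwoNorm volume (1 - 1 / pd d) (‖G ·‖ₑ) < ∞ := by
  rw [one_sub_one_div_pd hd]
  exact lorentzTwoNorm_lt_top_of_normXStar_lt_top hd g.2 hG

lemma integral_mul_conj_S_theta_eq_integral_mul_conj_S {T : 𝓢'(E d, ℂ)} {g : XStar d m hd}
    {H F G₁ G₂ : E d → ℂ} (hH : IsFun (S (-theta m d) T) H)
    (hHfin : lorentzTwoNorm volume (1 / pd d) (‖H ·‖ₑ) < ∞)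
    (hF : IsFun (S (-(m : ℝ)) T) F) (hFB : normB F < ∞)
    (hG₁ : IsFun (S (theta m d) (g : 𝓢'(E d, ℂ))) G₁) (hG₂ : IsFun (S m (g : 𝓢'(E d, ℂ))) G₂) :
    ∫ x, H x * conj (G₁ x) = ∫ x, F x * conj (G₂ x) := by
  have hG₂B : normBStar G₂ < ∞ := by
    rw [← distNorm_eq (fun _ _ ↦ normBStar_congr) hG₂]
    exact (normXStar_lt_top.1 g.2).2
  have hβ : 0 < (d : ℝ) / (d + 1) := by
    have : 0 < (d : ℝ) := by exact_mod_cast two_pos.trans_le hd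
    positivity
  have hneg : -((d : ℝ) / (d + 1)) + -theta m d = -m := by rw [theta]; ring
  have hpos : (d : ℝ) / (d + 1) + theta m d = m := by rw [theta]; ring
  exact integral_mul_conj_eq_integral_mul_conj_of_S hβ (one_div_pos.2 (pd_pos d))
    (one_div_pd_lt_one hd) hH hHfin (by rwa [S_S, hneg]) hFB hG₁
    (lorentzTwoNorm_S_theta_lt_top g hG₁) (by rwa [S_S, hpos]) hG₂B

lemma isPairing_of_isFun_S_neg_theta {T : X d m} {g : XStar d m hd} {F G : E d → ℂ}
    (hF : IsFun (S (-theta m d) (T : 𝓢'(E d, ℂ))) F)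
    (hFfin : lorentzTwoNorm volume (1 / pd d) (‖F ·‖ₑ) < ∞)
    (hG : IsFun (S (theta m d) (g : 𝓢'(E d, ℂ))) G) :
    IsPairing T g (∫ x, F x * conj (G x)) := by
  intro T₁ T₂ F₁ F₂ G₁ G₂ hsum hF₁ hF₁fin hF₂ hF₂B hG₁ hG₂
  rw [lorentzNorm_two_lt_top_iff (pd_pos d)] at hF₁fin
  have hT₂ : S (-theta m d) T₂ = S (-theta m d) (T : 𝓢'(E d, ℂ)) +
      (-1 : ℂ) • S (-theta m d) T₁ := by
    rw [hsum, map_add]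
    module
  have hH : IsFun (S (-theta m d) T₂) (F + (-1 : ℂ) • F₁) := hT₂ ▸ hF.add (hF₁.smul (-1))
  have hHfin : lorentzTwoNorm volume (1 / pd d) (‖(F + (-1 : ℂ) • F₁) ·‖ₑ) < ∞ := by
    refine (lorentzTwoNorm_enorm_add_le _ F ((-1 : ℂ) • F₁)).trans_lt ?_
    simp only [Pi.smul_apply, enorm_smul, enorm_neg, enorm_one, one_mul]
    finiteness
  have hG₁conj : AEStronglyMeasurable (fun x ↦ conj (G₁ x)) :=
    Complex.continuous_conj.comp_aestronglyMeasurable hG₁.1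
  have hG₁fin : lorentzTwoNorm volume (1 - 1 / pd d) (fun x ↦ ‖conj (G₁ x)‖ₑ) < ∞ := by
    simpa only [RCLike.enorm_conj] using lorentzTwoNorm_S_theta_lt_top g hG₁
  rw [← integral_mul_conj_S_theta_eq_integral_mul_conj_S hH hHfin hF₂ hF₂B hG₁ hG₂, ← integral_add
    (integrable_mul_of_lorentzTwoNorm hF₁.1 hG₁conj hF₁fin hG₁fin)
    (integrable_mul_of_lorentzTwoNorm hH.1 hG₁conj hHfin hG₁fin)]
  refine integral_congr_ae ((hG₁.ae_eq hG).mono fun x hx ↦ ?_)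
  simp only [Pi.add_apply, Pi.smul_apply, smul_eq_mul, hx]
  ring

lemma Exponents.lorentzTwoNorm_lintegral_besselMeasure_lt_top (h : Exponents d m c) {k : E d → ℂ}
    (hk : AEStronglyMeasurable k) (hfin : lorentzTwoNorm volume (1 / 2 + c) (‖k ·‖ₑ) < ∞) :
    lorentzTwoNorm volume (1 / pd d)
      (fun x ↦ ∫⁻ y, ‖k (y + x)‖ₑ ∂besselMeasure d (theta m d)) < ∞ := by
  obtain ⟨C, hC⟩ := h.exists_lorentzTwoNorm_lintegral_besselMeasure_le (a := 1 / 2 + c)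
    (b := 1 / pd d) (by linarith [one_div_pd d]) (one_div_pos.2 (pd_pos d))
    (by linarith [h.lt_half])
  exact (hC k hk).trans_lt (ENNReal.mul_lt_top ENNReal.coe_lt_top hfin)

lemma Exponents.integral_besselPotential_mul_conj (h : Exponents d m c) {k G : E d → ℂ}
    (hk : AEStronglyMeasurable k) (hkfin : lorentzTwoNorm volume (1 / 2 + c) (‖k ·‖ₑ) < ∞)
    (hG : AEStronglyMeasurable G) (hGfin : lorentzTwoNorm volume (1 / pd' d) (‖G ·‖ₑ) < ∞) :
    ∫ x, besselPotential (theta m d) k x * conj (G x) =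
      ∫ x, k x * conj (besselPotential (theta m d) G x) := by
  have := isProbabilityMeasure_besselMeasure (d := d) (theta_pos d h.one_le)
  have hGconj : AEStronglyMeasurable (fun x ↦ conj (G x)) :=
    Complex.continuous_conj.comp_aestronglyMeasurable hG
  have hkmeas : AEMeasurable (fun x ↦ ∫⁻ y, ‖k (y + x)‖ₑ ∂besselMeasure d (theta m d)) :=
    (hk.comp_quasiMeasurePreserving
      (quasiMeasurePreserving_add _)).prod_swap.enorm.lintegral_prod_right'
  have hkpot := h.lorentzTwoNorm_lintegral_besselMeasure_lt_top hk hkfin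
  rw [integral_besselPotential_mul (theta_pos d h.one_le) hk hGconj]
  · simp only [besselPotential, integral_conj]
  · refine (lintegral_mul_le_lorentzTwoNorm hkmeas hGconj.enorm (1 / pd d)).trans_lt ?_
    simp only [RCLike.enorm_conj, one_sub_one_div_pd h.two_le]
    finiteness

lemma isPairing_of_isFun (h : Exponents d m c) {T : X d m} {g : XStar d m hd} {k f : E d → ℂ}
    (hT : IsFun (T : 𝓢'(E d, ℂ)) k) (hk : lorentzTwoNorm volume (1 / 2 + c) (‖k ·‖ₑ) < ∞)
    (hg : IsFun (g : 𝓢'(E d, ℂ)) f) : IsPairing T g (∫ x, k x * conj (f x)) := by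
  obtain ⟨G, hG, -⟩ := distNorm_lt_top.1 (normXStar_lt_top.1 g.2).1
  have hpot := (h.memLOneAddLTop hT.1 hk).isFun_S_neg (theta_pos d h.one_le) hT
  have hpotfin : lorentzTwoNorm volume (1 / pd d) (‖besselPotential (theta m d) k ·‖ₑ) < ∞ :=
    (lorentzTwoNorm_mono (.of_forall (enorm_besselPotential_le _ _)) _).trans_lt
      (h.lorentzTwoNorm_lintegral_besselMeasure_lt_top hT.1 hk)
  convert! isPairing_of_isFun_S_neg_theta hpot hpotfin hG using 1
  rw [h.integral_besselPotential_mul_conj hT.1 hk hG.1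
    (lorentzTwoNorm_lt_top_of_normXStar_lt_top hd g.2 hG)]
  have hfG := hg.ae_eq (isFun_besselPotential_of_normXStar_lt_top hd h.one_le g.2 hG)
  exact integral_congr_ae (hfG.mono fun x hx ↦ by simp only [hx])

end Pairing

/-! ### Multiplication operators from `X^*` to `X` -/

section Multiplication

variable {d m : ℕ} {c : ℝ} {hd : 2 ≤ d}

lemma exists_lorentzTwoNorm_mul_le_normXStar (h : Exponents d m c) (b : ℝ) :
    ∃ C : ℝ≥0, ∀ (W : E d → ℂ) K, HasWeakBound volume b K (‖W ·‖ₑ) →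
      ∀ (u : 𝓢'(E d, ℂ)) f, IsFun u f →
        lorentzTwoNorm volume (1 / 2 - c + b) (fun x ↦ ‖W x * f x‖ₑ) ≤
          C * (K * normXStar m u) := by
  obtain ⟨C, hC⟩ := exists_lorentzTwoNorm_le_normXStar h
  refine ⟨(2 ^ (1 / 2 - c + b) : ℝ).toNNReal * C, fun W K hW u f hf ↦ ?_⟩
  refine (hW.lorentzTwoNorm_enorm_mul_le _ f).trans ?_
  rw [ENNReal.coe_mul, mul_assoc, mul_left_comm (C : ℝ≥0∞)]
  gcongr
  · exact le_rfl
  · exact hC u f hf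

lemma exists_normX_le_of_isFun_add (h : Exponents d m c) :
    ∃ C : ℝ≥0, ∀ (W₁ W₂ : E d → ℂ) K₁ K₂, HasWeakBound volume (2 * c) K₁ (‖W₁ ·‖ₑ) →
      HasWeakBound volume c K₂ (‖W₂ ·‖ₑ) → ∀ (u T : 𝓢'(E d, ℂ)) f₁ f₂, IsFun u f₁ →
        AEStronglyMeasurable f₂ → IsFun T (fun x ↦ W₁ x * f₁ x + W₂ x * f₂ x) →
          normX m T ≤ C * (K₁ * normXStar m u + K₂ * eLpNorm f₂ 2 volume) := by
  obtain ⟨C₁, hC₁⟩ := exists_lorentzTwoNorm_mul_le_normXStar h (2 * c)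
  obtain ⟨C₂, hC₂⟩ := exists_normX_le_lorentzTwoNorm h
  rw [show 1 / 2 - c + 2 * c = 1 / 2 + c by ring] at hC₁
  set D : ℝ≥0 := (2 ^ (1 / 2 + c) : ℝ).toNNReal
  refine ⟨C₂ * (D * (C₁ + D)), fun W₁ W₂ K₁ K₂ hW₁ hW₂ u T f₁ f₂ hf₁ hf₂ hT ↦ ?_⟩
  calc normX m T
      ≤ C₂ * lorentzTwoNorm volume (1 / 2 + c) (fun x ↦ ‖W₁ x * f₁ x + W₂ x * f₂ x‖ₑ) := hC₂ T _ hT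
    _ ≤ C₂ * (D * (C₁ * (K₁ * normXStar m u) + D * (K₂ * eLpNorm f₂ 2 volume))) := by
        refine mul_le_mul_right ((lorentzTwoNorm_enorm_add_le _ _ _).trans ?_) _
        gcongr
        · exact le_rfl
        · exact hC₁ W₁ K₁ hW₁ u f₁ hf₁
        · rw [← lorentzTwoNorm_half hf₂]
          exact hW₂.lorentzTwoNorm_enorm_mul_le _ f₂
    _ ≤ C₂ * (D * ((C₁ + D) * (K₁ * normXStar m u) + (C₁ + D) * (K₂ * eLpNorm f₂ 2 volume))) := by
        gcongr
        · exact le_self_add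
        · exact le_add_self
    _ = (C₂ * (D * (C₁ + D)) : ℝ≥0) * (K₁ * normXStar m u + K₂ * eLpNorm f₂ 2 volume) := by
        push_cast
        ring

lemma lorentzTwoNorm_mul_lt_top (h : Exponents d m c) {W : E d → ℂ} {K : ℝ≥0}
    (hW : HasWeakBound volume (2 * c) K (‖W ·‖ₑ)) {u : 𝓢'(E d, ℂ)} (hu : normXStar m u < ∞)
    {f : E d → ℂ} (hf : IsFun u f) :
    lorentzTwoNorm volume (1 / 2 + c) (fun x ↦ ‖W x * f x‖ₑ) < ∞ := by
  obtain ⟨C, hC⟩ := exists_lorentzTwoNorm_mul_le_normXStar h (2 * c)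
  rw [show 1 / 2 - c + 2 * c = 1 / 2 + c by ring] at hC
  exact (hC W K hW u f hf).trans_lt (by finiteness)

lemma exists_normX_le_of_isFun_mul (h : Exponents d m c) {W : E d → ℂ} {K : ℝ≥0}
    (hW : HasWeakBound volume (2 * c) K (‖W ·‖ₑ)) :
    ∃ C : ℝ≥0, ∀ (u T : 𝓢'(E d, ℂ)) f, IsFun u f → IsFun T (fun x ↦ W x * f x) →
      normX m T ≤ C * normXStar m u := by
  obtain ⟨C₁, hC₁⟩ := exists_lorentzTwoNorm_mul_le_normXStar h (2 * c)
  obtain ⟨C₂, hC₂⟩ := exists_normX_le_lorentzTwoNorm h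
  rw [show 1 / 2 - c + 2 * c = 1 / 2 + c by ring] at hC₁
  refine ⟨C₂ * (C₁ * K), fun u T f hf hT ↦ (hC₂ T _ hT).trans ?_⟩
  rw [ENNReal.coe_mul, ENNReal.coe_mul, mul_assoc, mul_assoc]
  gcongr
  exact hC₁ W K hW u f hf

/-- `M : X^* → X` is multiplication by `W`: if `u ∈ X^*` is the function `f`, then `M u` is the
function `W f`. -/
def IsMulOperator (W : E d → ℂ) (M : XStar d m hd →ₗ[ℂ] X d m) : Prop :=
  ∀ (u : XStar d m hd) f, IsFun (u : 𝓢'(E d, ℂ)) f →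
    IsFun (M u : 𝓢'(E d, ℂ)) fun x ↦ W x * f x

lemma exists_isMulOperator (h : Exponents d m c) {W : E d → ℂ} (hWm : AEStronglyMeasurable W)
    {K : ℝ≥0} (hW : HasWeakBound volume (2 * c) K (‖W ·‖ₑ)) :
    ∃ M : XStar d m hd →ₗ[ℂ] X d m, IsMulOperator W M := by
  obtain ⟨C, hC⟩ := exists_normX_le_of_isFun_mul h hW
  choose r hr using fun u : XStar d m hd ↦ exists_isFun_of_normXStar_lt_top hd h.one_le u.2
  choose T hT using fun u : XStar d m hd ↦
    (h.memLOneAddLTop (hWm.mul (hr u).1) (lorentzTwoNorm_mul_lt_top h hW u.2 (hr u))).exists_isFun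
  have hTX (u : XStar d m hd) : T u ∈ X d m := by
    have hu : normXStar m (u : 𝓢'(E d, ℂ)) < ∞ := u.2
    exact (hC u (T u) (r u) (hr u) (hT u)).trans_lt (by finiteness)
  have hTf (u : XStar d m hd) (f) (hf : IsFun (u : 𝓢'(E d, ℂ)) f) :
      IsFun (T u) fun x ↦ W x * f x :=
    (hT u).congr (((hr u).ae_eq hf).mono fun x hx ↦ congrArg (W x * ·) hx)
  refine ⟨⟨⟨fun u ↦ ⟨T u, hTX u⟩, fun u v ↦ Subtype.ext ?_⟩, fun a u ↦ Subtype.ext ?_⟩, hTf⟩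
  · exact (hTf (u + v) _ ((hr u).add (hr v))).dist_ext
      (((hT u).add (hT v)).congr (.of_forall fun x ↦ (mul_add _ _ _).symm))
  · exact (hTf (a • u) _ ((hr u).smul a)).dist_ext
      (((hT u).smul a).congr (.of_forall fun x ↦ mul_left_comm _ _ _))

section

variable {W : E d → ℂ} {M : XStar d m hd →ₗ[ℂ] X d m}

lemma IsMulOperator.exists_normX_le (hM : IsMulOperator W M) (h : Exponents d m c) {K : ℝ≥0}
    (hW : HasWeakBound volume (2 * c) K (‖W ·‖ₑ)) :
    ∃ C : ℝ≥0, ∀ u, normX m (M u : 𝓢'(E d, ℂ)) ≤ C * normXStar m (u : 𝓢'(E d, ℂ)) := by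
  obtain ⟨C, hC⟩ := exists_normX_le_of_isFun_mul h hW
  refine ⟨C, fun u ↦ ?_⟩
  obtain ⟨f, hf⟩ := exists_isFun_of_normXStar_lt_top hd h.one_le u.2
  exact hC u (M u) f hf (hM u f hf)

lemma IsMulOperator.isPairing (hM : IsMulOperator W M) (h : Exponents d m c) {K : ℝ≥0}
    (hW : HasWeakBound volume (2 * c) K (‖W ·‖ₑ)) {u g : XStar d m hd} {f k : E d → ℂ}
    (hf : IsFun (u : 𝓢'(E d, ℂ)) f) (hk : IsFun (g : 𝓢'(E d, ℂ)) k) :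
    IsPairing (M u) g (∫ x, W x * f x * conj (k x)) :=
  isPairing_of_isFun h (hM u f hf) (lorentzTwoNorm_mul_lt_top h hW u.2 hf) hk

lemma IsMulOperator.symmetric {V : E d → ℝ} (hM : IsMulOperator (fun x ↦ (V x : ℂ)) M)
    (h : Exponents d m c) {K : ℝ≥0} (hV : HasWeakBound volume (2 * c) K fun x ↦ ‖(V x : ℂ)‖ₑ)
    (φ ψ : 𝓢(E d, ℂ)) : ∃ z : ℂ,
      IsPairing (M (ofSchwartz m hd φ)) (ofSchwartz m hd ψ) z ∧
      IsPairing (M (ofSchwartz m hd ψ)) (ofSchwartz m hd φ) (conj z) := by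
  refine ⟨_, hM.isPairing h hV (isFun_schwartz φ) (isFun_schwartz ψ), ?_⟩
  convert! hM.isPairing h hV (u := ofSchwartz m hd ψ) (g := ofSchwartz m hd φ)
    (isFun_schwartz ψ) (isFun_schwartz φ) using 1
  rw [← integral_conj]
  congr! 2
  simp only [map_mul, Complex.conj_ofReal, Complex.conj_conj]
  ring

end

end Multiplication

/-! ### The weighted estimate -/

section Weighted

variable {d m : ℕ} {c : ℝ} {hd : 2 ≤ d}

lemma mu_nonneg (N : ℝ) {γ : ℝ} (hγ : 0 < γ) (x : E d) : 0 ≤ mu N γ x := by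
  unfold mu
  positivity

lemma mu_le {N γ R : ℝ} (hN : 0 ≤ N) (hγ : 0 < γ) {x : E d} (hx : ‖x‖ ≤ R) :
    mu N γ x ≤ (1 + R ^ 2) ^ N := by
  have hγx : 0 ≤ γ * ‖x‖ ^ 2 := by positivity
  refine (div_le_self (by positivity) (Real.one_le_rpow (by linarith) hN)).trans ?_
  gcongr

lemma hasWeakBound_mul_mu {φ : E d → ℂ} {M : ℝ≥0} {b R N γ : ℝ} (hM : ∀ x, ‖φ x‖ₑ ≤ M)
    (hφ : ∀ x, R < ‖x‖ → φ x = 0) (hb : 0 ≤ b) (hN : 0 ≤ N) (hγ : 0 < γ) :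
    HasWeakBound volume b
      (M * ENNReal.ofReal ((1 + R ^ 2) ^ N) * volume (Metric.closedBall (0 : E d) R) ^ b)
      (fun x ↦ ‖φ x * (mu N γ x : ℂ)‖ₑ) := by
  refine hasWeakBound_of_support (fun x ↦ ?_)
    (fun x hx ↦ by simp [hφ x (by simpa using hx)]) hb
  obtain hx | hx := le_or_gt ‖x‖ R
  · rw [enorm_mul, ← ofReal_norm (mu N γ x : ℂ), Complex.norm_real,
      Real.norm_of_nonneg (mu_nonneg N hγ x)]
    gcongr
    · exact hM x
    · exact mu_le hN hγ hx
  · simp [hφ x hx]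

lemma IsMulOperator.exists_normX_mulMu_le {W : E d → ℂ} {M : XStar d m hd →ₗ[ℂ] X d m}
    (hM : IsMulOperator W M) (h : Exponents d m c) (hW : IsWeakApproximable (2 * c) W) {ε N : ℝ}
    (hε : 0 < ε) (hN : 0 ≤ N) : ∃ A R : ℝ, 1 ≤ A ∧ 1 ≤ R ∧ ∀ (u : XStar d m hd) (γ : ℝ), 0 < γ →
      normX m (mulMu N γ (M u : 𝓢'(E d, ℂ))) ≤
        ENNReal.ofReal ε * normXStar m (mulMu N γ (u : 𝓢'(E d, ℂ))) +
        ENNReal.ofReal A *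
          distNorm (fun f ↦ eLpNorm f 2 (volume.restrict {x | ‖x‖ ≤ R})) (u : 𝓢'(E d, ℂ)) := by
  obtain ⟨C, hC⟩ := exists_normX_le_of_isFun_add h
  have hη : 0 < ENNReal.ofReal ε / (C + 1) :=
    ENNReal.div_pos (ENNReal.ofReal_pos.2 hε).ne' (by finiteness)
  have hCη : C * (ENNReal.ofReal ε / (C + 1)) ≤ ENNReal.ofReal ε :=
    (mul_le_mul_left le_self_add _).trans_eq (ENNReal.mul_div_cancel (by simp) (by finiteness))
  obtain ⟨φ, B, R, hR, hB, hφ, hweak⟩ := hW _ hη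
  set K : ℝ≥0∞ :=
    B * ENNReal.ofReal ((1 + R ^ 2) ^ N) * volume (Metric.closedBall (0 : E d) R) ^ c
  have hCK : C * K ≠ ∞ := by
    have hball : volume (Metric.closedBall (0 : E d) R) ≠ ∞ := measure_closedBall_lt_top.ne
    have hc := h.pos.le
    finiteness
  refine ⟨max 1 (C * K).toReal, R, le_max_left _ _, hR, fun u γ hγ ↦ ?_⟩
  obtain ⟨f, hf⟩ := exists_isFun_of_normXStar_lt_top hd h.one_le u.2
  have hball : MeasurableSet {x : E d | ‖x‖ ≤ R} :=
    measurableSet_le measurable_norm measurable_const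
  have hsplit (x : E d) : (mu N γ x : ℂ) * (W x * f x) =
      (W x - φ x) * ((mu N γ x : ℂ) * f x) +
        φ x * (mu N γ x : ℂ) * {x : E d | ‖x‖ ≤ R}.indicator f x := by
    by_cases hx : ‖x‖ ≤ R
    · rw [indicator_of_mem (by exact hx)]
      ring
    · rw [hφ x (not_le.1 hx)]
      ring
  have hT := (hM u f hf).mulMu N hγ
  simp_rw [hsplit] at hT
  have hle := hC _ _ _ _ hweak (hasWeakBound_mul_mu hB hφ h.pos.le hN hγ) _ _ _ _ (hf.mulMu N hγ)
    (hf.1.indicator hball) hT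
  rw [eLpNorm_indicator_eq_eLpNorm_restrict hball, mul_add, ← mul_assoc, ← mul_assoc] at hle
  rw [distNorm_eq (fun _ _ h ↦ eLpNorm_congr_ae (ae_restrict_of_ae h)) hf]
  refine hle.trans ?_
  gcongr
  exact (ENNReal.le_ofReal_iff_toReal_le hCK (by positivity)).2 (le_max_right _ _)

end Weighted

/-! ### Factorization through `L²` -/

section Factorization

variable {d m : ℕ} {c : ℝ} {hd : 2 ≤ d}

lemma exists_eLpNorm_two_mul_le_normXStar (h : Exponents d m c) {w : E d → ℂ}
    (hwm : AEStronglyMeasurable w) {K : ℝ≥0} (hw : HasWeakBound volume c K (‖w ·‖ₑ)) :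
    ∃ C : ℝ≥0, ∀ (u : 𝓢'(E d, ℂ)) f, IsFun u f →
      eLpNorm (fun x ↦ w x * f x) 2 volume ≤ C * normXStar m u := by
  obtain ⟨C, hC⟩ := exists_lorentzTwoNorm_mul_le_normXStar h c
  rw [sub_add_cancel] at hC
  refine ⟨C * K, fun u f hf ↦ ?_⟩
  rw [← lorentzTwoNorm_half (f := fun x ↦ w x * f x) (hwm.mul hf.1), ENNReal.coe_mul, mul_assoc]
  exact hC w K hw u f hf

lemma exists_linearMap_L2_mul (h : Exponents d m c) {w : E d → ℂ} (hwm : AEStronglyMeasurable w)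
    {K : ℝ≥0} (hw : HasWeakBound volume c K (‖w ·‖ₑ)) :
    ∃ A : XStar d m hd →ₗ[ℂ] L2 d,
      (∃ C : ℝ≥0, ∀ u, ‖A u‖ₑ ≤ C * normXStar m (u : 𝓢'(E d, ℂ))) ∧
      ∀ (u : XStar d m hd) f, IsFun (u : 𝓢'(E d, ℂ)) f → A u =ᵐ[volume] fun x ↦ w x * f x := by
  obtain ⟨C, hC⟩ := exists_eLpNorm_two_mul_le_normXStar (m := m) h hwm hw
  choose r hr using fun u : XStar d m hd ↦ exists_isFun_of_normXStar_lt_top hd h.one_le u.2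
  have hmem (u : XStar d m hd) : MemLp (fun x ↦ w x * r u x) 2 := by
    have hu : normXStar m (u : 𝓢'(E d, ℂ)) < ∞ := u.2
    exact ⟨hwm.mul (hr u).1, (hC u _ (hr u)).trans_lt (by finiteness)⟩
  set A : XStar d m hd → L2 d := fun u ↦ (hmem u).toLp _
  have hA (u : XStar d m hd) (f) (hf : IsFun (u : 𝓢'(E d, ℂ)) f) :
      A u =ᵐ[volume] fun x ↦ w x * f x :=
    (MemLp.coeFn_toLp _).trans (((hr u).ae_eq hf).mono fun x hx ↦ congrArg (w x * ·) hx)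
  refine ⟨⟨⟨A, fun u v ↦ Lp.ext ?_⟩, fun a u ↦ Lp.ext ?_⟩, ⟨C, fun u ↦ ?_⟩, hA⟩
  · filter_upwards [hA (u + v) _ ((hr u).add (hr v)), hA u _ (hr u), hA v _ (hr v),
      Lp.coeFn_add (A u) (A v)] with x huv hu hv hadd
    rw [huv, hadd, Pi.add_apply, Pi.add_apply, hu, hv, mul_add]
  · filter_upwards [hA (a • u) _ ((hr u).smul a), hA u _ (hr u),
      Lp.coeFn_smul a (A u)] with x hau hu hsmul
    rw [hau, RingHom.id_apply, hsmul, Pi.smul_apply, Pi.smul_apply, hu, smul_eq_mul, smul_eq_mul,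
      mul_left_comm]
  · exact (Lp.enorm_toLp (hf := hmem u)).trans_le (hC u _ (hr u))

lemma IsMulOperator.exists_factorization {W v w : E d → ℂ} {M : XStar d m hd →ₗ[ℂ] X d m}
    (hM : IsMulOperator W M) (h : Exponents d m c) {K K' : ℝ≥0}
    (hW : HasWeakBound volume (2 * c) K (‖W ·‖ₑ)) (hvm : AEStronglyMeasurable v)
    (hv : HasWeakBound volume c K' (‖v ·‖ₑ)) (hwm : AEStronglyMeasurable w)
    (hw : HasWeakBound volume c K' (‖w ·‖ₑ)) (hvw : ∀ x, v x * conj (w x) = W x) :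
    ∃ A B : XStar d m hd →ₗ[ℂ] L2 d,
      (∃ C : ℝ≥0, ∀ u, ‖A u‖ₑ ≤ C * normXStar m (u : 𝓢'(E d, ℂ)) ∧
        ‖B u‖ₑ ≤ C * normXStar m (u : 𝓢'(E d, ℂ))) ∧
      ∀ f g : XStar d m hd, IsPairing (M f) g (inner ℂ (A g) (B f)) := by
  obtain ⟨A, ⟨CA, hCA⟩, hA⟩ := exists_linearMap_L2_mul (hd := hd) h hwm hw
  obtain ⟨B, ⟨CB, hCB⟩, hB⟩ := exists_linearMap_L2_mul (hd := hd) h hvm hv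
  refine ⟨A, B, ⟨max CA CB, fun u ↦ ⟨(hCA u).trans ?_, (hCB u).trans ?_⟩⟩, fun u g ↦ ?_⟩
  · gcongr
    exact le_max_left _ _
  · gcongr
    exact le_max_right _ _
  · obtain ⟨f, hf⟩ := exists_isFun_of_normXStar_lt_top hd h.one_le u.2
    obtain ⟨k, hk⟩ := exists_isFun_of_normXStar_lt_top hd h.one_le g.2
    convert! hM.isPairing h hW hf hk using 1
    rw [L2.inner_def]
    refine integral_congr_ae ?_
    filter_upwards [hA g k hk, hB u f hf] with x hAx hBx
    rw [hAx, hBx, ← hvw, RCLike.inner_apply, map_mul]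
    ring

lemma enorm_ofReal_sqrt_abs (a : ℝ) : ‖((√|a| : ℝ) : ℂ)‖ₑ = ‖(a : ℂ)‖ₑ ^ (1 / 2 : ℝ) := by
  rw [← ofReal_norm, ← ofReal_norm, Complex.norm_real, Complex.norm_real,
    Real.norm_of_nonneg (Real.sqrt_nonneg _), Real.norm_eq_abs, Real.sqrt_eq_rpow,
    ENNReal.ofReal_rpow_of_nonneg (abs_nonneg _) (by positivity)]

lemma enorm_ofReal_div_sqrt_abs (a : ℝ) :
    ‖((a / √|a| : ℝ) : ℂ)‖ₑ = ‖(a : ℂ)‖ₑ ^ (1 / 2 : ℝ) := by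
  rw [← enorm_ofReal_sqrt_abs, ← ofReal_norm, ← ofReal_norm, Complex.norm_real, Complex.norm_real,
    norm_div, Real.norm_of_nonneg (Real.sqrt_nonneg _), Real.norm_eq_abs, Real.div_sqrt]

lemma ofReal_div_sqrt_abs_mul_conj (a : ℝ) :
    ((a / √|a| : ℝ) : ℂ) * conj ((√|a| : ℝ) : ℂ) = a := by
  rw [Complex.conj_ofReal, ← Complex.ofReal_mul]
  obtain rfl | ha := eq_or_ne a 0
  · simp
  · rw [div_mul_cancel₀ _ (Real.sqrt_pos.2 (abs_pos.2 ha)).ne']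

lemma isAdmissiblePotential_of_isWeakApproximable (h : Exponents d m c) {V : E d → ℝ}
    (hVm : AEMeasurable V) (hV : IsWeakApproximable (2 * c) fun x ↦ (V x : ℂ)) :
    IsAdmissiblePotential m hd V := by
  obtain ⟨K, hK⟩ := hV.exists_hasWeakBound (mul_nonneg zero_le_two h.pos.le)
  obtain ⟨M, hM⟩ := exists_isMulOperator (hd := hd) h
    (Complex.measurable_ofReal.comp_aemeasurable hVm).aestronglyMeasurable hK
  have hsqrt : AEMeasurable (fun x ↦ √|V x|) :=
    Real.continuous_sqrt.measurable.comp_aemeasurable hVm.abs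
  have hroot : HasWeakBound volume c (K ^ (1 / 2 : ℝ) : ℝ≥0)
      fun x ↦ ‖(V x : ℂ)‖ₑ ^ (1 / 2 : ℝ) := by
    rw [ENNReal.coe_rpow_of_nonneg _ (by positivity)]
    simpa only [one_div, mul_comm (2 : ℝ), mul_inv_cancel_right₀ (two_ne_zero' ℝ)] using
      hK.rpow (c := 1 / 2) (by positivity)
  obtain ⟨A, B, ⟨C, hC⟩, hAB⟩ := hM.exists_factorization (w := fun x ↦ ((√|V x| : ℝ) : ℂ))
    (v := fun x ↦ ((V x / √|V x| : ℝ) : ℂ)) h hK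
    (Complex.measurable_ofReal.comp_aemeasurable (hVm.div hsqrt)).aestronglyMeasurable
    (by simpa only [enorm_ofReal_div_sqrt_abs] using hroot)
    (Complex.measurable_ofReal.comp_aemeasurable hsqrt).aestronglyMeasurable
    (by simpa only [enorm_ofReal_sqrt_abs] using hroot)
    fun x ↦ ofReal_div_sqrt_abs_mul_conj (V x)
  refine ⟨M, fun u ↦ ?_, ?_⟩
  · obtain ⟨f, hf⟩ := exists_isFun_of_normXStar_lt_top hd h.one_le u.2
    exact ⟨f, hf, hM u f hf⟩
  · refine ⟨hM.exists_normX_le h hK, hM.symmetric h hK, fun ε N hε hN ↦ ?_, 1, fun _ ↦ A, fun _ ↦ B,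
      le_rfl, ⟨C, fun _ ↦ hC⟩, fun f g ↦ ?_⟩
    · obtain ⟨A₀, R, hA₀, hR, hle⟩ := hM.exists_normX_mulMu_le h hV hε hN
      exact ⟨A₀, R, hA₀, hR, fun u γ hγ _ ↦ hle u γ hγ⟩
    · simpa only [Finset.univ_unique, Finset.sum_singleton] using hAB f g

end Factorization

end HighOrderSchrodinger

theorem mainTheorem4 (d m : ℕ) (hd : 2 ≤ d) (hm : 1 ≤ m) (q : ℝ) (hq : 1 < q)
    (hq_lower : (d : ℝ) / (2 * m) ≤ q) (hq_upper : q ≤ ((d : ℝ) + 1) / 2)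
    (V : HighOrderSchrodinger.E d → ℝ)
    (hV : HighOrderSchrodinger.MemWeakZero q (fun x ↦ (V x : ℂ))) :
    HighOrderSchrodinger.IsAdmissiblePotential m hd V := by
  have hexp := HighOrderSchrodinger.exponents_one_div_two_mul hd hm hq hq_lower hq_upper
  have hVm : AEMeasurable V := by
    simpa only [Function.comp_def, Complex.ofReal_re] using
      Complex.measurable_re.comp_aemeasurable hV.1.aemeasurable
  have happrox := hV.isWeakApproximable (zero_lt_one.trans hq)
  rw [show 1 / q = 2 * (1 / (2 * q)) by field_simp] at happrox
  exact HighOrderSchrodinger.isAdmissiblePotential_of_isWeakApproximable hexp hVm happrox
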